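/- **Setting.** There are $n$ agents with demands $\mathbf d_i\in\mathbb R^m$ and differentiable costs $F_i:\mathbb R^m\to\mathbb R$, each $\frac1L$-strongly convex ($L>0$), and no local constraints ($\mathcal W_i=\mathbb R^m$). The problem is to minimize $\sum_iF_i(\mathbf w_i)$ subject to $\sum_i\mathbf w_i=\sum_i\mathbf d_i=:\mathbf d$. Its dual objective is $f(\mathbf x)=\sum_i\big(F_i^*(-\mathbf x)+\mathbf x^\top\mathbf d_i\big)$, where $F_i^*$ is the convex conjugate, and $f^*=\inf f$. The matrices $\mathbf R,\mathbf C\in\mathbb R^{n\times n}$ are non-negative, $\mathbf R\mathbf 1=\mathbf 1$, $\mathbf 1^\top\mathbf C=\mathbf 1^\top$. The digraph of a matrix $M$ has an edge $j\to i$ iff $M_{ij}>0$; some agent with positive self-weights $r_{ii},c_{ii}$ is the root of a spanning tree both of the digraph of $\mathbf R$ and of that of $\mathbf C^\top$. Let $\pi_{\mathbf R},\pi_{\mathbf C}\ge 0$ satisfy $\pi_{\mathbf R}^\top\mathbf R=\pi_{\mathbf R}^\top$, $\mathbf C\pi_{\mathbf C}=\pi_{\mathbf C}$, $\mathbf 1^\top\pi_{\mathbf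 R}=\mathbf 1^\top\pi_{\mathbf C}=1$, and put $\varpi=\pi_{\mathbf C}^\top\pi_{\mathbf R}$. **Algorithm (ET-DGT).** With step size $\alpha>0$, $\tilde{\mathbf w}_{i,0}=0$, $\mathbf w_{i,k}=\arg\min_{\mathbf w}\{F_i(\mathbf w)-\tilde{\mathbf w}_{i,k}^\top\mathbf w\}$ for all $k\ge0$, $\mathbf s_{i,0}=\mathbf d_i-\mathbf w_{i,0}$, $$\tilde{\mathbf w}_{i,k+1}=\tilde{\mathbf w}_{i,k}+\sum_jr_{ij}(\hat{\mathbf w}_{j,k}-\hat{\mathbf w}_{i,k})+\alpha\mathbf s_{i,k},\qquad \mathbf s_{i,k+1}=\mathbf s_{i,k}+\sum_jc_{ij}\hat{\mathbf s}_{j,k}-\hat{\mathbf s}_{i,k}-(\mathbf w_{i,k+1}-\mathbf w_{i,k}).$$ Here $\hat{\mathbf w}_{i}$, $\hat{\mathbf s}_i$ are the last broadcast values of $\tilde{\mathbf w}_i$, $\mathbf s_i$: both are broadcast at $k=0$, and then at every $k$ at which the current value differs in norm from the last broadcast one by at least $e_{\tilde{\mathbf w}_i,k}$, respectively $e_{\mathbf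 s_i,k}$. The sequence $e_k=\max_i\max(e_{\tilde{\mathbf w}_i,k},e_{\mathbf s_i,k})$ is non-increasing and summable. Write $\mathbf W_k$, $\mathbf X_k$, $\mathbf Y_k$ for the $n\times m$ matrices with rows $\mathbf w_{i,k}$, $-\tilde{\mathbf w}_{i,k}$, $\mathbf s_{i,k}$, and $\bar{\mathbf x}_k=\mathbf X_k^\top\pi_{\mathbf R}$, $\hat{\mathbf y}_k=\mathbf Y_k^\top\mathbf 1$, $\overline{\nabla F}_k=\frac1n\sum_i\nabla F_i(\mathbf w_{i,k})$. **Norms.** For invertible $T$ let $\|x\|_T=\|Tx\|_2$ on vectors, $\|A\|_T=\|TAT^{-1}\|_2$ on square matrices, $\|X\|_T=\|TX\|_F$ on $n\times m$ matrices. **Claim.** For all $\mathbf R,\mathbf C$ as above and every $\varepsilon>0$ there are norms $\|\cdot\|_{\mathbf R},\|\cdot\|_{\mathbf C}$ of this kind (depending only on $\mathbf R,\mathbf C,\varepsilon$) with $\|\cdot\|_{\mathbf R},\|\cdot\|_{\mathbf C}\le\|\cdot\|_2$ on vectors, such that $\sigma_{\mathbf R}=\|\mathbf R-\mathbf 1\pi_{\mathbf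 R}^\top\|_{\mathbf R}<1$ and $\sigma_{\mathbf C}=\|\mathbf C-\pi_{\mathbf C}\mathbf 1^\top\|_{\mathbf C}<1$ exceed the spectral radii of these matrices by less than $\varepsilon$, and such that the following holds for all constants $\delta$ with $\|\cdot\|_{\mathbf R}\le\delta_{\mathbf R,\mathbf C}\|\cdot\|_{\mathbf C}$, $\|\cdot\|_{\mathbf C}\le\delta_{\mathbf C,\mathbf R}\|\cdot\|_{\mathbf R}$, $\|\cdot\|_2\le\delta_{2,R}\|\cdot\|_{\mathbf R}$, $\|\cdot\|_2\le\delta_{2,C}\|\cdot\|_{\mathbf C}$, and for all problem data, thresholds and step sizes. *(1) Sublinear rate.* Let $$P=\begin{bmatrix}\sigma_{\mathbf R}+\alpha\sqrt nL&\alpha\delta_{\mathbf R,\mathbf C}\\(2+\alpha\sqrt nL)L\delta_{\mathbf C,\mathbf R}&\sigma_{\mathbf C}+\alpha L\end{bmatrix},$$ let $\lambda$ be its spectral radius, $0<\psi\le\Psi=\sqrt{(p_{11}-p_{22})^2+4p_{12}p_{21}}$, $c_3=\|\mathbf Y_0-\pi_{\mathbf C}\hat{\mathbf y}_0^\top\|_{\mathbf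 C}$, $c_0=c_3/\psi$, $c_1=1+L/\psi$, $c_2=[1+\sigma_{\mathbf R}+(2L+1+\sigma_{\mathbf C})/\psi]\sqrt n$, $c_4=L+(2L\delta_{\mathbf C,\mathbf R}+L)/\psi$, $c_5=[1+\sigma_{\mathbf C}+2L+(1-\sigma_{\mathbf R})(2L\delta_{\mathbf C,\mathbf R}+L)/\psi]\sqrt n$, $b_1=L\sqrt n\,\varpi\,\delta_{2,R}$, $b_2=\delta_{2,C}$, $b_3=3L\delta_{2,C}^2$, $b_4=3L^3n\varpi^2\delta_{2,R}^2$. If $$\alpha<\min\Big\{\tfrac{(1-\sigma_{\mathbf R})(1-\sigma_{\mathbf C})}{(\sqrt nL+\sqrt n+3)L\delta_{\mathbf R,\mathbf C}\delta_{\mathbf C,\mathbf R}},\tfrac1{\delta_{\mathbf R,\mathbf C}}\Big\}$$ and $$\alpha<\Big[\tfrac{3L\varpi^2}2+\tfrac{c_1b_1+c_4b_2+c_0b_1+c_3b_2}{1-\lambda}+\tfrac{c_1^2b_3+c_4^2b_4}{(1-\lambda)^2}+\tfrac{c_2b_1+c_5b_2}2\Big]^{-1}\varpi,$$ then for all $k\ge1$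 $$\frac1k\sum_{t=0}^{k-1}\Big[\sum_{i=1}^n\|\nabla F_i(\mathbf w_{i,t})-\overline{\nabla F}_t\|^2+\Big\|\sum_{i=1}^n\mathbf w_{i,t}-\mathbf d\Big\|^2\Big]\le\frac2k\sum_{t=0}^{k-1}\|\nabla f(\bar{\mathbf x}_t)\|^2+\frac{2n^2(1+L^2)}k\sum_{t=0}^{k-1}\|\mathbf X_t-\mathbf 1\bar{\mathbf x}_t^\top\|_F^2,$$ and the right-hand side is $\mathcal O(1/k)$. *(2) Linear rate.* Suppose moreover that every $\nabla F_i$ is $\mu$-Lipschitz, $\mu>0$; put $\beta=n/\mu$, $\kappa=\frac{1+\sigma_{\mathbf C}^2}{1-\sigma_{\mathbf C}^2}$, $\tau=\frac{(1-\sigma_{\mathbf R}^2)^2}{1+\sigma_{\mathbf R}^2}$ and $d_1=4nL^2$, $d_2=2\frac{3-\sigma_{\mathbf R}^2}{1-\sigma_{\mathbf R}^2}\delta_{\mathbf R,\mathbf C}^2$, $d_3=8nL$, $d_4=32\kappa L^2\delta_{\mathbf C,\mathbf R}^2$, $d_5=16\kappa nL^4\delta_{\mathbf C,\mathbf R}^2$,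 $d_6=8\kappa L^2$, $d_7=32\kappa nL^3$, $d_8=\frac12L^2n\varpi^2\delta_{2,R}^2$, $d_9=\frac32L^3n\varpi^2\delta_{2,R}^2$, $d_{10}=\frac12\delta_{2,C}^2$, $d_{11}=\frac{3L}2\delta_{2,C}^2$, $d_{12}=2\beta\varpi$, $d_{13}=2L+3\varpi^2L^2$, $$P=\begin{bmatrix}\frac{3\sigma_{\mathbf R}^2-\sigma_{\mathbf R}^4}{1+\sigma_{\mathbf R}^2}+d_1\alpha^2&d_2\alpha^2&d_3\alpha^2\\d_4+d_5\alpha^2&\frac{1+\sigma_{\mathbf C}^2}2+d_6\alpha^2&d_7\alpha^2\\d_8+d_9\alpha^2&d_{10}+d_{11}\alpha^2&1-d_{12}\alpha+d_{13}\alpha^2\end{bmatrix},\qquad\lambda=\rho(P),$$ $h_1=\frac{\tau(1-\sigma_{\mathbf C}^2)}{16}d_{12}$, $h_2=\frac{\tau(1-\sigma_{\mathbf C}^2)}{16}d_{13}+d_3d_4d_{10}+\frac{1-\sigma_{\mathbf C}^2}2d_3d_8+\tau d_7d_{10}$, $h_3=d_2d_4d_{12}$, $h_4=d_2d_7d_8+d_3d_5d_{10}+d_3d_4d_{11}+\frac{1-\sigma_{\mathbf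 C}^2}2d_3d_9+\tau d_7d_{11}+d_2d_5d_{12}$, $h_5=d_2d_5d_{13}$, $h_6=d_2d_7d_9+d_3d_5d_{11}$, $H=h_3+h_4+h_5+h_6$, $$h_7=\Big[\tfrac{3+\sigma_{\mathbf R}^2}{1+\sigma_{\mathbf R}^2}(1+\sigma_{\mathbf R})^2+2\kappa\big((1+\sigma_{\mathbf C})^2+4(1+\sigma_{\mathbf R})^2\delta_{\mathbf C,\mathbf R}^2L^2\big)\Big]n,\qquad h_8=\sqrt3\,\frac{\max_i\nu_i}{\min_i\nu_i},$$ where $\nu$ is a positive eigenvector of $P$ for the eigenvalue $\lambda$. Suppose $$\alpha<\min\Big\{\tfrac1{d_{12}},\tfrac{1-\sigma_{\mathbf R}^2}{4\sqrt nL\sqrt{1+\sigma_{\mathbf R}^2}},\tfrac{1-\sigma_{\mathbf C}^2}{4\sqrt2L\sqrt{1+\sigma_{\mathbf C}^2}},\tfrac{2\beta\varpi}{2L+3L^2\varpi^2},\tfrac{-h_2+\sqrt{h_2^2+4h_1H}}{2H}\Big\}.$$ Then $\lambda<1$ if $\alpha<1$. Moreover, if $e_k\le Es^k$ for all $k$,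 where $s\in(\sqrt\lambda,1)$ and $E^2\ge\|\mathbf z_0\|(s^2-\lambda)/h_7$ with $\mathbf z_0=\big[\|\mathbf X_0-\mathbf 1\bar{\mathbf x}_0^\top\|_{\mathbf R}^2,\ \|\mathbf Y_0-\pi_{\mathbf C}\hat{\mathbf y}_0^\top\|_{\mathbf C}^2,\ f(\bar{\mathbf x}_0)-f^*\big]^\top$, then for the optimal solution $\mathbf W^*$ and all $k\ge0$ $$\|\mathbf W_k-\mathbf W^*\|_F^2\le2\sqrt2\,L\,\frac{h_7h_8E^2s^{2k}}{s^2-\lambda}.$$ -/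

import Mathlib

open scoped BigOperators InnerProductSpace

noncomputable section

namespace ETDGT

/-! ## Communication network -/

/-- `r` is the root of a spanning tree of the digraph induced by the weight matrix `M`, in which
there is an edge `j → i` exactly when agent `i` weighs agent `j` positively (`0 < M i j`). -/
def IsRoot {n : ℕ} (M : Matrix (Fin n) (Fin n) ℝ) (r : Fin n) : Prop :=
  ∀ i, Relation.ReflTransGen (fun j i => 0 < M i j) r i

/-- `R` is row-stochastic, `C` is column-stochastic, and some agent with positive self-weights is
the root of a spanning tree both of the digraph induced by `R` and of the one induced by `Cᵀ`. -/
structure Network {n : ℕ} (R C : Matrix (Fin n) (Fin n) ℝ) : Prop where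
  R_nonneg : ∀ i j, 0 ≤ R i j
  R_row : ∀ i, ∑ j, R i j = 1
  C_nonneg : ∀ i j, 0 ≤ C i j
  C_col : ∀ j, ∑ i, C i j = 1
  common_root : ∃ r, IsRoot R r ∧ IsRoot C.transpose r ∧ 0 < R r r ∧ 0 < C r r

/-- `pR` is the non-negative left eigenvector of `R` for the eigenvalue `1`, and `pC` the
non-negative right eigenvector of `C` for the eigenvalue `1`, both of total mass `1`. -/
structure PerronPair {n : ℕ} (R C : Matrix (Fin n) (Fin n) ℝ) (pR pC : Fin n → ℝ) : Prop where
  R_nonneg : ∀ i, 0 ≤ pR i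
  R_eigen : Matrix.vecMul pR R = pR
  R_sum : ∑ i, pR i = 1
  C_nonneg : ∀ i, 0 ≤ pC i
  C_eigen : Matrix.mulVec C pC = pC
  C_sum : ∑ i, pC i = 1

/-! ## Norms -/

/-- The spectral radius of a real square matrix. -/
def rho {q : ℕ} (A : Matrix (Fin q) (Fin q) ℝ) : ℝ :=
  (spectralRadius ℂ (A.map (fun x : ℝ => (x : ℂ)))).toReal

/-- The Euclidean norm of a vector. -/
def l2 {q : ℕ} (x : Fin q → ℝ) : ℝ := ‖(WithLp.toLp 2 x : EuclideanSpace ℝ (Fin q))‖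

/-- The vector norm `x ↦ ‖T x‖₂` associated with an invertible matrix `T`. -/
def vecNorm {n : ℕ} (T : Matrix (Fin n) (Fin n) ℝ) (x : Fin n → ℝ) : ℝ := l2 (Matrix.mulVec T x)

/-- The matrix norm induced by `vecNorm T` on square matrices: `‖A‖ = ‖T A T⁻¹‖₂`. -/
def opNorm {n : ℕ} (T A : Matrix (Fin n) (Fin n) ℝ) : ℝ :=
  ‖Matrix.toEuclideanCLM (n := Fin n) (𝕜 := ℝ) (T * A * T⁻¹)‖

/-- The norm of an `n × m` matrix `X` with rows `X i`, that is `‖T X‖_F`; equivalently, the `ℓ²`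
norm of the `vecNorm T`-norms of its columns. -/
def matNorm {n m : ℕ} (T : Matrix (Fin n) (Fin n) ℝ) (X : Fin n → EuclideanSpace ℝ (Fin m)) : ℝ :=
  Real.sqrt (∑ a, ‖∑ b, T a b • X b‖ ^ 2)

/-- `R - 1 pRᵀ`. -/
def devR {n : ℕ} (R : Matrix (Fin n) (Fin n) ℝ) (pR : Fin n → ℝ) : Matrix (Fin n) (Fin n) ℝ :=
  R - Matrix.vecMulVec (fun _ => 1) pR

/-- `C - pC 1ᵀ`. -/
def devC {n : ℕ} (C : Matrix (Fin n) (Fin n) ℝ) (pC : Fin n → ℝ) : Matrix (Fin n) (Fin n) ℝ :=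
  C - Matrix.vecMulVec pC (fun _ => 1)

/-- The norms given by `TR` and `TC` make `R - 1 pRᵀ` and `C - pC 1ᵀ` contractions, with factors
exceeding the spectral radii by less than `ε`, and are dominated by the Euclidean norm. -/
structure ContractionNorms {n : ℕ} (R C : Matrix (Fin n) (Fin n) ℝ) (pR pC : Fin n → ℝ) (ε : ℝ)
    (TR TC : Matrix (Fin n) (Fin n) ℝ) : Prop where
  TR_inv : IsUnit TR.det
  TC_inv : IsUnit TC.det
  R_contr : opNorm TR (devR R pR) < 1
  C_contr : opNorm TC (devC C pC) < 1
  R_close : opNorm TR (devR R pR) < rho (devR R pR) + ε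
  C_close : opNorm TC (devC C pC) < rho (devC C pC) + ε
  R_le : ∀ x, vecNorm TR x ≤ l2 x
  C_le : ∀ x, vecNorm TC x ≤ l2 x

/-- `a`, `b`, `p`, `q` are norm-equivalence constants `δ_{R,C}`, `δ_{C,R}`, `δ_{2,R}`,
`δ_{2,C}`. -/
structure EquivConsts {n : ℕ} (TR TC : Matrix (Fin n) (Fin n) ℝ) (a b p q : ℝ) : Prop where
  RC : ∀ x, vecNorm TR x ≤ a * vecNorm TC x
  CR : ∀ x, vecNorm TC x ≤ b * vecNorm TR x
  twoR : ∀ x, l2 x ≤ p * vecNorm TR x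
  twoC : ∀ x, l2 x ≤ q * vecNorm TC x

/-! ## Primal and dual problem -/

/-- `W` is an optimal solution of the resource allocation problem
`min ∑ F_i(w_i)` subject to `∑ w_i = ∑ d_i`. -/
def IsOptimal {n m : ℕ} (F : Fin n → EuclideanSpace ℝ (Fin m) → ℝ)
    (d W : Fin n → EuclideanSpace ℝ (Fin m)) : Prop :=
  ∑ i, W i = ∑ i, d i ∧
    ∀ V : Fin n → EuclideanSpace ℝ (Fin m), ∑ i, V i = ∑ i, d i → ∑ i, F i (W i) ≤ ∑ i, F i (V i)

/-- The convex conjugate. -/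
def conj {m : ℕ} (F : EuclideanSpace ℝ (Fin m) → ℝ) (x : EuclideanSpace ℝ (Fin m)) : ℝ :=
  ⨆ w, (⟪x, w⟫_ℝ - F w)

/-- The global dual objective `f(x) = ∑ (F_i^*(-x) + xᵀ d_i)`. -/
def dual {n m : ℕ} (F : Fin n → EuclideanSpace ℝ (Fin m) → ℝ)
    (d : Fin n → EuclideanSpace ℝ (Fin m)) (x : EuclideanSpace ℝ (Fin m)) : ℝ :=
  ∑ i, (conj (F i) (-x) + ⟪x, d i⟫_ℝ)

/-! ## The algorithm -/

/-- The maximal triggering threshold `e_k` over all agents and both broadcast variables. -/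
def eMax {n : ℕ} (ew es : ℕ → Fin n → ℝ) (k : ℕ) : ℝ := ⨆ i, max (ew k i) (es k i)

/-- `v k i` is the value last broadcast by agent `i` up to time `k`, when its state is `u k i`, it
broadcasts at time `0`, and from then on whenever the state differs from the value last broadcast
by at least the threshold `e k i`. -/
structure EventTriggered {n m : ℕ} (e : ℕ → Fin n → ℝ)
    (u v : ℕ → Fin n → EuclideanSpace ℝ (Fin m)) : Prop where
  init : ∀ i, v 0 i = u 0 i
  trigger : ∀ k i, e (k + 1) i ≤ ‖u (k + 1) i - v k i‖ → v (k + 1) i = u (k + 1) i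
  hold : ∀ k i, ‖u (k + 1) i - v k i‖ < e (k + 1) i → v (k + 1) i = v k i

/-- The sequences generated by event-triggered dual gradient tracking without local constraints:
`wt` are the dual estimates, `w` the primal variables, `s` the gradient trackers, and `wh`, `sh`
the broadcast values of `wt` and `s`. -/
structure IsRun {n m : ℕ} (R C : Matrix (Fin n) (Fin n) ℝ)
    (F : Fin n → EuclideanSpace ℝ (Fin m) → ℝ) (d : Fin n → EuclideanSpace ℝ (Fin m))
    (α : ℝ) (ew es : ℕ → Fin n → ℝ)
    (wt w s wh sh : ℕ → Fin n → EuclideanSpace ℝ (Fin m)) : Prop where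
  wt_init : ∀ i, wt 0 i = 0
  s_init : ∀ i, s 0 i = d i - w 0 i
  argmin : ∀ k i, IsMinOn (fun v => F i v - ⟪wt k i, v⟫_ℝ) Set.univ (w k i)
  wt_step : ∀ k i, wt (k + 1) i = wt k i + ∑ j, R i j • (wh k j - wh k i) + α • s k i
  s_step : ∀ k i, s (k + 1) i =
    s k i + (∑ j, C i j • sh k j - sh k i) - (w (k + 1) i - w k i)
  wh_trig : EventTriggered ew wt wh
  sh_trig : EventTriggered es s sh

/-- The weighted average `x̄_k = X_kᵀ pR`, where `X_k = -wt_k`. -/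
def xbar {n m : ℕ} (pR : Fin n → ℝ) (wt : ℕ → Fin n → EuclideanSpace ℝ (Fin m)) (k : ℕ) :
    EuclideanSpace ℝ (Fin m) :=
  ∑ i, pR i • (-wt k i)

/-- The consensus error `X_k - 1 x̄_kᵀ`. -/
def xErr {n m : ℕ} (pR : Fin n → ℝ) (wt : ℕ → Fin n → EuclideanSpace ℝ (Fin m)) (k : ℕ) :
    Fin n → EuclideanSpace ℝ (Fin m) :=
  fun i => -wt k i - xbar pR wt k

/-- The tracking error `Y_k - pC ŷ_kᵀ`, where `Y_k = s_k` and `ŷ_k = Y_kᵀ 1`. -/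
def yErr {n m : ℕ} (pC : Fin n → ℝ) (s : ℕ → Fin n → EuclideanSpace ℝ (Fin m)) (k : ℕ) :
    Fin n → EuclideanSpace ℝ (Fin m) :=
  fun i => s k i - pC i • ∑ j, s k j

/-- The average cost gradient at time `k`. -/
def gradAvg {n m : ℕ} (F : Fin n → EuclideanSpace ℝ (Fin m) → ℝ)
    (w : ℕ → Fin n → EuclideanSpace ℝ (Fin m)) (k : ℕ) : EuclideanSpace ℝ (Fin m) :=
  (n : ℝ)⁻¹ • ∑ i, gradient (F i) (w k i)

/-- The gradient disagreement plus the supply-demand violation at time `k`. -/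
def kktResidual {n m : ℕ} (F : Fin n → EuclideanSpace ℝ (Fin m) → ℝ)
    (d : Fin n → EuclideanSpace ℝ (Fin m)) (w : ℕ → Fin n → EuclideanSpace ℝ (Fin m)) (k : ℕ) : ℝ :=
  ∑ i, ‖gradient (F i) (w k i) - gradAvg F w k‖ ^ 2 + ‖∑ i, w k i - ∑ i, d i‖ ^ 2

/-! ## Explicit constants -/

/-- The data on which the explicit constants depend: the number of agents, the smoothness constant
of the dual terms, the contraction factors and equivalence constants of the two norms, and the
inner product `ϖ = pCᵀ pR`. -/
structure Data where
  n : ℕ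
  L : ℝ
  σR : ℝ
  σC : ℝ
  δRC : ℝ
  δCR : ℝ
  δ2R : ℝ
  δ2C : ℝ
  ϖ : ℝ

namespace Data

variable (c : Data)

/-- The `2 × 2` matrix governing consensus and tracking errors. -/
def P₁ (α : ℝ) : Matrix (Fin 2) (Fin 2) ℝ :=
  !![c.σR + α * √c.n * c.L, α * c.δRC;
     (2 + α * √c.n * c.L) * c.L * c.δCR, c.σC + α * c.L]

/-- `Ψ = √((p₁₁ - p₂₂)² + 4 p₁₂ p₂₁)`, the gap between the two eigenvalues of `P₁`. -/
def Ψ (α : ℝ) : ℝ :=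
  √((c.P₁ α 0 0 - c.P₁ α 1 1) ^ 2 + 4 * c.P₁ α 0 1 * c.P₁ α 1 0)

def b₁ : ℝ := c.L * √c.n * c.ϖ * c.δ2R
def b₂ : ℝ := c.δ2C
def b₃ : ℝ := 3 * c.L * c.δ2C ^ 2
def b₄ : ℝ := 3 * c.L ^ 3 * c.n * c.ϖ ^ 2 * c.δ2R ^ 2

/-- In the next six constants `ψ` is the lower bound of `Ψ` and `y₀` the norm of the initial
tracking error. -/
def c₀ (ψ y₀ : ℝ) : ℝ := y₀ / ψ
def c₁ (ψ : ℝ) : ℝ := 1 + c.L / ψ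
def c₂ (ψ : ℝ) : ℝ := (1 + c.σR + (2 * c.L + 1 + c.σC) / ψ) * √c.n
def c₃ (y₀ : ℝ) : ℝ := y₀
def c₄ (ψ : ℝ) : ℝ := c.L + (2 * c.L * c.δCR + c.L) / ψ
def c₅ (ψ : ℝ) : ℝ :=
  (1 + c.σC + 2 * c.L + (1 - c.σR) * (2 * c.L * c.δCR + c.L) / ψ) * √c.n

/-- The step-size conditions for the sublinear rate. -/
structure StepSublinear (α ψ y₀ : ℝ) : Prop where
  pos : 0 < α
  psi_pos : 0 < ψ
  psi_le : ψ ≤ c.Ψ α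
  lt_contr : α < (1 - c.σR) * (1 - c.σC) /
    ((√c.n * c.L + √c.n + 3) * c.L * c.δRC * c.δCR)
  lt_inv : α < 1 / c.δRC
  lt_descent : α <
    (3 * c.L * c.ϖ ^ 2 / 2
      + (c.c₁ ψ * c.b₁ + c.c₄ ψ * c.b₂ + c₀ ψ y₀ * c.b₁ + c₃ y₀ * c.b₂) / (1 - rho (c.P₁ α))
      + (c.c₁ ψ ^ 2 * c.b₃ + c.c₄ ψ ^ 2 * c.b₄) / (1 - rho (c.P₁ α)) ^ 2
      + (c.c₂ ψ * c.b₁ + c.c₅ ψ * c.b₂) / 2)⁻¹ * c.ϖ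

/-- The ratio `(1 + σ_C²) / (1 - σ_C²)`. -/
def κC : ℝ := (1 + c.σC ^ 2) / (1 - c.σC ^ 2)

def d₁ : ℝ := 4 * c.n * c.L ^ 2
def d₂ : ℝ := 2 * ((3 - c.σR ^ 2) / (1 - c.σR ^ 2)) * c.δRC ^ 2
def d₃ : ℝ := 8 * c.n * c.L
def d₄ : ℝ := 32 * c.κC * c.L ^ 2 * c.δCR ^ 2
def d₅ : ℝ := 16 * c.κC * c.n * c.L ^ 4 * c.δCR ^ 2
def d₆ : ℝ := 8 * c.κC * c.L ^ 2
def d₇ : ℝ := 32 * c.κC * c.n * c.L ^ 3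
def d₈ : ℝ := 1 / 2 * c.L ^ 2 * c.n * c.ϖ ^ 2 * c.δ2R ^ 2
def d₉ : ℝ := 3 / 2 * c.L ^ 3 * c.n * c.ϖ ^ 2 * c.δ2R ^ 2
def d₁₀ : ℝ := 1 / 2 * c.δ2C ^ 2
def d₁₁ : ℝ := 3 * c.L / 2 * c.δ2C ^ 2
def d₁₂ (β : ℝ) : ℝ := 2 * β * c.ϖ
def d₁₃ : ℝ := 2 * c.L + 3 * c.ϖ ^ 2 * c.L ^ 2

/-- The `3 × 3` matrix governing the squared consensus error, the squared tracking error and the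
dual optimality gap, under the Polyak-Łojasiewicz condition with constant `β`. -/
def P₂ (β α : ℝ) : Matrix (Fin 3) (Fin 3) ℝ :=
  !![(3 * c.σR ^ 2 - c.σR ^ 4) / (1 + c.σR ^ 2) + c.d₁ * α ^ 2, c.d₂ * α ^ 2, c.d₃ * α ^ 2;
     c.d₄ + c.d₅ * α ^ 2, (1 + c.σC ^ 2) / 2 + c.d₆ * α ^ 2, c.d₇ * α ^ 2;
     c.d₈ + c.d₉ * α ^ 2, c.d₁₀ + c.d₁₁ * α ^ 2, 1 - c.d₁₂ β * α + c.d₁₃ * α ^ 2]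

/-- `(1 - σ_R²)² / (1 + σ_R²)`. -/
def κR : ℝ := (1 - c.σR ^ 2) ^ 2 / (1 + c.σR ^ 2)

def h₁ (β : ℝ) : ℝ :=
  (1 - c.σR ^ 2) ^ 2 * (1 - c.σC ^ 2) / (16 * (1 + c.σR ^ 2)) * c.d₁₂ β
def h₂ : ℝ :=
  (1 - c.σR ^ 2) ^ 2 * (1 - c.σC ^ 2) / (16 * (1 + c.σR ^ 2)) * c.d₁₃
    + c.d₃ * c.d₄ * c.d₁₀ + (1 - c.σC ^ 2) / 2 * c.d₃ * c.d₈ + c.κR * c.d₇ * c.d₁₀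
def h₃ (β : ℝ) : ℝ := c.d₂ * c.d₄ * c.d₁₂ β
def h₄ (β : ℝ) : ℝ :=
  c.d₂ * c.d₇ * c.d₈ + c.d₃ * c.d₅ * c.d₁₀ + c.d₃ * c.d₄ * c.d₁₁
    + (1 - c.σC ^ 2) / 2 * c.d₃ * c.d₉ + c.κR * c.d₇ * c.d₁₁ + c.d₂ * c.d₅ * c.d₁₂ β
def h₅ : ℝ := c.d₂ * c.d₅ * c.d₁₃
def h₆ : ℝ := c.d₂ * c.d₇ * c.d₉ + c.d₃ * c.d₅ * c.d₁₁
def h₇ : ℝ :=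
  ((3 + c.σR ^ 2) / (1 + c.σR ^ 2) * (1 + c.σR) ^ 2
    + 2 * c.κC * ((1 + c.σC) ^ 2 + 4 * (1 + c.σR) ^ 2 * c.δCR ^ 2 * c.L ^ 2)) * c.n

/-- `√3 max ν_i / min ν_i` for a positive vector `ν`. -/
def h₈ (ν : Fin 3 → ℝ) : ℝ :=
  √3 * (max (ν 0) (max (ν 1) (ν 2)) / min (ν 0) (min (ν 1) (ν 2)))

/-- The sum `h₃ + h₄ + h₅ + h₆`. -/
def hSum (β : ℝ) : ℝ := c.h₃ β + c.h₄ β + c.h₅ + c.h₆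

/-- The step-size conditions for the linear rate. -/
structure StepLinear (β α : ℝ) : Prop where
  pos : 0 < α
  lt_one : α < 1 / c.d₁₂ β
  lt_two : α < (1 - c.σR ^ 2) / (4 * √c.n * c.L * √(1 + c.σR ^ 2))
  lt_three : α < (1 - c.σC ^ 2) / (4 * √2 * c.L * √(1 + c.σC ^ 2))
  lt_four : α < 2 * β * c.ϖ / (2 * c.L + 3 * c.L ^ 2 * c.ϖ ^ 2)
  lt_five : α < (-c.h₂ + √(c.h₂ ^ 2 + 4 * c.h₁ β * c.hSum β)) / (2 * c.hSum β)

end Data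

end ETDGT

end

noncomputable section

namespace ETDGT

open Matrix

/-! ## Spectral radius and adapted norms -/

/-! The freedom in the claim is the choice of the two norms, and the proof exploits it fully. First,
contraction norms exist. Since a common root carries self-loops, `R - 1 pRᵀ` and `C - pC 1ᵀ` have
spectral radius below `1` (`rho_devR_lt_one`, `rho_devC_lt_one`), and a matrix is a contraction,
with factor as close to its spectral radius as desired, in a suitable norm `‖T ·‖₂`
(`exists_adapted_norm`).

Multiplying both `TR` and `TC` by a small `t > 0` changes neither the contraction factors nor the
admissible pairs `δRC`, `δCR`, but forces `δ2C ≥ 1 / t` (`EquivConsts.one_le_mul_scale`). So, with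
`t` fixed in terms of the network alone, the step-size conditions become as restrictive, and the
constants in the final estimate as large, as needed. The error vector is never shown to obey a
recursion with the explicit matrices; only their spectral radii and the eigenvector `ν` enter, as
numbers. It suffices to analyse the algorithm in the unscaled norms with crude constants.

That analysis rests on duality. Strong convexity makes the primal variable an `L`-Lipschitz function
of the dual one, so the dual `f` has a quadratic upper bound, and the trackers sum to `∇f(x̄)` up to
the consensus error. This yields coupled recursions for consensus error `x`, tracking error `y` and
dual gap `Δ` (`IsRun.stepBounds`), squared in `StepBounds.sqBounds`.

Sublinear rate: the step-size bound implies `3 α L δ2C² < ϖ` (`StepSublinear.mul_lt`), so `α L / ϖ`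
is as small as desired. Then `Δ + L x² + (b / L) y²` decreases up to summable noise, and `‖∇f(x̄)‖²`
and `x²` have bounded sums (`SqBounds.sum_bounded`).

Linear rate: a Lipschitz gradient gives the Polyak-Łojasiewicz inequality for `f`. The step-size
bound makes `α L` small (`StepLinear.mul_L_le`). The eigenvector equation gives `λ ≥ 1 - 2βϖα +
2α²L(1 + 8nL²δ2C²)` (`StepLinear.eigenvalue_ge`), whose last term leaves room for a Lyapunov
function to contract by `λ` (`SqBounds.lyapunov_step`). It also gives a lower bound of order `δ2C³`
for `h₈` (`StepLinear.h₈_ge`), so the claimed constant dominates the crude ones. -/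

lemma l2_sq {q : ℕ} (x : Fin q → ℝ) : l2 x ^ 2 = ∑ i, x i ^ 2 := by
  simp [l2, EuclideanSpace.norm_sq_eq]

lemma l2_nonneg {q : ℕ} (x : Fin q → ℝ) : 0 ≤ l2 x := norm_nonneg _

lemma l2_eq_zero {q : ℕ} {x : Fin q → ℝ} : l2 x = 0 ↔ x = 0 := by
  simp [l2]

lemma l2_smul {q : ℕ} (c : ℝ) (x : Fin q → ℝ) : l2 (c • x) = |c| * l2 x := by
  simp [l2, norm_smul]

/-- The spectral norm of a real square matrix. -/
def matOp {n : ℕ} (A : Matrix (Fin n) (Fin n) ℝ) : ℝ :=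
  ‖Matrix.toEuclideanCLM (n := Fin n) (𝕜 := ℝ) A‖

lemma matOp_nonneg {n : ℕ} (A : Matrix (Fin n) (Fin n) ℝ) : 0 ≤ matOp A := norm_nonneg _

lemma l2_mulVec_le {n : ℕ} (A : Matrix (Fin n) (Fin n) ℝ) (x : Fin n → ℝ) :
    l2 (A *ᵥ x) ≤ matOp A * l2 x := by
  have := (Matrix.toEuclideanCLM (n := Fin n) (𝕜 := ℝ) A).le_opNorm (WithLp.toLp 2 x)
  simpa [l2, matOp] using this

lemma matOp_le {n : ℕ} {A : Matrix (Fin n) (Fin n) ℝ} {r : ℝ} (hr : 0 ≤ r)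
    (h : ∀ x, l2 (A *ᵥ x) ≤ r * l2 x) : matOp A ≤ r :=
  ContinuousLinearMap.opNorm_le_bound _ hr fun x => h (WithLp.ofLp x)

lemma exists_eigenvector {q : ℕ} {B : Matrix (Fin q) (Fin q) ℂ} {z : ℂ}
    (hz : z ∈ spectrum ℂ B) : ∃ v : Fin q → ℂ, v ≠ 0 ∧ B *ᵥ v = z • v := by
  rw [← Matrix.spectrum_toLin', ← Module.End.hasEigenvalue_iff_mem_spectrum] at hz
  obtain ⟨v, hv⟩ := hz.exists_hasEigenvector
  exact ⟨v, hv.2, by simpa using hv.apply_eq_smul⟩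

/-! ### Gelfand's formula for the complexification of a real matrix. -/

section
open scoped Matrix.Norms.L2Operator

/-- Over `ℂ` the spectrum of a nonempty matrix is nonempty and compact, so the spectral radius is
attained. It is then finite, and `toReal` in `rho` loses nothing. -/
lemma exists_spectrum_norm_eq_rho {q : ℕ} [NeZero q] (A : Matrix (Fin q) (Fin q) ℝ) :
    ∃ z ∈ spectrum ℂ (A.map (fun x : ℝ => (x : ℂ))), ‖z‖ = rho A ∧
      spectralRadius ℂ (A.map (fun x : ℝ => (x : ℂ))) = ENNReal.ofReal (rho A) := by
  obtain ⟨z, hz, h⟩ := spectrum.exists_nnnorm_eq_spectralRadius (A.map (fun x : ℝ => (x : ℂ)))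
  refine ⟨z, hz, ?_, ?_⟩
  · simp [rho, ← h]
  · rw [rho, ENNReal.ofReal_toReal]
    simp [← h]

/-- By Gelfand's formula `‖A ^ N‖ ^ (1 / N)` falls below `r` for large `N`. The bound for the
complexified matrix restricts to real vectors, which embed isometrically. -/
lemma exists_pow_mulVec_le {n : ℕ} [NeZero n] (A : Matrix (Fin n) (Fin n) ℝ) {r : ℝ}
    (hr : rho A < r) : ∃ N : ℕ, 0 < N ∧ ∀ x, l2 ((A ^ N) *ᵥ x) ≤ r ^ N * l2 x := by
  obtain ⟨z, -, hz, hs⟩ := exists_spectrum_norm_eq_rho A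
  have h0 : 0 ≤ rho A := hz ▸ norm_nonneg z
  have hr0 : 0 < r := h0.trans_lt hr
  have ht := spectrum.pow_norm_pow_one_div_tendsto_nhds_spectralRadius
    (A.map (fun x : ℝ => (x : ℂ)))
  rw [hs] at ht
  have hev := ht.eventually (gt_mem_nhds ((ENNReal.ofReal_lt_ofReal_iff hr0).2 hr))
  obtain ⟨N, hN, hN0⟩ := (hev.and (Filter.eventually_gt_atTop 0)).exists
  refine ⟨N, hN0, fun x => ?_⟩
  rw [ENNReal.ofReal_lt_ofReal_iff hr0] at hN
  have hle : ‖(A.map (fun x : ℝ => (x : ℂ))) ^ N‖ ≤ r ^ N := by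
    have h1 := pow_le_pow_left₀ (by positivity) hN.le N
    rwa [one_div, Real.rpow_inv_natCast_pow (norm_nonneg _) hN0.ne'] at h1
  have hpow : (A.map (fun x : ℝ => (x : ℂ))) ^ N = (A ^ N).map (fun x : ℝ => (x : ℂ)) :=
    (map_pow (Complex.ofRealHom.mapMatrix (m := Fin n)) A N).symm
  have h2 := l2_opNorm_mulVec ((A.map (fun x : ℝ => (x : ℂ))) ^ N)
    (WithLp.toLp 2 (fun i => (x i : ℂ)))
  have hx : ‖(WithLp.toLp 2 (fun i => (x i : ℂ)) : EuclideanSpace ℂ (Fin n))‖ = l2 x := by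
    simp [l2, EuclideanSpace.norm_eq]
  have hAx : ‖(EuclideanSpace.equiv (Fin n) ℂ).symm
      (((A.map (fun x : ℝ => (x : ℂ))) ^ N) *ᵥ (fun i => (x i : ℂ)))‖ = l2 ((A ^ N) *ᵥ x) := by
    have : ((A.map (fun x : ℝ => (x : ℂ))) ^ N) *ᵥ (fun i => (x i : ℂ))
        = fun i => (((A ^ N) *ᵥ x) i : ℂ) := by
      rw [hpow]; ext i; simp [Matrix.mulVec, dotProduct]
    rw [this]
    simp [l2, EuclideanSpace.norm_eq]
  rw [hx] at h2
  calc l2 ((A ^ N) *ᵥ x) ≤ _ := hAx ▸ h2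
    _ ≤ _ := mul_le_mul_of_nonneg_right hle (l2_nonneg x)

end

lemma rho_nonneg {q : ℕ} (A : Matrix (Fin q) (Fin q) ℝ) : 0 ≤ rho A := ENNReal.toReal_nonneg

lemma rho_transpose {q : ℕ} (A : Matrix (Fin q) (Fin q) ℝ) : rho A.transpose = rho A := by
  have : spectrum ℂ (A.transpose.map (fun x : ℝ => (x : ℂ)))
      = spectrum ℂ (A.map (fun x : ℝ => (x : ℂ))) := by
    ext z
    rw [Matrix.mem_spectrum_iff_isRoot_charpoly, Matrix.mem_spectrum_iff_isRoot_charpoly,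
      Matrix.transpose_map, Matrix.charpoly_transpose]
  simp only [rho, spectralRadius, this]

/-- A non-negative matrix with a positive `θ`-supersolution has spectral radius at most `θ`. -/
lemma rho_le_of_supersolution {q : ℕ} [NeZero q] {P : Matrix (Fin q) (Fin q) ℝ}
    (hP : ∀ i j, 0 ≤ P i j) {v : Fin q → ℝ} (hv : ∀ i, 0 < v i) {θ : ℝ}
    (h : ∀ i, ∑ j, P i j * v j ≤ θ * v i) : rho P ≤ θ := by
  obtain ⟨z, hz, hzr, -⟩ := exists_spectrum_norm_eq_rho P
  obtain ⟨u, hu0, hu⟩ := exists_eigenvector hz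
  -- Collatz-Wielandt argument: compare the moduli of an eigenvector with the supersolution at the
  -- index where their ratio is largest.
  obtain ⟨i, -, hi⟩ := Finset.exists_max_image Finset.univ (fun i => ‖u i‖ / v i)
    Finset.univ_nonempty
  set K := ‖u i‖ / v i with hK
  have hb : ∀ j, ‖u j‖ ≤ K * v j := fun j => by
    have := hi j (Finset.mem_univ j)
    rwa [div_le_iff₀ (hv j)] at this
  have hKi : ‖u i‖ = K * v i := by rw [hK]; field_simp [(hv i).ne']
  have hK0 : 0 < K := by
    by_contra hneg
    apply hu0
    ext j
    have h1 := hb j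
    have h2 : K * v j ≤ 0 := mul_nonpos_of_nonpos_of_nonneg (not_lt.1 hneg) (hv j).le
    exact norm_le_zero_iff.1 (h1.trans h2)
  have h1 : ‖z‖ * ‖u i‖ ≤ K * (θ * v i) := by
    have := congrFun hu i
    rw [Pi.smul_apply, smul_eq_mul] at this
    rw [← norm_mul, ← this]
    calc ‖(P.map (fun x : ℝ => (x : ℂ)) *ᵥ u) i‖ ≤ ∑ j, P i j * ‖u j‖ := by
          rw [Matrix.mulVec, dotProduct]
          refine (norm_sum_le _ _).trans (le_of_eq (Finset.sum_congr rfl fun j _ => ?_))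
          simp [abs_of_nonneg (hP i j)]
      _ ≤ ∑ j, P i j * (K * v j) :=
          Finset.sum_le_sum fun j _ => mul_le_mul_of_nonneg_left (hb j) (hP i j)
      _ = K * ∑ j, P i j * v j := by rw [Finset.mul_sum]; congr 1; ext j; ring
      _ ≤ _ := mul_le_mul_of_nonneg_left (h i) hK0.le
  rw [hKi] at h1
  rw [← hzr]
  have : ‖z‖ * (K * v i) ≤ θ * (K * v i) := by linarith
  exact le_of_mul_le_mul_right this (mul_pos hK0 (hv i))

lemma rho_lt_one_of_supersolution {q : ℕ} [NeZero q] {P : Matrix (Fin q) (Fin q) ℝ}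
    (hP : ∀ i j, 0 ≤ P i j) {v : Fin q → ℝ} (hv : ∀ i, 0 < v i)
    (h : ∀ i, ∑ j, P i j * v j < v i) : rho P < 1 := by
  obtain ⟨i, -, hi⟩ := Finset.exists_max_image Finset.univ (fun i => (∑ j, P i j * v j) / v i)
    Finset.univ_nonempty
  refine (rho_le_of_supersolution hP hv (θ := (∑ j, P i j * v j) / v i) fun k => ?_).trans_lt
    ((div_lt_one (hv i)).2 (h i))
  have := hi k (Finset.mem_univ k)
  rwa [div_le_iff₀ (hv k)] at this

lemma dotProduct_mulVec_transpose_mul {n : ℕ} (T : Matrix (Fin n) (Fin n) ℝ) (x : Fin n → ℝ) :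
    x ⬝ᵥ ((T.transpose * T) *ᵥ x) = l2 (T *ᵥ x) ^ 2 := by
  rw [← Matrix.mulVec_mulVec, Matrix.dotProduct_mulVec, Matrix.vecMul_transpose, l2_sq, dotProduct]
  simp [sq]

lemma opNorm_le {n : ℕ} {T A : Matrix (Fin n) (Fin n) ℝ} (hT : IsUnit T.det) {r : ℝ} (hr : 0 ≤ r)
    (h : ∀ x, l2 (T *ᵥ (A *ᵥ x)) ≤ r * l2 (T *ᵥ x)) : opNorm T A ≤ r := by
  refine matOp_le hr fun x => ?_
  have := h (T⁻¹ *ᵥ x)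
  rwa [Matrix.mulVec_mulVec, Matrix.mulVec_mulVec, Matrix.mulVec_mulVec _ T T⁻¹,
    Matrix.mul_nonsing_inv T hT, Matrix.one_mulVec] at this

/-- Conjugation by `T` is insensitive to a scalar factor. When `T` is singular, both inverses are
`0` by convention. -/
lemma opNorm_smul {n : ℕ} (T A : Matrix (Fin n) (Fin n) ℝ) {t : ℝ} (ht : t ≠ 0) :
    opNorm (t • T) A = opNorm T A := by
  unfold opNorm
  by_cases hT : IsUnit T.det
  · have h1 : (t • T)⁻¹ = t⁻¹ • T⁻¹ := by
      apply Matrix.inv_eq_right_inv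
      rw [Matrix.smul_mul, Matrix.mul_smul, smul_smul, mul_inv_cancel₀ ht, one_smul,
        Matrix.mul_nonsing_inv T hT]
    rw [h1, Matrix.smul_mul, Matrix.smul_mul, Matrix.mul_smul, smul_smul, mul_inv_cancel₀ ht,
      one_smul]
  · have h1 : T⁻¹ = 0 := Matrix.nonsing_inv_apply_not_isUnit T hT
    have h2 : (t • T)⁻¹ = 0 := by
      apply Matrix.nonsing_inv_apply_not_isUnit
      rw [Matrix.det_smul, isUnit_iff_ne_zero] at *
      simpa [ht] using hT
    rw [h1, h2, Matrix.mul_zero, Matrix.mul_zero]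

/-- Every matrix is a contraction with factor arbitrarily close to its spectral radius in the norm
given by a suitable invertible matrix. -/
lemma exists_adapted_norm {n : ℕ} [NeZero n] (A : Matrix (Fin n) (Fin n) ℝ) {r : ℝ}
    (hr : rho A < r) :
    ∃ T : Matrix (Fin n) (Fin n) ℝ, IsUnit T.det ∧ opNorm T A ≤ r ∧ ∀ x, vecNorm T x ≤ l2 x := by
  have hr0 : 0 < r := (rho_nonneg A).trans_lt hr
  obtain ⟨N, hN0, hN⟩ := exists_pow_mulVec_le A hr
  -- The adapted norm is `‖x‖² = ∑_{k<N} r^{-2k} ‖A^k x‖²`, realised as `‖T x‖₂²` by factoring its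
  -- Gram matrix.
  set Q : Matrix (Fin n) (Fin n) ℝ :=
    ∑ k ∈ Finset.range N, (r⁻¹ ^ k) ^ 2 • ((A ^ k).transpose * A ^ k) with hQ
  have hQx : ∀ x, x ⬝ᵥ (Q *ᵥ x)
      = ∑ k ∈ Finset.range N, (r⁻¹ ^ k) ^ 2 * l2 ((A ^ k) *ᵥ x) ^ 2 := by
    intro x
    rw [hQ, Matrix.sum_mulVec, dotProduct_sum]
    refine Finset.sum_congr rfl fun k _ => ?_
    rw [Matrix.smul_mulVec, dotProduct_smul, dotProduct_mulVec_transpose_mul, smul_eq_mul]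
  have hpsd : Q.PosSemidef := by
    rw [hQ]
    refine Matrix.posSemidef_sum _ fun k _ => Matrix.PosSemidef.smul ?_ (by positivity)
    simpa [Matrix.conjTranspose_eq_transpose_of_trivial] using
      Matrix.posSemidef_conjTranspose_mul_self (A ^ k)
  obtain ⟨T, hT⟩ : ∃ T : Matrix (Fin n) (Fin n) ℝ, Q = T.transpose * T := by
    open scoped MatrixOrder in
    obtain ⟨B, hB⟩ := CStarAlgebra.nonneg_iff_eq_star_mul_self.mp hpsd.nonneg
    exact ⟨B, by simpa [Matrix.star_eq_conjTranspose,
      Matrix.conjTranspose_eq_transpose_of_trivial] using hB⟩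
  have hTx : ∀ x, l2 (T *ᵥ x) ^ 2
      = ∑ k ∈ Finset.range N, (r⁻¹ ^ k) ^ 2 * l2 ((A ^ k) *ᵥ x) ^ 2 := fun x => by
    rw [← dotProduct_mulVec_transpose_mul, ← hT, hQx]
  have hdet : IsUnit T.det := by
    rw [isUnit_iff_ne_zero]
    intro h0
    obtain ⟨v, hv, hv0⟩ := Matrix.exists_mulVec_eq_zero_iff.2 h0
    have h1 := hTx v
    rw [hv0, l2_eq_zero.2 rfl] at h1
    have h2 : l2 v ^ 2 ≤ ∑ k ∈ Finset.range N, (r⁻¹ ^ k) ^ 2 * l2 ((A ^ k) *ᵥ v) ^ 2 := by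
      refine le_trans ?_ (Finset.single_le_sum (fun k _ => by positivity)
        (Finset.mem_range.2 hN0))
      simp
    have : l2 v = 0 := by
      have := l2_nonneg v
      nlinarith
    exact hv (l2_eq_zero.1 this)
  have hcontr : ∀ x, l2 (T *ᵥ (A *ᵥ x)) ≤ r * l2 (T *ᵥ x) := by
    intro x
    refine abs_le_of_sq_le_sq' ?_ (mul_nonneg hr0.le (l2_nonneg _)) |>.2
    rw [mul_pow, hTx, hTx]
    have e1 : ∀ k, (r⁻¹ ^ k) ^ 2 * l2 ((A ^ k) *ᵥ (A *ᵥ x)) ^ 2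
        = r ^ 2 * ((r⁻¹ ^ (k + 1)) ^ 2 * l2 ((A ^ (k + 1)) *ᵥ x) ^ 2) := fun k => by
      rw [Matrix.mulVec_mulVec, ← pow_succ, pow_succ r⁻¹]
      field_simp
    simp_rw [e1]
    rw [← Finset.mul_sum]
    refine mul_le_mul_of_nonneg_left ?_ (sq_nonneg r)
    -- Applying `A` shifts the sum by one index: the term `k = 0` is traded for the term `k = N`,
    -- which is no larger by the choice of `N`.
    have e2 := Finset.sum_range_succ' (fun k => (r⁻¹ ^ k) ^ 2 * l2 ((A ^ k) *ᵥ x) ^ 2) N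
    have e3 := Finset.sum_range_succ (fun k => (r⁻¹ ^ k) ^ 2 * l2 ((A ^ k) *ᵥ x) ^ 2) N
    have e4 : (r⁻¹ ^ N) ^ 2 * l2 ((A ^ N) *ᵥ x) ^ 2 ≤ l2 x ^ 2 := by
      have := pow_le_pow_left₀ (l2_nonneg _) (hN x) 2
      calc (r⁻¹ ^ N) ^ 2 * l2 ((A ^ N) *ᵥ x) ^ 2 ≤ (r⁻¹ ^ N) ^ 2 * (r ^ N * l2 x) ^ 2 := by gcongr
        _ = l2 x ^ 2 := by rw [← mul_pow, ← mul_assoc, ← mul_pow, inv_mul_cancel₀ hr0.ne']; simp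
    simp only [pow_zero, one_pow, one_mul, Matrix.one_mulVec] at e2
    linarith
  -- Rescaling brings the norm below the Euclidean one without affecting the contraction factor.
  have hM : 0 < (matOp T + 1)⁻¹ := inv_pos.2 (by have := matOp_nonneg T; linarith)
  refine ⟨(matOp T + 1)⁻¹ • T, ?_, ?_, fun x => ?_⟩
  · rw [Matrix.det_smul, isUnit_iff_ne_zero]
    exact mul_ne_zero (pow_ne_zero _ hM.ne') hdet.ne_zero
  · rw [opNorm_smul _ _ hM.ne']
    exact opNorm_le hdet hr0.le hcontr
  · rw [vecNorm, Matrix.smul_mulVec, l2_smul, abs_of_pos hM, inv_mul_le_iff₀ (inv_pos.1 hM)]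
    have := l2_mulVec_le T x
    have := l2_nonneg x
    nlinarith

end ETDGT

end

noncomputable section

namespace ETDGT

open Matrix

/-! ## Stochastic matrices with a rooted digraph -/

/-- If a convex combination of vectors of the disc of radius `M` lies outside its interior, all
vectors with positive weight coincide with it. -/
lemma eq_of_norm_convexCombination {ι : Type*} [Fintype ι] {a : ι → ℝ} (ha : ∀ j, 0 ≤ a j)
    (hs : ∑ j, a j = 1) {u : ι → ℂ} {M : ℝ} (hM : ∀ j, ‖u j‖ ≤ M) {w : ℂ}
    (hw : ∑ j, (a j : ℂ) * u j = w) (hMw : M ≤ ‖w‖) {j : ι} (hj : 0 < a j) : u j = w := by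
  -- The variance `∑ a_k ‖u_k - w‖²` equals `∑ a_k ‖u_k‖² - ‖w‖²`, which is non-positive here.
  have hsum : ∑ k, a k * ‖u k - w‖ ^ 2 ≤ 0 := by
    have e : ∀ k, a k * ‖u k - w‖ ^ 2
        = a k * ‖u k‖ ^ 2 - 2 * (a k * ((u k) * (starRingEnd ℂ) w).re) + a k * ‖w‖ ^ 2 := by
      intro k
      simp only [← Complex.normSq_eq_norm_sq, Complex.normSq_apply, Complex.sub_re, Complex.sub_im,
        Complex.mul_re, Complex.conj_re, Complex.conj_im]
      ring
    have e2 : ∑ k, a k * ((u k) * (starRingEnd ℂ) w).re = ‖w‖ ^ 2 := by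
      have : ∑ k, a k * ((u k) * (starRingEnd ℂ) w).re
          = ((∑ k, (a k : ℂ) * u k) * (starRingEnd ℂ) w).re := by
        rw [Finset.sum_mul, Complex.re_sum]
        refine Finset.sum_congr rfl fun k _ => ?_
        rw [mul_assoc, Complex.re_ofReal_mul]
      rw [this, hw, Complex.mul_conj, Complex.ofReal_re, Complex.normSq_eq_norm_sq]
    have e3 : ∑ k, a k * ‖u k‖ ^ 2 ≤ ‖w‖ ^ 2 := by
      calc ∑ k, a k * ‖u k‖ ^ 2 ≤ ∑ k, a k * ‖w‖ ^ 2 :=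
            Finset.sum_le_sum fun k _ => mul_le_mul_of_nonneg_left
              (pow_le_pow_left₀ (norm_nonneg _) ((hM k).trans hMw) 2) (ha k)
        _ = ‖w‖ ^ 2 := by rw [← Finset.sum_mul, hs, one_mul]
    simp_rw [e]
    rw [Finset.sum_add_distrib, Finset.sum_sub_distrib, ← Finset.mul_sum, e2, ← Finset.sum_mul, hs]
    linarith
  have h0 : a j * ‖u j - w‖ ^ 2 ≤ 0 :=
    (Finset.single_le_sum (f := fun k => a k * ‖u k - w‖ ^ 2)
      (fun k _ => mul_nonneg (ha k) (sq_nonneg _)) (Finset.mem_univ j)).trans hsum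
  have h1 : ‖u j - w‖ ^ 2 ≤ 0 := by
    by_contra h
    exact absurd h0 (not_le.2 (mul_pos hj (not_le.1 h)))
  have h2 : ‖u j - w‖ = 0 := by
    have := norm_nonneg (u j - w)
    nlinarith
  exact sub_eq_zero.1 (norm_eq_zero.1 h2)

/-- Maximum principle: where `‖u‖` is maximal, every agent weighed positively takes the value `z * u
i`, hence is maximal too. Following a path of the digraph backwards from a maximum leads to the
root, and the self-loop there gives `z * u r = u r`. -/
lemma peripheral_eigenvector_root {n : ℕ} {R : Matrix (Fin n) (Fin n) ℝ} (hR : ∀ i j, 0 ≤ R i j)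
    (hrow : ∀ i, ∑ j, R i j = 1) {r : Fin n} (hr : IsRoot R r) (hrr : 0 < R r r) {u : Fin n → ℂ}
    {z : ℂ} (hz : 1 ≤ ‖z‖) (hu : ∀ i, ∑ j, (R i j : ℂ) * u j = z * u i) :
    (∀ i, ‖u i‖ ≤ ‖u r‖) ∧ z * u r = u r := by
  obtain ⟨i₀, -, hi₀⟩ := Finset.exists_max_image Finset.univ (fun i => ‖u i‖)
    ⟨r, Finset.mem_univ r⟩
  have hM : ∀ j, ‖u j‖ ≤ ‖u i₀‖ := fun j => hi₀ j (Finset.mem_univ j)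
  have step : ∀ i, ‖u i‖ = ‖u i₀‖ → ∀ j, 0 < R i j → u j = z * u i := fun i hi j hj =>
    eq_of_norm_convexCombination (hR i) (hrow i) hM (hu i)
      (by rw [norm_mul, hi]; exact le_mul_of_one_le_left (norm_nonneg _) hz) hj
  have back : ‖u r‖ = ‖u i₀‖ := by
    refine (hr i₀).head_induction_on (motive := fun j _ => ‖u j‖ = ‖u i₀‖) rfl ?_
    intro a b hab _ hb
    refine le_antisymm (hM a) ?_
    rw [step b hb a hab, norm_mul, hb]
    exact le_mul_of_one_le_left (norm_nonneg _) hz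
  exact ⟨fun i => back ▸ hM i, (step r back r hrr).symm⟩

/-- Let `u` be an eigenvector with `1 ≤ ‖z‖`. Since `pᵀ (R - 1 pᵀ) = 0` and `z ≠ 0`, it satisfies
`pᵀ u = 0` and is an eigenvector of `R`. The maximum principle gives `z = 1` and then constancy of
`u`, which contradicts `pᵀ u = 0`. -/
lemma rho_devR_lt_one {n : ℕ} {R : Matrix (Fin n) (Fin n) ℝ} (hR : ∀ i j, 0 ≤ R i j)
    (hrow : ∀ i, ∑ j, R i j = 1) {r : Fin n} (hr : IsRoot R r) (hrr : 0 < R r r) {p : Fin n → ℝ}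
    (hp : Matrix.vecMul p R = p) (hps : ∑ i, p i = 1) : rho (devR R p) < 1 := by
  have : NeZero n := ⟨by rintro rfl; exact r.elim0⟩
  obtain ⟨z, hz, hzr, -⟩ := exists_spectrum_norm_eq_rho (devR R p)
  by_contra hlt
  rw [not_lt, ← hzr] at hlt
  obtain ⟨u, hu0, hu⟩ := exists_eigenvector hz
  have hu' : ∀ i, ∑ j, (R i j : ℂ) * u j - ∑ j, (p j : ℂ) * u j = z * u i := by
    intro i
    have := congrFun hu i
    rw [Pi.smul_apply, smul_eq_mul] at this
    rw [← this, ← Finset.sum_sub_distrib]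
    simp [Matrix.mulVec, dotProduct, devR, Matrix.vecMulVec_apply, sub_mul]
  have hpC : ∀ j, ∑ i, (p i : ℂ) * (R i j : ℂ) = p j := by
    intro j
    have := congrFun hp j
    rw [Matrix.vecMul, dotProduct] at this
    exact_mod_cast this
  have hpsC : ∑ i, (p i : ℂ) = 1 := by exact_mod_cast hps
  have hpu : ∑ j, (p j : ℂ) * u j = 0 := by
    have h1 : ∑ i, (p i : ℂ) * (∑ j, (R i j : ℂ) * u j - ∑ j, (p j : ℂ) * u j) = 0 := by
      simp_rw [mul_sub, Finset.sum_sub_distrib, ← Finset.sum_mul, hpsC, one_mul, Finset.mul_sum]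
      rw [Finset.sum_comm]
      simp_rw [← mul_assoc, ← Finset.sum_mul, hpC, sub_self]
    simp_rw [hu'] at h1
    have h2 : z * ∑ j, (p j : ℂ) * u j = 0 := by
      rw [← h1, Finset.mul_sum]
      exact Finset.sum_congr rfl fun j _ => by ring
    refine (mul_eq_zero.1 h2).resolve_left fun h => ?_
    rw [h, norm_zero] at hlt
    linarith
  simp_rw [hpu, sub_zero] at hu'
  obtain ⟨hmax, hfix⟩ := peripheral_eigenvector_root hR hrow hr hrr hlt hu'
  have hur : u r ≠ 0 := by
    intro h
    apply hu0
    ext i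
    have := hmax i
    rw [h, norm_zero] at this
    exact norm_le_zero_iff.1 this
  have hz1 : z = 1 := by
    have : (z - 1) * u r = 0 := by linear_combination hfix
    exact sub_eq_zero.1 ((mul_eq_zero.1 this).resolve_right hur)
  subst hz1
  have hrowC : ∀ i, ∑ j, (R i j : ℂ) = 1 := fun i => by exact_mod_cast hrow i
  -- The vector `u - u r` is again fixed by `R`, and its modulus is largest at the root, where it
  -- vanishes.
  obtain ⟨hmax', -⟩ := peripheral_eigenvector_root hR hrow hr hrr (u := fun i => u i - u r)
    (z := 1) (by simp) (fun i => by
      simp_rw [mul_sub, Finset.sum_sub_distrib, hu', ← Finset.sum_mul, hrowC])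
  have hconst : ∀ i, u i = u r := fun i => by
    have := hmax' i
    simp only [sub_self, norm_zero] at this
    exact sub_eq_zero.1 (norm_le_zero_iff.1 this)
  apply hur
  have : ∑ j, (p j : ℂ) * u j = u r := by
    simp_rw [fun j => hconst j, ← Finset.sum_mul, hpsC, one_mul]
  rw [← this, hpu]

lemma devC_eq_transpose {n : ℕ} (C : Matrix (Fin n) (Fin n) ℝ) (p : Fin n → ℝ) :
    devC C p = (devR C.transpose p).transpose := by
  ext i j
  simp [devC, devR, Matrix.vecMulVec_apply]

lemma rho_devC_lt_one {n : ℕ} {C : Matrix (Fin n) (Fin n) ℝ} (hC : ∀ i j, 0 ≤ C i j)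
    (hcol : ∀ j, ∑ i, C i j = 1) {r : Fin n} (hr : IsRoot C.transpose r) (hrr : 0 < C r r)
    {p : Fin n → ℝ} (hp : Matrix.mulVec C p = p) (hps : ∑ i, p i = 1) : rho (devC C p) < 1 := by
  rw [devC_eq_transpose, rho_transpose]
  exact rho_devR_lt_one (R := C.transpose) (fun i j => hC j i) hcol hr hrr (by rwa [Matrix.vecMul_transpose]) hps

/-- Contraction norms exist at every sufficiently small scale. -/
lemma exists_contractionNorms {n : ℕ} {R C : Matrix (Fin n) (Fin n) ℝ} (hnet : Network R C)
    {pR pC : Fin n → ℝ} (hp : PerronPair R C pR pC) {ε : ℝ} (hε : 0 < ε) :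
    ∃ TR TC : Matrix (Fin n) (Fin n) ℝ, ContractionNorms R C pR pC ε TR TC := by
  obtain ⟨r, hrR, hrC, hR, hC⟩ := hnet.common_root
  have : NeZero n := ⟨by rintro rfl; exact r.elim0⟩
  have h1 := rho_devR_lt_one hnet.R_nonneg hnet.R_row hrR hR hp.R_eigen hp.R_sum
  have h2 := rho_devC_lt_one hnet.C_nonneg hnet.C_col hrC hC hp.C_eigen hp.C_sum
  obtain ⟨s, hs, hs'⟩ := exists_between (lt_min h1 (lt_add_of_pos_right _ hε))
  obtain ⟨t, ht, ht'⟩ := exists_between (lt_min h2 (lt_add_of_pos_right _ hε))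
  obtain ⟨TR, a1, a2, a3⟩ := exists_adapted_norm _ hs
  obtain ⟨TC, b1, b2, b3⟩ := exists_adapted_norm _ ht
  rw [lt_min_iff] at hs' ht'
  exact ⟨TR, TC, a1, b1, a2.trans_lt hs'.1, b2.trans_lt ht'.1, a2.trans_lt hs'.2,
    b2.trans_lt ht'.2, a3, b3⟩

/-- This leaves the scale of the norms free, which is what the whole comparison of constants rests
on. -/
lemma ContractionNorms.smul {n : ℕ} {R C : Matrix (Fin n) (Fin n) ℝ} {pR pC : Fin n → ℝ} {ε : ℝ}
    {TR TC : Matrix (Fin n) (Fin n) ℝ} (h : ContractionNorms R C pR pC ε TR TC) {t : ℝ}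
    (ht : 0 < t) (ht1 : t ≤ 1) : ContractionNorms R C pR pC ε (t • TR) (t • TC) := by
  have key : ∀ T : Matrix (Fin n) (Fin n) ℝ, (∀ x, vecNorm T x ≤ l2 x) →
      ∀ x, vecNorm (t • T) x ≤ l2 x := fun T hT x => by
    have h1 := hT x
    rw [vecNorm, Matrix.smul_mulVec, l2_smul, abs_of_pos ht]
    rw [vecNorm] at h1
    have := l2_nonneg (T *ᵥ x)
    nlinarith
  refine ⟨?_, ?_, ?_, ?_, ?_, ?_, key TR h.R_le, key TC h.C_le⟩
  · rw [Matrix.det_smul, isUnit_iff_ne_zero]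
    exact mul_ne_zero (pow_ne_zero _ ht.ne') h.TR_inv.ne_zero
  · rw [Matrix.det_smul, isUnit_iff_ne_zero]
    exact mul_ne_zero (pow_ne_zero _ ht.ne') h.TC_inv.ne_zero
  all_goals rw [opNorm_smul _ _ ht.ne']
  exacts [h.R_contr, h.C_contr, h.R_close, h.C_close]

end ETDGT

end

noncomputable section

namespace ETDGT

/-! ## Strongly convex functions and their conjugates -/

section Convex

variable {m : ℕ} {F : EuclideanSpace ℝ (Fin m) → ℝ}

lemma hasDerivAt_line (hF : Differentiable ℝ F) (u h : EuclideanSpace ℝ (Fin m)) (s : ℝ) :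
    HasDerivAt (fun s : ℝ => F (u + s • h)) ⟪gradient F (u + s • h), h⟫_ℝ s := by
  have h1 : HasDerivAt (fun s : ℝ => u + s • h) h s := by
    simpa using ((hasDerivAt_id s).smul_const h).const_add u
  have h2 := (hF (u + s • h)).hasGradientAt.hasFDerivAt.comp_hasDerivAt s h1
  simpa [Function.comp_def] using h2

/-- Divide the strong convexity inequality on the segment from `u` to `v` by its parameter and let
the parameter decrease to `0`. -/
lemma strongConvex_lower (hF : Differentiable ℝ F) {k : ℝ} (hk : StrongConvexOn Set.univ k F)
    (u v : EuclideanSpace ℝ (Fin m)) :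
    F u + ⟪gradient F u, v - u⟫_ℝ + k / 2 * ‖v - u‖ ^ 2 ≤ F v := by
  have h1 := hasDerivAt_line hF u (v - u) 0
  have h2 := h1.tendsto_slope_zero_right
  simp only [zero_smul, add_zero, zero_add, smul_eq_mul] at h2
  have h3 : Filter.Tendsto (fun s : ℝ => F v - F u - (1 - s) * (k / 2 * ‖v - u‖ ^ 2))
      (nhdsWithin 0 (Set.Ioi 0)) (nhds (F v - F u - (1 - 0) * (k / 2 * ‖v - u‖ ^ 2))) :=
    (Continuous.tendsto (by fun_prop) 0).mono_left nhdsWithin_le_nhds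
  have h4 : ∀ᶠ s in nhdsWithin (0 : ℝ) (Set.Ioi 0), s⁻¹ * (F (u + s • (v - u)) - F u)
      ≤ F v - F u - (1 - s) * (k / 2 * ‖v - u‖ ^ 2) := by
    filter_upwards [Ioo_mem_nhdsGT (zero_lt_one' ℝ)] with s hs
    have h5 := hk.2 (Set.mem_univ u) (Set.mem_univ v) (sub_nonneg.2 hs.2.le) hs.1.le
      (sub_add_cancel 1 s)
    have e : (1 - s) • u + s • v = u + s • (v - u) := by
      rw [sub_smul, smul_sub, one_smul]; abel
    rw [e, norm_sub_rev u v] at h5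
    simp only [smul_eq_mul] at h5
    rw [inv_mul_le_iff₀ hs.1]
    linarith
  have := le_of_tendsto_of_tendsto h2 h3 h4
  linarith

lemma strongConvex_gradient_mono (hF : Differentiable ℝ F) {k : ℝ}
    (hk : StrongConvexOn Set.univ k F) (u v : EuclideanSpace ℝ (Fin m)) :
    k * ‖v - u‖ ^ 2 ≤ ⟪gradient F v - gradient F u, v - u⟫_ℝ := by
  have h1 := strongConvex_lower hF hk u v
  have h2 := strongConvex_lower hF hk v u
  rw [norm_sub_rev u v, ← neg_sub v u, inner_neg_right] at h2
  rw [inner_sub_left]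
  linarith

/-- Strong monotonicity of the gradient and Cauchy-Schwarz. It makes the inverse of the gradient map
`L`-Lipschitz, so primal variables inherit the accuracy of dual estimates. -/
lemma strongConvex_gradient_expand (hF : Differentiable ℝ F) {L : ℝ} (hL : 0 < L)
    (hk : StrongConvexOn Set.univ (1 / L) F) (u v : EuclideanSpace ℝ (Fin m)) :
    ‖v - u‖ ≤ L * ‖gradient F v - gradient F u‖ := by
  have h1 := strongConvex_gradient_mono hF hk u v
  have h2 := real_inner_le_norm (gradient F v - gradient F u) (v - u)
  rcases (norm_nonneg (v - u)).eq_or_lt with h | h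
  · rw [← h]; positivity
  · have h3 : ‖v - u‖ * ‖v - u‖ ≤ L * ‖gradient F v - gradient F u‖ * ‖v - u‖ := by
      have := mul_le_mul_of_nonneg_left (h1.trans h2) hL.le
      rw [← mul_assoc, mul_one_div_cancel hL.ne'] at this
      nlinarith
    exact le_of_mul_le_mul_right h3 h

lemma gradient_eq_of_isMinOn (hF : Differentiable ℝ F) {y w : EuclideanSpace ℝ (Fin m)}
    (h : IsMinOn (fun v => F v - ⟪y, v⟫_ℝ) Set.univ w) : gradient F w = y := by
  have h1 : IsLocalMin (fun v => F v - ⟪y, v⟫_ℝ) w := h.isLocalMin Filter.univ_mem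
  have h2 : HasFDerivAt (fun v => F v - ⟪y, v⟫_ℝ)
      (InnerProductSpace.toDual ℝ _ (gradient F w) - InnerProductSpace.toDual ℝ _ y) w :=
    (hF w).hasGradientAt.hasFDerivAt.sub (InnerProductSpace.toDual ℝ _ y).hasFDerivAt
  have h3 := h1.hasFDerivAt_eq_zero h2
  rw [← map_sub, map_eq_zero_iff _ (LinearIsometryEquiv.injective _)] at h3
  exact sub_eq_zero.1 h3

/-- The quadratic lower bound at `0` makes `F - ⟪y, ·⟫` coercive, so it has a minimizer, where its
gradient vanishes. -/
lemma exists_gradient_eq (hF : Differentiable ℝ F) {k : ℝ} (hk0 : 0 < k)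
    (hk : StrongConvexOn Set.univ k F) (y : EuclideanSpace ℝ (Fin m)) : ∃ w, gradient F w = y := by
  have hc : Continuous (fun v => F v - ⟪y, v⟫_ℝ) := by
    have := hF.continuous
    fun_prop
  have hq : Filter.Tendsto (fun r : ℝ => F 0 + (k / 2 * r - ‖gradient F 0 - y‖) * r)
      Filter.atTop Filter.atTop := by
    refine Filter.tendsto_atTop_add_const_left _ _ (Filter.Tendsto.atTop_mul_atTop₀ ?_
      Filter.tendsto_id)
    exact Filter.tendsto_atTop_add_const_right _ _
      (Filter.tendsto_id.const_mul_atTop (by positivity))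
  have hlim : Filter.Tendsto (fun v => F v - ⟪y, v⟫_ℝ) (Filter.cocompact _) Filter.atTop := by
    refine Filter.tendsto_atTop_mono (fun v => ?_)
      (hq.comp (tendsto_norm_cocompact_atTop (E := EuclideanSpace ℝ (Fin m))))
    have h1 := strongConvex_lower hF hk 0 v
    have h2 := neg_le_of_abs_le (abs_real_inner_le_norm (gradient F 0 - y) v)
    rw [inner_sub_left] at h2
    simp only [sub_zero] at h1
    simp only [Function.comp_apply]
    nlinarith
  obtain ⟨w, hw⟩ := hc.exists_forall_le hlim
  exact ⟨w, gradient_eq_of_isMinOn hF (fun v _ => hw v)⟩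

lemma le_conj_apply (hF : Differentiable ℝ F) {k : ℝ} (hk0 : 0 < k)
    (hk : StrongConvexOn Set.univ k F) (w v : EuclideanSpace ℝ (Fin m)) :
    ⟪gradient F w, v⟫_ℝ - F v ≤ ⟪gradient F w, w⟫_ℝ - F w := by
  have h1 := strongConvex_lower hF hk w v
  rw [inner_sub_right] at h1
  have : 0 ≤ k / 2 * ‖v - w‖ ^ 2 := by positivity
  linarith

lemma conj_gradient (hF : Differentiable ℝ F) {k : ℝ} (hk0 : 0 < k)
    (hk : StrongConvexOn Set.univ k F) (w : EuclideanSpace ℝ (Fin m)) :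
    conj F (gradient F w) = ⟪gradient F w, w⟫_ℝ - F w :=
  le_antisymm (ciSup_le (le_conj_apply hF hk0 hk w))
    (le_ciSup (f := fun v => ⟪gradient F w, v⟫_ℝ - F v)
      ⟨_, Set.forall_mem_range.2 (le_conj_apply hF hk0 hk w)⟩ w)

/-- Surjectivity of the gradient is needed: it bounds the family above, so that the real supremum
defining `conj` is not a default value. -/
lemma le_conj (hF : Differentiable ℝ F) {k : ℝ} (hk0 : 0 < k)
    (hk : StrongConvexOn Set.univ k F) (y v : EuclideanSpace ℝ (Fin m)) :
    ⟪y, v⟫_ℝ - F v ≤ conj F y := by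
  obtain ⟨w, rfl⟩ := exists_gradient_eq hF hk0 hk y
  rw [conj_gradient hF hk0 hk]
  exact le_conj_apply hF hk0 hk w v

/-- Write `y` as the gradient at some `v` and use the Fenchel inequality at `v`. The remainder `⟪y -
∇F w, v - w⟫` is bounded by the expansion property. The factor `L` is twice the sharp one, which
does no harm. -/
lemma conj_upper (hF : Differentiable ℝ F) {L : ℝ} (hL : 0 < L)
    (hk : StrongConvexOn Set.univ (1 / L) F) (w : EuclideanSpace ℝ (Fin m))
    (y : EuclideanSpace ℝ (Fin m)) :
    conj F y ≤ conj F (gradient F w) + ⟪y - gradient F w, w⟫_ℝ + L * ‖y - gradient F w‖ ^ 2 := by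
  have hk0 : 0 < 1 / L := by positivity
  obtain ⟨v, rfl⟩ := exists_gradient_eq hF hk0 hk y
  rw [conj_gradient hF hk0 hk]
  have h1 := le_conj hF hk0 hk (gradient F w) v
  have h2 := strongConvex_gradient_expand hF hL hk w v
  have h3 := real_inner_le_norm (gradient F v - gradient F w) (v - w)
  have h4 := mul_le_mul_of_nonneg_left h2 (norm_nonneg (gradient F v - gradient F w))
  have e : ⟪gradient F v - gradient F w, v - w⟫_ℝ = ⟪gradient F v, v⟫_ℝ - ⟪gradient F w, v⟫_ℝ
      - ⟪gradient F v - gradient F w, w⟫_ℝ := by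
    simp only [inner_sub_left, inner_sub_right]
  nlinarith

/-- The Fenchel inequality from below and `conj_upper` from above enclose the first-order remainder
between `0` and a quadratic. -/
lemma conj_hasGradientAt (hF : Differentiable ℝ F) {L : ℝ} (hL : 0 < L)
    (hk : StrongConvexOn Set.univ (1 / L) F) (w : EuclideanSpace ℝ (Fin m)) :
    HasGradientAt (conj F) w (gradient F w) := by
  have hk0 : 0 < 1 / L := by positivity
  rw [hasGradientAt_iff_isLittleO]
  have hO : (fun y => conj F y - conj F (gradient F w) - ⟪w, y - gradient F w⟫_ℝ)
      =O[nhds (gradient F w)] fun y => ‖y - gradient F w‖ ^ 2 := by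
    refine Asymptotics.IsBigO.of_bound L (Filter.Eventually.of_forall fun y => ?_)
    have h1 := conj_upper hF hL hk w y
    have h2 := le_conj hF hk0 hk y w
    rw [conj_gradient hF hk0 hk] at h1 ⊢
    have e : ⟪w, y - gradient F w⟫_ℝ = ⟪y, w⟫_ℝ - ⟪gradient F w, w⟫_ℝ := by
      rw [real_inner_comm, inner_sub_left]
    rw [inner_sub_left] at h1
    rw [e, Real.norm_eq_abs, abs_le, Real.norm_of_nonneg (by positivity)]
    constructor <;> nlinarith [sq_nonneg ‖y - gradient F w‖]
  refine hO.trans_isLittleO ?_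
  have h0 : Filter.Tendsto (fun y => ‖y - gradient F w‖) (nhds (gradient F w)) (nhds 0) :=
    tendsto_iff_norm_sub_tendsto_zero.1 Filter.tendsto_id
  have := ((Asymptotics.isLittleO_one_iff ℝ).2 h0).mul_isBigO
    (Asymptotics.isBigO_refl (fun y => ‖y - gradient F w‖) (nhds (gradient F w)))
  refine Asymptotics.IsLittleO.of_norm_right ?_
  simpa [sq] using this

/-- The difference of the two sides along the segment is a function of one variable with
non-positive derivative. -/
lemma descent_lemma (hF : Differentiable ℝ F) {μ : ℝ}
    (hμ : ∀ v v', ‖gradient F v - gradient F v'‖ ≤ μ * ‖v - v'‖)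
    (u v : EuclideanSpace ℝ (Fin m)) :
    F v ≤ F u + ⟪gradient F u, v - u⟫_ℝ + μ / 2 * ‖v - u‖ ^ 2 := by
  set h := v - u with hh
  have hd : ∀ s : ℝ, HasDerivAt (fun s : ℝ => F (u + s • h) - s * ⟪gradient F u, h⟫_ℝ
      - μ / 2 * ‖h‖ ^ 2 * s ^ 2)
      (⟪gradient F (u + s • h), h⟫_ℝ - ⟪gradient F u, h⟫_ℝ - μ / 2 * ‖h‖ ^ 2 * (2 * s)) s := by
    intro s
    refine ((hasDerivAt_line hF u h s).sub ?_).sub ?_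
    · simpa using (hasDerivAt_id s).mul_const ⟪gradient F u, h⟫_ℝ
    · simpa using (hasDerivAt_pow 2 s).const_mul (μ / 2 * ‖h‖ ^ 2)
  have hanti : AntitoneOn (fun s : ℝ => F (u + s • h) - s * ⟪gradient F u, h⟫_ℝ
      - μ / 2 * ‖h‖ ^ 2 * s ^ 2) (Set.Icc 0 1) := by
    refine antitoneOn_of_deriv_nonpos (convex_Icc 0 1)
      (fun s _ => (hd s).continuousAt.continuousWithinAt)
      (fun s _ => (hd s).differentiableAt.differentiableWithinAt) fun s hs => ?_
    rw [interior_Icc] at hs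
    rw [(hd s).deriv, ← inner_sub_left]
    have h1 := real_inner_le_norm (gradient F (u + s • h) - gradient F u) h
    have h2 := hμ (u + s • h) u
    rw [add_sub_cancel_left, norm_smul, Real.norm_of_nonneg hs.1.le] at h2
    have := mul_le_mul_of_nonneg_right h2 (norm_nonneg h)
    nlinarith
  have h1 := hanti (Set.left_mem_Icc.2 zero_le_one) (Set.right_mem_Icc.2 zero_le_one) zero_le_one
  simp only [one_smul, zero_smul, add_zero, hh, add_sub_cancel] at h1
  rw [hh]
  linarith

lemma conj_lower (hF : Differentiable ℝ F) {k μ : ℝ} (hk0 : 0 < k)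
    (hk : StrongConvexOn Set.univ k F) (hμ0 : 0 < μ)
    (hμ : ∀ v v', ‖gradient F v - gradient F v'‖ ≤ μ * ‖v - v'‖)
    (w y : EuclideanSpace ℝ (Fin m)) :
    conj F (gradient F w) + ⟪y - gradient F w, w⟫_ℝ + 1 / (2 * μ) * ‖y - gradient F w‖ ^ 2
      ≤ conj F y := by
  set g := y - gradient F w with hg
  -- This test point maximizes the quadratic lower bound for `⟪y, ·⟫ - F` given by the descent
  -- lemma.
  have h1 := le_conj hF hk0 hk y (w + μ⁻¹ • g)
  have h2 := descent_lemma hF hμ w (w + μ⁻¹ • g)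
  have hy : y = gradient F w + g := by rw [hg]; abel
  rw [conj_gradient hF hk0 hk]
  rw [add_sub_cancel_left, inner_smul_right, norm_smul, mul_pow, Real.norm_of_nonneg
    (by positivity)] at h2
  rw [hy, inner_add_right, inner_smul_right, inner_add_left, inner_add_left,
    real_inner_self_eq_norm_sq, mul_add] at h1
  have e1 : μ / 2 * (μ⁻¹ ^ 2 * ‖g‖ ^ 2) = 1 / (2 * μ) * ‖g‖ ^ 2 := by field_simp
  have e2 : μ⁻¹ * ‖g‖ ^ 2 = 2 * (1 / (2 * μ) * ‖g‖ ^ 2) := by field_simp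
  rw [← hy] at h1
  linarith

/-- The strong convexity modulus `1 / L` cannot exceed the Lipschitz constant `μ`. Two distinct
points are needed, so dimension zero is excluded. -/
lemma one_le_mul_of_gradient_lipschitz [Nontrivial (EuclideanSpace ℝ (Fin m))]
    (hF : Differentiable ℝ F) {L μ : ℝ} (hL : 0 < L) (hk : StrongConvexOn Set.univ (1 / L) F)
    (hμ : ∀ v v', ‖gradient F v - gradient F v'‖ ≤ μ * ‖v - v'‖) : 1 ≤ μ * L := by
  obtain ⟨u, v, huv⟩ := exists_pair_ne (EuclideanSpace ℝ (Fin m))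
  have h1 := strongConvex_gradient_expand hF hL hk u v
  have h2 := mul_le_mul_of_nonneg_left (hμ v u) hL.le
  have h3 : 0 < ‖v - u‖ := norm_pos_iff.2 (sub_ne_zero.2 huv.symm)
  have h4 : 1 * ‖v - u‖ ≤ μ * L * ‖v - u‖ := by linarith
  exact le_of_mul_le_mul_right h4 h3

end Convex

end ETDGT

end

noncomputable section

namespace ETDGT

/-! ## The dual objective -/

section Dual

variable {n m : ℕ} {F : Fin n → EuclideanSpace ℝ (Fin m) → ℝ}
  {d : Fin n → EuclideanSpace ℝ (Fin m)} {L : ℝ}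

/-- The minimizer of `F i + ⟪x, ·⟫`. -/
def primal (F : Fin n → EuclideanSpace ℝ (Fin m) → ℝ) (x : EuclideanSpace ℝ (Fin m)) (i : Fin n) :
    EuclideanSpace ℝ (Fin m) :=
  Function.invFun (gradient (F i)) (-x)

/-- The dual optimality gap. -/
def dualGap (F : Fin n → EuclideanSpace ℝ (Fin m) → ℝ) (d : Fin n → EuclideanSpace ℝ (Fin m))
    (x : EuclideanSpace ℝ (Fin m)) : ℝ :=
  dual F d x - ⨅ y, dual F d y

lemma gradient_primal (hL : 0 < L) (hF : ∀ i, Differentiable ℝ (F i))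
    (hk : ∀ i, StrongConvexOn Set.univ (1 / L) (F i)) (x : EuclideanSpace ℝ (Fin m)) (i : Fin n) :
    gradient (F i) (primal F x i) = -x :=
  Function.invFun_eq (exists_gradient_eq (hF i) (by positivity) (hk i) (-x))

lemma dual_hasGradientAt (hL : 0 < L) (hF : ∀ i, Differentiable ℝ (F i))
    (hk : ∀ i, StrongConvexOn Set.univ (1 / L) (F i)) (x : EuclideanSpace ℝ (Fin m)) :
    HasGradientAt (dual F d) (∑ i, (d i - primal F x i)) x := by
  have h1 : ∀ i, HasFDerivAt (fun y => conj (F i) (-y) + ⟪y, d i⟫_ℝ)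
      (InnerProductSpace.toDual ℝ _ (d i - primal F x i)) x := by
    intro i
    have h2 := conj_hasGradientAt (hF i) hL (hk i) (primal F x i)
    rw [gradient_primal hL hF hk] at h2
    have h3 := h2.hasFDerivAt.comp x (hasFDerivAt_id (𝕜 := ℝ) x).fun_neg
    have h4 := h3.add (InnerProductSpace.toDual ℝ _ (d i)).hasFDerivAt
    have e : (fun y => conj (F i) (-y) + ⟪y, d i⟫_ℝ)
        = (conj (F i) ∘ fun y => -y) + fun y => InnerProductSpace.toDual ℝ _ (d i) y := by
      ext y
      simp [real_inner_comm]
    rw [e]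
    refine h4.congr_fderiv ?_
    ext y
    simp
    ring
  rw [hasGradientAt_iff_hasFDerivAt, map_sum]
  exact HasFDerivAt.fun_sum fun i _ => h1 i

lemma gradient_dual (hL : 0 < L) (hF : ∀ i, Differentiable ℝ (F i))
    (hk : ∀ i, StrongConvexOn Set.univ (1 / L) (F i)) (x : EuclideanSpace ℝ (Fin m)) :
    gradient (dual F d) x = ∑ i, (d i - primal F x i) :=
  (dual_hasGradientAt hL hF hk x).gradient

lemma dual_upper (hL : 0 < L) (hF : ∀ i, Differentiable ℝ (F i))
    (hk : ∀ i, StrongConvexOn Set.univ (1 / L) (F i)) (x y : EuclideanSpace ℝ (Fin m)) :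
    dual F d y ≤ dual F d x + ⟪gradient (dual F d) x, y - x⟫_ℝ + n * L * ‖y - x‖ ^ 2 := by
  rw [gradient_dual hL hF hk, sum_inner]
  unfold dual
  have e : (n : ℝ) * L * ‖y - x‖ ^ 2 = ∑ _i : Fin n, L * ‖y - x‖ ^ 2 := by
    simp [mul_assoc]
  rw [e, ← Finset.sum_add_distrib, ← Finset.sum_add_distrib]
  refine Finset.sum_le_sum fun i _ => ?_
  have h1 := conj_upper (hF i) hL (hk i) (primal F x i) (-y)
  rw [gradient_primal hL hF hk, ← neg_sub', norm_neg, inner_neg_left] at h1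
  rw [inner_sub_left, real_inner_comm _ (d i), real_inner_comm _ (primal F x i)]
  have e2 : ⟪y - x, d i⟫_ℝ = ⟪y, d i⟫_ℝ - ⟪x, d i⟫_ℝ := inner_sub_left _ _ _
  linarith

lemma dual_lower (hL : 0 < L) (hF : ∀ i, Differentiable ℝ (F i))
    (hk : ∀ i, StrongConvexOn Set.univ (1 / L) (F i)) {μ : ℝ} (hμ0 : 0 < μ)
    (hμ : ∀ i v v', ‖gradient (F i) v - gradient (F i) v'‖ ≤ μ * ‖v - v'‖)
    (x y : EuclideanSpace ℝ (Fin m)) :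
    dual F d x + ⟪gradient (dual F d) x, y - x⟫_ℝ + n / (2 * μ) * ‖y - x‖ ^ 2 ≤ dual F d y := by
  rw [gradient_dual hL hF hk, sum_inner]
  unfold dual
  have e : (n : ℝ) / (2 * μ) * ‖y - x‖ ^ 2 = ∑ _i : Fin n, 1 / (2 * μ) * ‖y - x‖ ^ 2 := by
    simp; ring
  rw [e, ← Finset.sum_add_distrib, ← Finset.sum_add_distrib]
  refine Finset.sum_le_sum fun i _ => ?_
  have h1 := conj_lower (hF i) (by positivity) (hk i) hμ0 (hμ i) (primal F x i) (-y)
  rw [gradient_primal hL hF hk, ← neg_sub', norm_neg, inner_neg_left] at h1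
  rw [inner_sub_left, real_inner_comm _ (d i), real_inner_comm _ (primal F x i)]
  have e2 : ⟪y - x, d i⟫_ℝ = ⟪y, d i⟫_ℝ - ⟪x, d i⟫_ℝ := inner_sub_left _ _ _
  linarith

/-- Weak duality with the feasible point `d` itself. -/
lemma dual_bddBelow (hL : 0 < L) (hF : ∀ i, Differentiable ℝ (F i))
    (hk : ∀ i, StrongConvexOn Set.univ (1 / L) (F i)) :
    BddBelow (Set.range (dual F d)) := by
  refine ⟨∑ i, -F i (d i), Set.forall_mem_range.2 fun x => Finset.sum_le_sum fun i _ => ?_⟩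
  have := le_conj (hF i) (by positivity) (hk i) (-x) (d i)
  rw [inner_neg_left] at this
  linarith

lemma dualGap_nonneg (hL : 0 < L) (hF : ∀ i, Differentiable ℝ (F i))
    (hk : ∀ i, StrongConvexOn Set.univ (1 / L) (F i)) (x : EuclideanSpace ℝ (Fin m)) :
    0 ≤ dualGap F d x :=
  sub_nonneg.2 (ciInf_le (dual_bddBelow hL hF hk) x)

/-- One gradient step of length `1 / (2nL)` decreases the dual by `‖g‖² / (4nL)` and cannot go below
the infimum. -/
lemma gradient_dual_sq_le (hn : 0 < n) (hL : 0 < L) (hF : ∀ i, Differentiable ℝ (F i))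
    (hk : ∀ i, StrongConvexOn Set.univ (1 / L) (F i)) (x : EuclideanSpace ℝ (Fin m)) :
    ‖gradient (dual F d) x‖ ^ 2 ≤ 4 * n * L * dualGap F d x := by
  have hn' : (0 : ℝ) < n := by exact_mod_cast hn
  set g := gradient (dual F d) x with hg
  have h1 := dual_upper (d := d) hL hF hk x (x - (2 * n * L)⁻¹ • g)
  have h2 := ciInf_le (dual_bddBelow (d := d) hL hF hk) (x - (2 * n * L)⁻¹ • g)
  rw [sub_sub_cancel_left, norm_neg, norm_smul, mul_pow, inner_neg_right, inner_smul_right, ← hg,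
    real_inner_self_eq_norm_sq, Real.norm_of_nonneg (by positivity)] at h1
  unfold dualGap
  have e : (2 * n * L)⁻¹ * ‖g‖ ^ 2 - n * L * ((2 * n * L)⁻¹ ^ 2 * ‖g‖ ^ 2)
      = ‖g‖ ^ 2 / (4 * n * L) := by
    field_simp; ring
  have h3 : ‖g‖ ^ 2 / (4 * n * L) ≤ dual F d x - ⨅ y, dual F d y := by linarith
  rw [div_le_iff₀ (by positivity)] at h3
  linarith

/-- The Polyak-Łojasiewicz inequality with constant `n / μ`: minimize the strongly convex lower
bound of the dual over `y` by completing a square. -/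
lemma dualGap_le_gradient_sq (hn : 0 < n) (hL : 0 < L) (hF : ∀ i, Differentiable ℝ (F i))
    (hk : ∀ i, StrongConvexOn Set.univ (1 / L) (F i)) {μ : ℝ} (hμ0 : 0 < μ)
    (hμ : ∀ i v v', ‖gradient (F i) v - gradient (F i) v'‖ ≤ μ * ‖v - v'‖)
    (x : EuclideanSpace ℝ (Fin m)) :
    2 * (n / μ) * dualGap F d x ≤ ‖gradient (dual F d) x‖ ^ 2 := by
  have hn' : (0 : ℝ) < n := by exact_mod_cast hn
  set g := gradient (dual F d) x with hg
  have h1 : dual F d x - μ / (2 * n) * ‖g‖ ^ 2 ≤ ⨅ y, dual F d y := by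
    refine le_ciInf fun y => ?_
    have h2 := dual_lower (d := d) hL hF hk hμ0 hμ x y
    have h3 := neg_le_of_abs_le (abs_real_inner_le_norm g (y - x))
    have h4 : 0 ≤ n / (2 * μ) * (‖y - x‖ - μ / n * ‖g‖) ^ 2 := by positivity
    have e : n / (2 * μ) * (‖y - x‖ - μ / n * ‖g‖) ^ 2
        = n / (2 * μ) * ‖y - x‖ ^ 2 - ‖g‖ * ‖y - x‖ + μ / (2 * n) * ‖g‖ ^ 2 := by
      field_simp
      ring
    linarith
  unfold dualGap
  have h5 : dual F d x - ⨅ y, dual F d y ≤ μ / (2 * n) * ‖g‖ ^ 2 := by linarith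
  calc 2 * (n / μ) * (dual F d x - ⨅ y, dual F d y)
      ≤ 2 * (n / μ) * (μ / (2 * n) * ‖g‖ ^ 2) := by gcongr
    _ = ‖g‖ ^ 2 := by field_simp

lemma norm_sub_primal_le (hL : 0 < L) (hF : ∀ i, Differentiable ℝ (F i))
    (hk : ∀ i, StrongConvexOn Set.univ (1 / L) (F i)) (x : EuclideanSpace ℝ (Fin m)) (i : Fin n)
    (w : EuclideanSpace ℝ (Fin m)) :
    ‖w - primal F x i‖ ≤ L * ‖-gradient (F i) w - x‖ := by
  have := strongConvex_gradient_expand (hF i) hL (hk i) (primal F x i) w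
  rwa [gradient_primal hL hF hk, sub_neg_eq_add, ← norm_neg, neg_sub, ← norm_neg (_ + x), neg_add,
    ← sub_eq_add_neg, norm_sub_rev] at this

lemma IsOptimal.gradient_eq {W : Fin n → EuclideanSpace ℝ (Fin m)} (hF : ∀ i, Differentiable ℝ (F i))
    (hW : IsOptimal F d W) (i j : Fin n) : gradient (F i) (W i) = gradient (F j) (W j) := by
  by_cases hij : i = j
  · rw [hij]
  set h := gradient (F i) (W i) - gradient (F j) (W j) with hh
  have hmin : IsLocalMin (fun s : ℝ => F i (W i + s • h) + F j (W j + s • (-h))) 0 := by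
    refine Filter.Eventually.of_forall fun s => ?_
    -- Moving `s • h` from agent `j` to agent `i` preserves the total. Stationarity at `s = 0` then
    -- reads `‖h‖² = 0`.
    set V : Fin n → EuclideanSpace ℝ (Fin m) :=
      fun k => W k + ((if k = i then s • h else 0) + if k = j then s • (-h) else 0) with hV
    have h1 := hW.2 V (by
      rw [← hW.1, hV, Finset.sum_add_distrib, Finset.sum_add_distrib]
      simp)
    have e : ∀ k, F k (V k) = F k (W k) + ((if k = i then F i (W i + s • h) - F i (W i) else 0)
        + if k = j then F j (W j + s • (-h)) - F j (W j) else 0) := by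
      intro k
      by_cases h2 : k = i
      · subst h2; simp [hV, hij]
      · by_cases h3 : k = j
        · subst h3; simp [hV, h2]
        · simp [hV, h2, h3]
    simp_rw [e] at h1
    rw [Finset.sum_add_distrib, Finset.sum_add_distrib] at h1
    simp only [Finset.sum_ite_eq', Finset.mem_univ, if_true] at h1
    simp only [zero_smul, add_zero]
    linarith
  have h2 := hmin.hasDerivAt_eq_zero
    ((hasDerivAt_line (hF i) (W i) h 0).add (hasDerivAt_line (hF j) (W j) (-h) 0))
  simp only [zero_smul, add_zero, inner_neg_right, ← sub_eq_add_neg, ← inner_sub_left] at h2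
  exact sub_eq_zero.1 (inner_self_eq_zero.1 h2)

/-- The negative of the common gradient at the optimum is a dual point of value `-∑ F_i(W_i)`, so
the dual gap at `x` bounds the excess of the Lagrangian at `W` over its minimum, attained at `primal
F x`. Strong convexity turns that excess into a squared distance. -/
lemma sum_primal_sub_optimal_sq_le (hn : 0 < n) (hL : 0 < L) (hF : ∀ i, Differentiable ℝ (F i))
    (hk : ∀ i, StrongConvexOn Set.univ (1 / L) (F i)) {W : Fin n → EuclideanSpace ℝ (Fin m)}
    (hW : IsOptimal F d W) (x : EuclideanSpace ℝ (Fin m)) :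
    ∑ i, ‖primal F x i - W i‖ ^ 2 ≤ 2 * L * dualGap F d x := by
  have hk0 : 0 < 1 / L := by positivity
  set y : EuclideanSpace ℝ (Fin m) := -gradient (F ⟨0, hn⟩) (W ⟨0, hn⟩) with hy
  have hg : ∀ i, gradient (F i) (W i) = -y := fun i => by
    rw [hy, neg_neg]; exact hW.gradient_eq hF i _
  have hsum : ∀ z : EuclideanSpace ℝ (Fin m), ∑ i, ⟪z, d i⟫_ℝ = ∑ i, ⟪z, W i⟫_ℝ := fun z => by
    rw [← inner_sum, ← inner_sum, hW.1]
  have h1 : dual F d y = -∑ i, F i (W i) := by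
    unfold dual
    have : ∀ i, conj (F i) (-y) = -⟪y, W i⟫_ℝ - F i (W i) := fun i => by
      rw [← hg i, conj_gradient (hF i) hk0 (hk i), hg i, inner_neg_left]
    simp_rw [this]
    rw [Finset.sum_add_distrib, hsum, Finset.sum_sub_distrib, Finset.sum_neg_distrib]
    ring
  have h2 : ⨅ z, dual F d z ≤ -∑ i, F i (W i) :=
    h1 ▸ ciInf_le (dual_bddBelow (d := d) hL hF hk) y
  have h3 : ∑ i, (1 / L / 2) * ‖primal F x i - W i‖ ^ 2 ≤ ∑ i, F i (W i) + dual F d x := by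
    unfold dual
    rw [Finset.sum_add_distrib, hsum, ← Finset.sum_add_distrib, ← Finset.sum_add_distrib]
    refine Finset.sum_le_sum fun i _ => ?_
    have h4 := strongConvex_lower (hF i) (hk i) (primal F x i) (W i)
    have h5 := conj_gradient (hF i) hk0 (hk i) (primal F x i)
    rw [gradient_primal hL hF hk] at h4 h5
    rw [inner_sub_right, norm_sub_rev] at h4
    rw [h5]
    simp only [inner_neg_left] at h4 ⊢
    linarith
  rw [← Finset.mul_sum] at h3
  unfold dualGap
  have h6 : (1 / L / 2) * ∑ i, ‖primal F x i - W i‖ ^ 2 ≤ dual F d x - ⨅ z, dual F d z := by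
    linarith
  calc ∑ i, ‖primal F x i - W i‖ ^ 2
      = 2 * L * ((1 / L / 2) * ∑ i, ‖primal F x i - W i‖ ^ 2) := by field_simp
    _ ≤ _ := by gcongr

end Dual

end ETDGT

end

noncomputable section

namespace ETDGT

/-! ## Matrices acting on families of vectors -/

section Action

variable {n m : ℕ}

/-- The action of a matrix on a family of vectors. -/
def act (A : Matrix (Fin n) (Fin n) ℝ) (X : Fin n → EuclideanSpace ℝ (Fin m)) :
    Fin n → EuclideanSpace ℝ (Fin m) :=
  fun a => ∑ b, A a b • X b

/-- The Frobenius norm. -/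
def frob (X : Fin n → EuclideanSpace ℝ (Fin m)) : ℝ :=
  ‖(WithLp.toLp 2 X : PiLp 2 fun _ : Fin n => EuclideanSpace ℝ (Fin m))‖

lemma frob_nonneg (X : Fin n → EuclideanSpace ℝ (Fin m)) : 0 ≤ frob X := norm_nonneg _

lemma frob_sq (X : Fin n → EuclideanSpace ℝ (Fin m)) : frob X ^ 2 = ∑ i, ‖X i‖ ^ 2 :=
  PiLp.norm_sq_eq_of_L2 _ _

lemma frob_add_le (X Y : Fin n → EuclideanSpace ℝ (Fin m)) : frob (X + Y) ≤ frob X + frob Y :=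
  norm_add_le _ _

lemma frob_sub_le (X Y : Fin n → EuclideanSpace ℝ (Fin m)) : frob (X - Y) ≤ frob X + frob Y :=
  norm_sub_le _ _

lemma frob_smul (c : ℝ) (X : Fin n → EuclideanSpace ℝ (Fin m)) : frob (c • X) = |c| * frob X :=
  norm_smul c _

lemma frob_neg (X : Fin n → EuclideanSpace ℝ (Fin m)) : frob (-X) = frob X :=
  norm_neg _

lemma norm_le_frob (X : Fin n → EuclideanSpace ℝ (Fin m)) (i : Fin n) : ‖X i‖ ≤ frob X :=
  PiLp.norm_apply_le (WithLp.toLp 2 X : PiLp 2 fun _ : Fin n => EuclideanSpace ℝ (Fin m)) i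

lemma frob_le_of_sq_le {X : Fin n → EuclideanSpace ℝ (Fin m)} {c : ℝ} (hc : 0 ≤ c)
    (h : ∑ i, ‖X i‖ ^ 2 ≤ c ^ 2) : frob X ≤ c := by
  rw [← frob_sq] at h
  exact abs_le_of_sq_le_sq' h hc |>.2

lemma frob_le_mul_of_norm_le {X Y : Fin n → EuclideanSpace ℝ (Fin m)} {c : ℝ} (hc : 0 ≤ c)
    (h : ∀ i, ‖X i‖ ≤ c * ‖Y i‖) : frob X ≤ c * frob Y := by
  refine frob_le_of_sq_le (mul_nonneg hc (frob_nonneg Y)) ?_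
  rw [mul_pow, frob_sq, Finset.mul_sum]
  exact Finset.sum_le_sum fun i _ => by
    rw [← mul_pow]; exact pow_le_pow_left₀ (norm_nonneg _) (h i) 2

lemma frob_le_of_norm_le {X : Fin n → EuclideanSpace ℝ (Fin m)} {c : ℝ} (hc : 0 ≤ c)
    (h : ∀ i, ‖X i‖ ≤ c) : frob X ≤ √n * c := by
  refine frob_le_of_sq_le (by positivity) ?_
  rw [mul_pow, Real.sq_sqrt (by positivity)]
  calc ∑ i, ‖X i‖ ^ 2 ≤ ∑ _i : Fin n, c ^ 2 :=
        Finset.sum_le_sum fun i _ => pow_le_pow_left₀ (norm_nonneg _) (h i) 2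
    _ = n * c ^ 2 := by simp

lemma sum_norm_le_frob (X : Fin n → EuclideanSpace ℝ (Fin m)) : ∑ i, ‖X i‖ ≤ √n * frob X := by
  refine abs_le_of_sq_le_sq' ?_ (mul_nonneg (Real.sqrt_nonneg _) (frob_nonneg X)) |>.2
  rw [mul_pow, Real.sq_sqrt (by positivity), frob_sq]
  have := sq_sum_le_card_mul_sum_sq (s := Finset.univ) (f := fun i => ‖X i‖)
  simpa using this

lemma frob_smul_const_le {p : Fin n → ℝ} (hp : ∀ i, 0 ≤ p i) (hs : ∑ i, p i = 1)
    (v : EuclideanSpace ℝ (Fin m)) : frob (fun i => p i • v) ≤ ‖v‖ := by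
  refine frob_le_of_sq_le (norm_nonneg v) ?_
  have hp1 : ∀ i, p i ≤ 1 := fun i =>
    hs ▸ Finset.single_le_sum (fun j _ => hp j) (Finset.mem_univ i)
  calc ∑ i, ‖p i • v‖ ^ 2 = (∑ i, p i ^ 2) * ‖v‖ ^ 2 := by
        rw [Finset.sum_mul]
        exact Finset.sum_congr rfl fun i _ => by rw [norm_smul, mul_pow, Real.norm_eq_abs, sq_abs]
    _ ≤ (∑ i, p i) * ‖v‖ ^ 2 := by
        refine mul_le_mul_of_nonneg_right (Finset.sum_le_sum fun i _ => ?_) (sq_nonneg _)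
        have := hp i; have := hp1 i
        nlinarith
    _ = ‖v‖ ^ 2 := by rw [hs, one_mul]

lemma norm_sum_smul_le_frob {p : Fin n → ℝ} (hp : ∀ i, 0 ≤ p i) (hs : ∑ i, p i = 1)
    (X : Fin n → EuclideanSpace ℝ (Fin m)) : ‖∑ i, p i • X i‖ ≤ frob X := by
  calc ‖∑ i, p i • X i‖ ≤ ∑ i, p i * frob X := by
        refine (norm_sum_le _ _).trans (Finset.sum_le_sum fun i _ => ?_)
        rw [norm_smul, Real.norm_of_nonneg (hp i)]
        exact mul_le_mul_of_nonneg_left (norm_le_frob X i) (hp i)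
    _ = frob X := by rw [← Finset.sum_mul, hs, one_mul]

lemma act_mul (A B : Matrix (Fin n) (Fin n) ℝ) (X : Fin n → EuclideanSpace ℝ (Fin m)) :
    act (A * B) X = act A (act B X) := by
  ext1 a
  simp only [act, Matrix.mul_apply, Finset.sum_smul, Finset.smul_sum, smul_smul]
  exact Finset.sum_comm

lemma act_one (X : Fin n → EuclideanSpace ℝ (Fin m)) : act 1 X = X := by
  ext1 a
  simp [act, Matrix.one_apply, ite_smul]

lemma act_add (A : Matrix (Fin n) (Fin n) ℝ) (X Y : Fin n → EuclideanSpace ℝ (Fin m)) :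
    act A (X + Y) = act A X + act A Y := by
  ext1 a
  simp [act, smul_add, Finset.sum_add_distrib]

lemma act_smul (A : Matrix (Fin n) (Fin n) ℝ) (c : ℝ) (X : Fin n → EuclideanSpace ℝ (Fin m)) :
    act A (c • X) = c • act A X := by
  ext1 a
  simp [act, Finset.smul_sum, smul_comm c]

lemma act_neg (A : Matrix (Fin n) (Fin n) ℝ) (X : Fin n → EuclideanSpace ℝ (Fin m)) :
    act A (-X) = -act A X := by
  ext1 a
  simp [act]

lemma act_sub (A : Matrix (Fin n) (Fin n) ℝ) (X Y : Fin n → EuclideanSpace ℝ (Fin m)) :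
    act A (X - Y) = act A X - act A Y := by
  rw [sub_eq_add_neg, act_add, act_neg, ← sub_eq_add_neg]

lemma sub_act (A B : Matrix (Fin n) (Fin n) ℝ) (X : Fin n → EuclideanSpace ℝ (Fin m)) :
    act (A - B) X = act A X - act B X := by
  ext1 a
  simp [act, sub_smul]

lemma smul_act (c : ℝ) (A : Matrix (Fin n) (Fin n) ℝ) (X : Fin n → EuclideanSpace ℝ (Fin m)) :
    act (c • A) X = c • act A X := by
  ext1 a
  simp [act, Finset.smul_sum, smul_smul]

/-- Each of the `m` columns is multiplied by the same matrix, and squared Frobenius norms add over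
columns. -/
lemma frob_act_le (A : Matrix (Fin n) (Fin n) ℝ) (X : Fin n → EuclideanSpace ℝ (Fin m)) :
    frob (act A X) ≤ matOp A * frob X := by
  refine frob_le_of_sq_le (mul_nonneg (matOp_nonneg A) (frob_nonneg X)) ?_
  have e : ∀ Y : Fin n → EuclideanSpace ℝ (Fin m),
      ∑ i, ‖Y i‖ ^ 2 = ∑ c, l2 (fun i => Y i c) ^ 2 := fun Y => by
    simp_rw [l2_sq, EuclideanSpace.norm_sq_eq, Real.norm_eq_abs, sq_abs]
    exact Finset.sum_comm
  rw [mul_pow, frob_sq, e, e, Finset.mul_sum]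
  refine Finset.sum_le_sum fun c _ => ?_
  rw [← mul_pow]
  refine pow_le_pow_left₀ (l2_nonneg _) ?_ 2
  have h : (fun i => act A X i c) = A.mulVec fun i => X i c := by
    ext i
    simp [act, Matrix.mulVec, dotProduct]
  rw [h]
  exact l2_mulVec_le A _

lemma matNorm_eq_frob (T : Matrix (Fin n) (Fin n) ℝ) (X : Fin n → EuclideanSpace ℝ (Fin m)) :
    matNorm T X = frob (act T X) := by
  rw [matNorm, frob, PiLp.norm_eq_of_L2]
  rfl

lemma matNorm_nonneg (T : Matrix (Fin n) (Fin n) ℝ) (X : Fin n → EuclideanSpace ℝ (Fin m)) :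
    0 ≤ matNorm T X := Real.sqrt_nonneg _

lemma matNorm_add_le (T : Matrix (Fin n) (Fin n) ℝ) (X Y : Fin n → EuclideanSpace ℝ (Fin m)) :
    matNorm T (X + Y) ≤ matNorm T X + matNorm T Y := by
  simp only [matNorm_eq_frob, act_add, frob_add_le]

lemma matNorm_sub_le (T : Matrix (Fin n) (Fin n) ℝ) (X Y : Fin n → EuclideanSpace ℝ (Fin m)) :
    matNorm T (X - Y) ≤ matNorm T X + matNorm T Y := by
  simp only [matNorm_eq_frob, act_sub, frob_sub_le]

lemma matNorm_act_le {T : Matrix (Fin n) (Fin n) ℝ} (hT : IsUnit T.det)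
    (A : Matrix (Fin n) (Fin n) ℝ) (X : Fin n → EuclideanSpace ℝ (Fin m)) :
    matNorm T (act A X) ≤ opNorm T A * matNorm T X := by
  have e : act T (act A X) = act (T * A * T⁻¹) (act T X) := by
    rw [← act_mul, ← act_mul, Matrix.mul_assoc (T * A), Matrix.nonsing_inv_mul T hT,
      Matrix.mul_one]
  rw [matNorm_eq_frob, matNorm_eq_frob, e]
  exact frob_act_le _ _

lemma matNorm_le_frob {T : Matrix (Fin n) (Fin n) ℝ} (hT : ∀ x, vecNorm T x ≤ l2 x)
    (X : Fin n → EuclideanSpace ℝ (Fin m)) : matNorm T X ≤ frob X := by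
  rw [matNorm_eq_frob]
  refine (frob_act_le T X).trans (mul_le_of_le_one_left (frob_nonneg X) ?_)
  exact matOp_le zero_le_one fun x => by simpa [vecNorm] using hT x

lemma frob_le_matNorm {T : Matrix (Fin n) (Fin n) ℝ} (hT : IsUnit T.det)
    (X : Fin n → EuclideanSpace ℝ (Fin m)) : frob X ≤ matOp T⁻¹ * matNorm T X := by
  rw [matNorm_eq_frob]
  have := frob_act_le T⁻¹ (act T X)
  rwa [← act_mul, Matrix.nonsing_inv_mul T hT, act_one] at this

lemma matNorm_smul {t : ℝ} (ht : 0 ≤ t) (T : Matrix (Fin n) (Fin n) ℝ)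
    (X : Fin n → EuclideanSpace ℝ (Fin m)) : matNorm (t • T) X = t * matNorm T X := by
  rw [matNorm_eq_frob, matNorm_eq_frob, smul_act, frob_smul, abs_of_nonneg ht]

end Action

/-! ## Projections along the Perron vectors -/

section Projections

variable {n m : ℕ}

/-- `1 - 1 pᵀ`. -/
def projR (p : Fin n → ℝ) : Matrix (Fin n) (Fin n) ℝ := 1 - Matrix.vecMulVec (fun _ => 1) p

/-- `1 - p 1ᵀ`. -/
def projC (p : Fin n → ℝ) : Matrix (Fin n) (Fin n) ℝ := 1 - Matrix.vecMulVec p (fun _ => 1)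

variable {R C : Matrix (Fin n) (Fin n) ℝ} {pR pC : Fin n → ℝ}

lemma R_mul_ones (h : ∀ i, ∑ j, R i j = 1) (p : Fin n → ℝ) :
    R * Matrix.vecMulVec (fun _ => 1) p = Matrix.vecMulVec (fun _ => 1) p := by
  rw [Matrix.mul_vecMulVec]
  congr 1
  ext i
  simp [Matrix.mulVec, dotProduct, h]

lemma ones_mul_R (h : Matrix.vecMul pR R = pR) :
    Matrix.vecMulVec (fun _ : Fin n => (1 : ℝ)) pR * R = Matrix.vecMulVec (fun _ => 1) pR := by
  rw [Matrix.vecMulVec_mul, h]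

lemma ones_mul_ones (h : ∑ i, pR i = 1) :
    Matrix.vecMulVec (fun _ : Fin n => (1 : ℝ)) pR * Matrix.vecMulVec (fun _ => 1) pR
      = Matrix.vecMulVec (fun _ => 1) pR := by
  rw [Matrix.vecMulVec_mul_vecMulVec]
  ext i j
  simp [Matrix.vecMulVec_apply, dotProduct, h]

/-- Together with `devR_mul_projR` this says that applying `R` and then taking the consensus error
amounts to applying the contraction `devR R pR` to the consensus error. -/
lemma projR_mul (hp : Matrix.vecMul pR R = pR) : projR pR * R = devR R pR := by
  rw [projR, devR, Matrix.sub_mul, Matrix.one_mul, ones_mul_R hp]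

lemma devR_mul_projR (hr : ∀ i, ∑ j, R i j = 1) (hs : ∑ i, pR i = 1) :
    devR R pR * projR pR = devR R pR := by
  rw [projR, devR, Matrix.mul_sub, Matrix.mul_one, Matrix.sub_mul, R_mul_ones hr,
    ones_mul_ones hs, sub_self, sub_zero]

lemma projR_mul_sub_one (hp : Matrix.vecMul pR R = pR) : projR pR * (R - 1) = R - 1 := by
  rw [Matrix.mul_sub, projR_mul hp, Matrix.mul_one, devR, projR]; abel

lemma sub_one_mul_projR (hr : ∀ i, ∑ j, R i j = 1) : (R - 1) * projR pR = R - 1 := by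
  rw [projR, Matrix.mul_sub, Matrix.mul_one, Matrix.sub_mul, R_mul_ones hr, Matrix.one_mul,
    sub_self, sub_zero]

lemma projC_mul (hc : ∀ j, ∑ i, C i j = 1) : projC pC * C = devC C pC := by
  rw [projC, devC, Matrix.sub_mul, Matrix.one_mul, Matrix.vecMulVec_mul]
  congr 2
  ext j
  simp [Matrix.vecMul, dotProduct, hc]

lemma devC_mul_projC (hp : Matrix.mulVec C pC = pC) (hs : ∑ i, pC i = 1) :
    devC C pC * projC pC = devC C pC := by
  have h1 : C * Matrix.vecMulVec pC (fun _ : Fin n => (1 : ℝ))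
      = Matrix.vecMulVec pC (fun _ => 1) := by
    rw [Matrix.mul_vecMulVec, hp]
  have h2 : Matrix.vecMulVec pC (fun _ : Fin n => (1 : ℝ))
      * Matrix.vecMulVec pC (fun _ : Fin n => (1 : ℝ)) = Matrix.vecMulVec pC (fun _ => 1) := by
    rw [Matrix.vecMulVec_mul_vecMulVec]
    ext i j
    simp [Matrix.vecMulVec_apply, dotProduct, hs]
  rw [projC, devC, Matrix.mul_sub, Matrix.mul_one, Matrix.sub_mul, h1, h2, sub_self, sub_zero]

lemma projC_mul_sub_one (hc : ∀ j, ∑ i, C i j = 1) : projC pC * (C - 1) = C - 1 := by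
  rw [Matrix.mul_sub, projC_mul hc, Matrix.mul_one, devC, projC]; abel

lemma xErr_eq_act (wt : ℕ → Fin n → EuclideanSpace ℝ (Fin m)) (k : ℕ) :
    xErr pR wt k = act (projR pR) (-wt k) := by
  rw [projR, sub_act, act_one]
  ext1 i
  simp [xErr, xbar, act, Matrix.vecMulVec_apply]

lemma yErr_eq_act (s : ℕ → Fin n → EuclideanSpace ℝ (Fin m)) (k : ℕ) :
    yErr pC s k = act (projC pC) (s k) := by
  rw [projC, sub_act, act_one]
  ext1 i
  simp [yErr, act, Matrix.vecMulVec_apply, Finset.smul_sum]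

end Projections

end ETDGT

end

noncomputable section

namespace ETDGT

/-! ## One-step bounds along a run -/

lemma eMax_nonneg {n : ℕ} {ew es : ℕ → Fin n → ℝ} (h1 : Antitone (eMax ew es))
    (h2 : Summable (eMax ew es)) (k : ℕ) : 0 ≤ eMax ew es k :=
  h1.le_of_tendsto h2.tendsto_atTop_zero k

lemma le_eMax {n : ℕ} (ew es : ℕ → Fin n → ℝ) (k : ℕ) (i : Fin n) :
    max (ew k i) (es k i) ≤ eMax ew es k :=
  le_ciSup (f := fun i => max (ew k i) (es k i)) (Set.finite_range _).bddAbove i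

lemma EventTriggered.norm_sub_le {n m : ℕ} {e : ℕ → Fin n → ℝ}
    {u v : ℕ → Fin n → EuclideanSpace ℝ (Fin m)} (h : EventTriggered e u v) {k : ℕ} {i : Fin n}
    {b : ℝ} (hb : 0 ≤ b) (he : e k i ≤ b) : ‖v k i - u k i‖ ≤ b := by
  cases k with
  | zero => rw [h.init, sub_self, norm_zero]; exact hb
  | succ k =>
    rcases le_or_gt (e (k + 1) i) ‖u (k + 1) i - v k i‖ with h1 | h1
    · rw [h.trigger k i h1, sub_self, norm_zero]; exact hb
    · rw [h.hold k i h1, norm_sub_rev]; exact h1.le.trans he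

/-- One-step bounds for the consensus error `x`, the tracking error `y`, the aggregate tracker `s`,
the dual gradient `g` and the dual gap `Δ`, driven by triggering thresholds `e`. -/
structure StepBounds (σ K ϖ L α : ℝ) (x y s g Δ e : ℕ → ℝ) : Prop where
  x_nonneg : ∀ k, 0 ≤ x k
  y_nonneg : ∀ k, 0 ≤ y k
  s_nonneg : ∀ k, 0 ≤ s k
  g_nonneg : ∀ k, 0 ≤ g k
  gap_nonneg : ∀ k, 0 ≤ Δ k
  x_step : ∀ k, x (k + 1) ≤ σ * x k + K * (α * y k + α * s k + e k)
  y_step : ∀ k, y (k + 1) ≤ σ * y k + K * e k + K * L * (x k + α * y k + α * s k + e k)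
  s_le : ∀ k, s k ≤ g k + K * L * x k
  gap_step : ∀ k, Δ (k + 1) ≤ Δ k - α * ϖ * g k ^ 2 + K * α * g k * (L * x k + y k)
    + 2 * K * L * α ^ 2 * (y k ^ 2 + s k ^ 2)
  g_sq_le : ∀ k, g k ^ 2 ≤ 4 * K * L * Δ k

section Run

variable {n m : ℕ} {R C : Matrix (Fin n) (Fin n) ℝ} {pR pC : Fin n → ℝ}
  {F : Fin n → EuclideanSpace ℝ (Fin m) → ℝ} {d : Fin n → EuclideanSpace ℝ (Fin m)} {L α : ℝ}
  {ew es : ℕ → Fin n → ℝ} {wt w s wh sh : ℕ → Fin n → EuclideanSpace ℝ (Fin m)}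

lemma IsRun.gradient_eq (h : IsRun R C F d α ew es wt w s wh sh)
    (hF : ∀ i, Differentiable ℝ (F i)) (k : ℕ) (i : Fin n) :
    gradient (F i) (w k i) = wt k i :=
  gradient_eq_of_isMinOn (hF i) (h.argmin k i)

/-- Unit row sums turn the exchange term into `(R - 1)` applied to the broadcast values, which are
split into true states and broadcast errors. -/
lemma IsRun.wt_succ (h : IsRun R C F d α ew es wt w s wh sh) (hr : ∀ i, ∑ j, R i j = 1) (k : ℕ) :
    wt (k + 1) = wt k + act (R - 1) (wt k) + act (R - 1) (wh k - wt k) + α • s k := by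
  have e : wt k + act (R - 1) (wt k) + act (R - 1) (wh k - wt k) + α • s k
      = wt k + act (R - 1) (wh k) + α • s k := by
    rw [act_sub]; abel
  rw [e, sub_act, act_one]
  ext1 i
  rw [h.wt_step]
  simp [act, smul_sub, Finset.sum_sub_distrib, ← Finset.sum_smul, hr]

lemma IsRun.s_succ (h : IsRun R C F d α ew es wt w s wh sh) (k : ℕ) :
    s (k + 1) = act C (s k) + act (C - 1) (sh k - s k) - (w (k + 1) - w k) := by
  have e : act C (s k) + act (C - 1) (sh k - s k) - (w (k + 1) - w k)
      = s k + (act C (sh k) - sh k) - (w (k + 1) - w k) := by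
    rw [act_sub, sub_act, sub_act, act_one, act_one]; abel
  rw [e]
  ext1 i
  rw [h.s_step]
  simp [act]

/-- Unit column sums make the exchange of trackers conserve the total, whatever was broadcast. -/
lemma IsRun.sum_s (h : IsRun R C F d α ew es wt w s wh sh) (hc : ∀ j, ∑ i, C i j = 1) (k : ℕ) :
    ∑ i, s k i = ∑ i, (d i - w k i) := by
  induction k with
  | zero => exact Finset.sum_congr rfl fun i _ => h.s_init i
  | succ k ih =>
    have e : ∑ i, ∑ j, C i j • sh k j = ∑ j, sh k j := by
      rw [Finset.sum_comm]
      simp [← Finset.sum_smul, hc]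
    simp_rw [h.s_step, Finset.sum_sub_distrib, Finset.sum_add_distrib, Finset.sum_sub_distrib, e,
      ih, Finset.sum_sub_distrib]
    abel

lemma IsRun.xErr_succ (h : IsRun R C F d α ew es wt w s wh sh) (hr : ∀ i, ∑ j, R i j = 1)
    (hp : Matrix.vecMul pR R = pR) (hs : ∑ i, pR i = 1) (k : ℕ) :
    xErr pR wt (k + 1) = act (devR R pR) (xErr pR wt k) - act (R - 1) (wh k - wt k)
      - α • act (projR pR) (s k) := by
  have e : wt k + act (R - 1) (wt k) = act R (wt k) := by rw [sub_act, act_one]; abel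
  rw [xErr_eq_act, xErr_eq_act, h.wt_succ hr, e, ← act_mul, devR_mul_projR hr hs, neg_add, neg_add,
    act_add, act_add, ← act_neg, ← act_mul, projR_mul hp, act_neg, act_neg, ← act_mul,
    projR_mul_sub_one hp, act_neg, act_smul]
  abel

/-- Since `R - 1` annihilates consensus states, the increment is controlled by the consensus error,
the broadcast error and the trackers. -/
lemma IsRun.wt_sub (h : IsRun R C F d α ew es wt w s wh sh) (hr : ∀ i, ∑ j, R i j = 1) (k : ℕ) :
    wt (k + 1) - wt k = -act (R - 1) (xErr pR wt k) + act (R - 1) (wh k - wt k) + α • s k := by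
  rw [h.wt_succ hr, xErr_eq_act, ← act_mul, sub_one_mul_projR hr, act_neg]
  abel

lemma IsRun.yErr_succ (h : IsRun R C F d α ew es wt w s wh sh) (hc : ∀ j, ∑ i, C i j = 1)
    (hp : Matrix.mulVec C pC = pC) (hs : ∑ i, pC i = 1) (k : ℕ) :
    yErr pC s (k + 1) = act (devC C pC) (yErr pC s k) + act (C - 1) (sh k - s k)
      - act (projC pC) (w (k + 1) - w k) := by
  rw [yErr_eq_act, yErr_eq_act, h.s_succ, act_sub, act_add, ← act_mul, ← act_mul, ← act_mul,
    devC_mul_projC hp hs, projC_mul hc, projC_mul_sub_one hc]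

lemma IsRun.xbar_succ (h : IsRun R C F d α ew es wt w s wh sh) (hr : ∀ i, ∑ j, R i j = 1)
    (hp : Matrix.vecMul pR R = pR) (k : ℕ) :
    xbar pR wt (k + 1) = xbar pR wt k - α • ∑ i, pR i • s k i := by
  have e : ∀ A : Matrix (Fin n) (Fin n) ℝ, ∀ X : Fin n → EuclideanSpace ℝ (Fin m),
      ∑ i, pR i • act A X i = ∑ j, Matrix.vecMul pR A j • X j := fun A X => by
    simp only [act, Finset.smul_sum, smul_smul, Matrix.vecMul, dotProduct, Finset.sum_smul]
    exact Finset.sum_comm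
  have e0 : ∀ X : Fin n → EuclideanSpace ℝ (Fin m), ∑ i, pR i • act (R - 1) X i = 0 := fun X => by
    rw [e, Matrix.vecMul_sub, hp, Matrix.vecMul_one, sub_self]
    simp
  unfold xbar
  rw [h.wt_succ hr]
  simp only [Pi.add_apply, Pi.smul_apply, smul_neg, smul_add, Finset.sum_neg_distrib,
    Finset.sum_add_distrib, e0, smul_comm _ α, ← Finset.smul_sum, neg_add]
  abel

/-- The weighted average moves along the total tracker with coefficient `ϖ`, up to the tracking
error. Here `ϖ` becomes the effective gradient gain. -/
lemma IsRun.sum_smul_s (pR pC : Fin n → ℝ) (s : ℕ → Fin n → EuclideanSpace ℝ (Fin m)) (k : ℕ) :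
    ∑ i, pR i • s k i = ∑ i, pR i • yErr pC s k i + (∑ i, pC i * pR i) • ∑ j, s k j := by
  simp only [yErr, smul_sub, Finset.sum_sub_distrib, smul_smul, Finset.sum_smul, mul_comm (pC _)]
  abel

/-- The sum of the trackers approximates the dual gradient at the weighted average. -/
lemma IsRun.norm_sum_s_sub_gradient_le (h : IsRun R C F d α ew es wt w s wh sh)
    (hc : ∀ j, ∑ i, C i j = 1) (hL : 0 < L) (hF : ∀ i, Differentiable ℝ (F i))
    (hk : ∀ i, StrongConvexOn Set.univ (1 / L) (F i)) (k : ℕ) :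
    ‖∑ i, s k i - gradient (dual F d) (xbar pR wt k)‖ ≤ L * (√n * frob (xErr pR wt k)) := by
  rw [h.sum_s hc, gradient_dual hL hF hk, ← Finset.sum_sub_distrib]
  calc ‖∑ i, (d i - w k i - (d i - primal F (xbar pR wt k) i))‖
      ≤ ∑ i, L * ‖xErr pR wt k i‖ := by
        refine (norm_sum_le _ _).trans (Finset.sum_le_sum fun i _ => ?_)
        rw [sub_sub_sub_cancel_left, norm_sub_rev]
        have := norm_sub_primal_le hL hF hk (xbar pR wt k) i (w k i)
        rwa [h.gradient_eq hF] at this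
    _ ≤ _ := by
        rw [← Finset.mul_sum]
        exact mul_le_mul_of_nonneg_left (sum_norm_le_frob _) hL.le

/-- A bound for the operator norms and norm-equivalence constants of a network. -/
def netBound (R C : Matrix (Fin n) (Fin n) ℝ) (pR pC : Fin n → ℝ)
    (TR TC : Matrix (Fin n) (Fin n) ℝ) : ℝ :=
  1 + √n + matOp (projR pR) + matOp (projC pC) + matOp (R - 1) + matOp (C - 1) + matOp TR⁻¹
    + matOp TC⁻¹

set_option maxHeartbeats 1000000 in
-- A single constant `M = netBound` bounds all the operators, `√n` and the comparison with the
-- Euclidean norm. At most four such factors are multiplied in any coefficient, whence `M ^ 4`.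
lemma IsRun.stepBounds (h : IsRun R C F d α ew es wt w s wh sh) (hnet : Network R C)
    (hp : PerronPair R C pR pC) {ε : ℝ} {TR TC : Matrix (Fin n) (Fin n) ℝ}
    (hT : ContractionNorms R C pR pC ε TR TC) (hn : 0 < n) (hL : 0 < L)
    (hF : ∀ i, Differentiable ℝ (F i)) (hk : ∀ i, StrongConvexOn Set.univ (1 / L) (F i))
    (hα : 0 < α) (he1 : Antitone (eMax ew es)) (he2 : Summable (eMax ew es)) :
    StepBounds (max (opNorm TR (devR R pR)) (opNorm TC (devC C pC)))
      (netBound R C pR pC TR TC ^ 4) (∑ i, pC i * pR i) L α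
      (fun k => matNorm TR (xErr pR wt k)) (fun k => matNorm TC (yErr pC s k))
      (fun k => ‖∑ i, s k i‖) (fun k => ‖gradient (dual F d) (xbar pR wt k)‖)
      (fun k => dualGap F d (xbar pR wt k)) (eMax ew es) := by
  set M := netBound R C pR pC TR TC with hM
  set σ := max (opNorm TR (devR R pR)) (opNorm TC (devC C pC)) with hσ
  have p1 := Real.sqrt_nonneg (n : ℝ)
  have p2 := matOp_nonneg (projR pR)
  have p3 := matOp_nonneg (projC pC)
  have p4 := matOp_nonneg (R - 1)
  have p5 := matOp_nonneg (C - 1)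
  have p6 := matOp_nonneg TR⁻¹
  have p7 := matOp_nonneg TC⁻¹
  have q0 : 1 ≤ M := by rw [hM, netBound]; linarith
  have q1 : √n ≤ M := by rw [hM, netBound]; linarith
  have q2 : matOp (projR pR) ≤ M := by rw [hM, netBound]; linarith
  have q3 : matOp (projC pC) ≤ M := by rw [hM, netBound]; linarith
  have q4 : matOp (R - 1) ≤ M := by rw [hM, netBound]; linarith
  have q5 : matOp (C - 1) ≤ M := by rw [hM, netBound]; linarith
  have q6 : matOp TR⁻¹ ≤ M := by rw [hM, netBound]; linarith
  have q7 : matOp TC⁻¹ ≤ M := by rw [hM, netBound]; linarith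
  have M0 : 0 ≤ M := zero_le_one.trans q0
  have M1 : M ≤ M ^ 4 := le_self_pow₀ q0 (by norm_num)
  have M2 : M ^ 2 ≤ M ^ 4 := pow_le_pow_right₀ q0 (by norm_num)
  have M3 : M ^ 3 ≤ M ^ 4 := pow_le_pow_right₀ q0 (by norm_num)
  have M14 : 1 ≤ M ^ 4 := one_le_pow₀ q0
  have hnM : (n : ℝ) ≤ M ^ 2 := by
    rw [← Real.sq_sqrt (Nat.cast_nonneg n)]; exact pow_le_pow_left₀ p1 q1 2
  have e0 := eMax_nonneg he1 he2
  have hx0 : ∀ k, 0 ≤ matNorm TR (xErr pR wt k) := fun k => matNorm_nonneg _ _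
  have hy0 : ∀ k, 0 ≤ matNorm TC (yErr pC s k) := fun k => matNorm_nonneg _ _
  have hs0 : ∀ k, 0 ≤ ‖∑ i, s k i‖ := fun k => norm_nonneg _
  have fx : ∀ k, frob (xErr pR wt k) ≤ M * matNorm TR (xErr pR wt k) := fun k =>
    (frob_le_matNorm hT.TR_inv _).trans (mul_le_mul_of_nonneg_right q6 (hx0 k))
  have fy : ∀ k, frob (yErr pC s k) ≤ M * matNorm TC (yErr pC s k) := fun k =>
    (frob_le_matNorm hT.TC_inv _).trans (mul_le_mul_of_nonneg_right q7 (hy0 k))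
  have fact : ∀ (A : Matrix (Fin n) (Fin n) ℝ) (X : Fin n → EuclideanSpace ℝ (Fin m)) {b : ℝ},
      matOp A ≤ M → frob X ≤ b → frob (act A X) ≤ M * b := fun A X b hA hX =>
    (frob_act_le A X).trans (mul_le_mul hA hX (frob_nonneg X) M0)
  have fs : ∀ k, frob (s k) ≤ M * matNorm TC (yErr pC s k) + ‖∑ i, s k i‖ := fun k => by
    have e : s k = yErr pC s k + fun i => pC i • ∑ j, s k j := by
      ext1 i; simp [yErr]
    calc frob (s k) ≤ frob (yErr pC s k) + frob (fun i => pC i • ∑ j, s k j) := by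
          conv_lhs => rw [e]
          exact frob_add_le _ _
      _ ≤ _ := add_le_add (fy k) (frob_smul_const_le hp.C_nonneg hp.C_sum _)
  have fwh : ∀ k, frob (wh k - wt k) ≤ M * eMax ew es k := fun k =>
    (frob_le_of_norm_le (e0 k) fun i => h.wh_trig.norm_sub_le (e0 k)
      ((le_max_left _ _).trans (le_eMax ew es k i))).trans (mul_le_mul_of_nonneg_right q1 (e0 k))
  have fsh : ∀ k, frob (sh k - s k) ≤ M * eMax ew es k := fun k =>
    (frob_le_of_norm_le (e0 k) fun i => h.sh_trig.norm_sub_le (e0 k)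
      ((le_max_right _ _).trans (le_eMax ew es k i))).trans (mul_le_mul_of_nonneg_right q1 (e0 k))
  have fw : ∀ k, frob (w (k + 1) - w k) ≤ L * (M ^ 2 * (matNorm TR (xErr pR wt k)
      + α * matNorm TC (yErr pC s k) + α * ‖∑ i, s k i‖ + eMax ew es k)) := fun k => by
    have h1 : frob (w (k + 1) - w k) ≤ L * frob (wt (k + 1) - wt k) := by
      refine frob_le_mul_of_norm_le hL.le fun i => ?_
      have := strongConvex_gradient_expand (hF i) hL (hk i) (w k i) (w (k + 1) i)
      rwa [h.gradient_eq hF, h.gradient_eq hF] at this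
    refine h1.trans (mul_le_mul_of_nonneg_left ?_ hL.le)
    rw [h.wt_sub (pR := pR) hnet.R_row]
    have h2 := frob_add_le (-act (R - 1) (xErr pR wt k) + act (R - 1) (wh k - wt k)) (α • s k)
    have h3 := frob_add_le (-act (R - 1) (xErr pR wt k)) (act (R - 1) (wh k - wt k))
    rw [frob_neg] at h3
    rw [frob_smul, abs_of_pos hα] at h2
    have h4 := fact (R - 1) _ q4 (fx k)
    have h5 := fact (R - 1) _ q4 (fwh k)
    have h6 := mul_le_mul_of_nonneg_left (fs k) hα.le
    have h7 : α * (M * matNorm TC (yErr pC s k)) ≤ M ^ 2 * (α * matNorm TC (yErr pC s k)) := by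
      have := mul_nonneg hα.le (hy0 k)
      nlinarith
    have h8 : α * ‖∑ i, s k i‖ ≤ M ^ 2 * (α * ‖∑ i, s k i‖) :=
      le_mul_of_one_le_left (mul_nonneg hα.le (hs0 k)) (one_le_pow₀ q0)
    linarith
  have hϖ0 : 0 ≤ ∑ i, pC i * pR i :=
    Finset.sum_nonneg fun i _ => mul_nonneg (hp.C_nonneg i) (hp.R_nonneg i)
  have hϖ1 : ∑ i, pC i * pR i ≤ 1 := by
    calc ∑ i, pC i * pR i ≤ ∑ i, pC i * 1 := Finset.sum_le_sum fun i _ =>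
          mul_le_mul_of_nonneg_left (hp.R_sum ▸ Finset.single_le_sum
            (fun j _ => hp.R_nonneg j) (Finset.mem_univ i)) (hp.C_nonneg i)
      _ = 1 := by simp [hp.C_sum]
  have hsg : ∀ k, ‖∑ i, s k i - gradient (dual F d) (xbar pR wt k)‖
      ≤ M ^ 2 * L * matNorm TR (xErr pR wt k) := fun k => by
    refine (h.norm_sum_s_sub_gradient_le hnet.C_col hL hF hk k).trans ?_
    have : √n * frob (xErr pR wt k) ≤ M * (M * matNorm TR (xErr pR wt k)) :=
      mul_le_mul q1 (fx k) (frob_nonneg _) M0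
    nlinarith
  refine ⟨hx0, hy0, hs0, fun k => norm_nonneg _, fun k => dualGap_nonneg hL hF hk _,
    fun k => ?_, fun k => ?_, fun k => ?_, fun k => ?_, fun k => ?_⟩
  · rw [h.xErr_succ hnet.R_row hp.R_eigen hp.R_sum]
    have h1 := matNorm_sub_le TR (act (devR R pR) (xErr pR wt k) - act (R - 1) (wh k - wt k))
      (α • act (projR pR) (s k))
    have h2 := matNorm_sub_le TR (act (devR R pR) (xErr pR wt k)) (act (R - 1) (wh k - wt k))
    have h3 := matNorm_act_le hT.TR_inv (devR R pR) (xErr pR wt k)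
    have h4 := mul_le_mul_of_nonneg_right
      (le_max_left (opNorm TR (devR R pR)) (opNorm TC (devC C pC))) (hx0 k)
    have h5 := (matNorm_le_frob hT.R_le (act (R - 1) (wh k - wt k))).trans (fact _ _ q4 (fwh k))
    have h6 := matNorm_le_frob hT.R_le (α • act (projR pR) (s k))
    rw [frob_smul, abs_of_pos hα] at h6
    have h7 := mul_le_mul_of_nonneg_left (fact _ _ q2 (fs k)) hα.le
    have h8 : M * (M * eMax ew es k) ≤ M ^ 4 * eMax ew es k := by
      rw [← mul_assoc, ← sq]; exact mul_le_mul_of_nonneg_right M2 (e0 k)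
    have h9 : α * (M * (M * matNorm TC (yErr pC s k) + ‖∑ i, s k i‖))
        ≤ M ^ 4 * (α * matNorm TC (yErr pC s k) + α * ‖∑ i, s k i‖) := by
      have a1 := mul_le_mul_of_nonneg_right M2 (mul_nonneg hα.le (hy0 k))
      have a2 := mul_le_mul_of_nonneg_right M1 (mul_nonneg hα.le (hs0 k))
      nlinarith
    linarith
  · rw [h.yErr_succ hnet.C_col hp.C_eigen hp.C_sum]
    have h1 := matNorm_sub_le TC (act (devC C pC) (yErr pC s k) + act (C - 1) (sh k - s k))
      (act (projC pC) (w (k + 1) - w k))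
    have h2 := matNorm_add_le TC (act (devC C pC) (yErr pC s k)) (act (C - 1) (sh k - s k))
    have h3 := matNorm_act_le hT.TC_inv (devC C pC) (yErr pC s k)
    have h4 := mul_le_mul_of_nonneg_right
      (le_max_right (opNorm TR (devR R pR)) (opNorm TC (devC C pC))) (hy0 k)
    have h5 := (matNorm_le_frob hT.C_le (act (C - 1) (sh k - s k))).trans (fact _ _ q5 (fsh k))
    have h6 := (matNorm_le_frob hT.C_le (act (projC pC) (w (k + 1) - w k))).trans
      (fact _ _ q3 (fw k))
    have h8 : M * (M * eMax ew es k) ≤ M ^ 4 * eMax ew es k := by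
      rw [← mul_assoc, ← sq]; exact mul_le_mul_of_nonneg_right M2 (e0 k)
    have h9 : M * (L * (M ^ 2 * (matNorm TR (xErr pR wt k)
        + α * matNorm TC (yErr pC s k) + α * ‖∑ i, s k i‖ + eMax ew es k)))
        ≤ M ^ 4 * L * (matNorm TR (xErr pR wt k)
        + α * matNorm TC (yErr pC s k) + α * ‖∑ i, s k i‖ + eMax ew es k) := by
      have a0 : 0 ≤ L * (matNorm TR (xErr pR wt k)
        + α * matNorm TC (yErr pC s k) + α * ‖∑ i, s k i‖ + eMax ew es k) := by
        have := hx0 k; have := hy0 k; have := hs0 k; have := e0 k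
        positivity
      have a1 := mul_le_mul_of_nonneg_right M3 a0
      linarith
    linarith
  · have h1 := norm_add_le (∑ i, s k i - gradient (dual F d) (xbar pR wt k))
      (gradient (dual F d) (xbar pR wt k))
    rw [sub_add_cancel] at h1
    have h2 := hsg k
    have h3 := mul_le_mul_of_nonneg_right M2 (mul_nonneg hL.le (hx0 k))
    linarith
  · set g := gradient (dual F d) (xbar pR wt k) with hg
    set u := ∑ i, pR i • s k i with hu
    set v := ∑ i, pR i • yErr pC s k i with hv
    set ϖ := ∑ i, pC i * pR i with hϖ
    have huv : u = v + ϖ • ∑ j, s k j := IsRun.sum_smul_s pR pC s k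
    have hvy : ‖v‖ ≤ M * matNorm TC (yErr pC s k) :=
      (norm_sum_smul_le_frob hp.R_nonneg hp.R_sum _).trans (fy k)
    have h1 := dual_upper (d := d) hL hF hk (xbar pR wt k) (xbar pR wt (k + 1))
    rw [h.xbar_succ hnet.R_row hp.R_eigen, ← hu, sub_sub_cancel_left, inner_neg_right,
      inner_smul_right, norm_neg, norm_smul, mul_pow, Real.norm_of_nonneg hα.le, ← hg] at h1
    rw [h.xbar_succ hnet.R_row hp.R_eigen, ← hu]
    -- The direction of motion `u` is `ϖ • g` plus the tracking error `v` and the gradient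
    -- approximation error. The first part is the descent, the other two are the cross terms.
    have h2 : ⟪g, u⟫_ℝ = ϖ * ‖g‖ ^ 2 + ⟪g, v⟫_ℝ + ϖ * ⟪g, ∑ i, s k i - g⟫_ℝ := by
      rw [huv, inner_add_right, inner_smul_right, inner_sub_right, real_inner_self_eq_norm_sq]
      ring
    have h3 := neg_le_of_abs_le (abs_real_inner_le_norm g v)
    have h4 := neg_le_of_abs_le (abs_real_inner_le_norm g (∑ i, s k i - g))
    have hg0 := norm_nonneg g
    have h5 : ‖g‖ * ‖v‖ ≤ M ^ 4 * (‖g‖ * matNorm TC (yErr pC s k)) := by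
      have a1 := mul_le_mul_of_nonneg_left hvy hg0
      have a2 := mul_le_mul_of_nonneg_right M1 (mul_nonneg hg0 (hy0 k))
      linarith
    have h6 : -(M ^ 4 * (‖g‖ * (L * matNorm TR (xErr pR wt k))))
        ≤ ϖ * ⟪g, ∑ i, s k i - g⟫_ℝ := by
      have a1 := mul_le_mul_of_nonneg_left (hsg k) hg0
      have a2 := mul_le_mul_of_nonneg_right M2
        (mul_nonneg hg0 (mul_nonneg hL.le (hx0 k)))
      have a3 : 0 ≤ ‖g‖ * ‖∑ i, s k i - g‖ := by positivity
      have a4 := mul_le_mul_of_nonneg_left h4 hϖ0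
      have a5 := mul_le_mul_of_nonneg_right hϖ1 a3
      linarith
    have h7 : ‖u‖ ≤ M * matNorm TC (yErr pC s k) + ‖∑ i, s k i‖ := by
      rw [huv]
      refine (norm_add_le _ _).trans (add_le_add hvy ?_)
      rw [norm_smul, Real.norm_of_nonneg hϖ0]
      exact mul_le_of_le_one_left (hs0 k) hϖ1
    have h8 : n * ‖u‖ ^ 2 ≤ 2 * M ^ 4 * (matNorm TC (yErr pC s k) ^ 2 + ‖∑ i, s k i‖ ^ 2) := by
      have a1 := pow_le_pow_left₀ (norm_nonneg u) h7 2
      have a2 : (M * matNorm TC (yErr pC s k) + ‖∑ i, s k i‖) ^ 2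
          ≤ 2 * M ^ 2 * (matNorm TC (yErr pC s k) ^ 2 + ‖∑ i, s k i‖ ^ 2) := by
        have b1 := sq_nonneg (M * matNorm TC (yErr pC s k) - ‖∑ i, s k i‖)
        have b2 : 1 ≤ M ^ 2 := one_le_pow₀ q0
        have b3 := mul_le_mul_of_nonneg_right b2 (sq_nonneg ‖∑ i, s k i‖)
        linarith
      calc n * ‖u‖ ^ 2 ≤ M ^ 2 * (2 * M ^ 2 * (matNorm TC (yErr pC s k) ^ 2
            + ‖∑ i, s k i‖ ^ 2)) := mul_le_mul hnM (a1.trans a2) (sq_nonneg _) (by positivity)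
        _ = _ := by ring
    have h9 := mul_le_mul_of_nonneg_left h8 (mul_nonneg hL.le (sq_nonneg α))
    have h10 : α * (ϖ * ‖g‖ ^ 2 - M ^ 4 * (‖g‖ * matNorm TC (yErr pC s k))
        - M ^ 4 * (‖g‖ * (L * matNorm TR (xErr pR wt k)))) ≤ α * ⟪g, u⟫_ℝ := by
      refine mul_le_mul_of_nonneg_left ?_ hα.le
      linarith
    unfold dualGap
    linarith
  · have h1 := gradient_dual_sq_le (d := d) hn hL hF hk (xbar pR wt k)
    have h2 := mul_le_mul_of_nonneg_right (hnM.trans M2)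
      (mul_nonneg hL.le (dualGap_nonneg (d := d) hL hF hk (xbar pR wt k)))
    linarith

end Run

end ETDGT

end

noncomputable section

namespace ETDGT

/-! ## Lyapunov analysis of the error recursions -/

/-- Squared form of `StepBounds`. -/
structure SqBounds (ρ c ϖ L α : ℝ) (x y s g Δ e : ℕ → ℝ) : Prop where
  gap_nonneg : ∀ k, 0 ≤ Δ k
  x_step : ∀ k, x (k + 1) ^ 2 ≤ ρ * x k ^ 2
    + c * (α ^ 2 * y k ^ 2 + α ^ 2 * s k ^ 2 + e k ^ 2)
  y_step : ∀ k, y (k + 1) ^ 2 ≤ ρ * y k ^ 2 + c * e k ^ 2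
    + c * L ^ 2 * (x k ^ 2 + α ^ 2 * y k ^ 2 + α ^ 2 * s k ^ 2 + e k ^ 2)
  s_le : ∀ k, s k ^ 2 ≤ c * (g k ^ 2 + L ^ 2 * x k ^ 2)
  gap_step : ∀ k, Δ (k + 1) ≤ Δ k - α * ϖ * g k ^ 2 + c * α * g k * (L * x k + y k)
    + c * L * α ^ 2 * (y k ^ 2 + s k ^ 2)
  g_sq_le : ∀ k, g k ^ 2 ≤ c * L * Δ k

/-- Young's inequality weighted so that `σ²` rises only to the midpoint between `σ²` and `1`. -/
lemma sq_add_le_of_contraction {σ : ℝ} (h0 : 0 ≤ σ) (h1 : σ < 1) (x r : ℝ) :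
    (σ * x + r) ^ 2 ≤ (1 + σ ^ 2) / 2 * x ^ 2 + (1 + 2 / (1 - σ ^ 2)) * r ^ 2 := by
  have hσ : 0 < 1 - σ ^ 2 := by nlinarith
  have e : (1 + σ ^ 2) / 2 * x ^ 2 + (1 + 2 / (1 - σ ^ 2)) * r ^ 2 - (σ * x + r) ^ 2
      = ((1 - σ ^ 2) * x / 2 - σ * r) ^ 2 * (2 / (1 - σ ^ 2)) + 2 * r ^ 2 := by
    field_simp
    ring
  have : 0 ≤ ((1 - σ ^ 2) * x / 2 - σ * r) ^ 2 * (2 / (1 - σ ^ 2)) + 2 * r ^ 2 := by positivity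
  linarith

lemma StepBounds.sqBounds {σ K ϖ L α : ℝ} {x y s g Δ e : ℕ → ℝ}
    (h : StepBounds σ K ϖ L α x y s g Δ e) (hσ0 : 0 ≤ σ) (hσ1 : σ < 1) (hK : 1 ≤ K) (hL : 0 < L)
    (hα : 0 < α) :
    SqBounds ((1 + σ ^ 2) / 2) (8 * (1 + 2 / (1 - σ ^ 2)) * K ^ 2) ϖ L α x y s g Δ e := by
  set Q := 1 + 2 / (1 - σ ^ 2) with hQ
  have hσ : 0 < 1 - σ ^ 2 := by nlinarith
  have hQ1 : 1 ≤ Q := by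
    have : 0 < 2 / (1 - σ ^ 2) := by positivity
    rw [hQ]; linarith
  have hK2 : K ≤ K ^ 2 := by nlinarith
  have hQK : K ^ 2 ≤ Q * K ^ 2 := le_mul_of_one_le_left (sq_nonneg K) hQ1
  refine ⟨h.gap_nonneg, fun k => ?_, fun k => ?_, fun k => ?_,
    fun k => ?_, fun k => ?_⟩
  · have h1 := (pow_le_pow_left₀ (h.x_nonneg (k + 1)) (h.x_step k) 2).trans
      (sq_add_le_of_contraction hσ0 hσ1 _ _)
    have h2 : (K * (α * y k + α * s k + e k)) ^ 2
        ≤ 8 * K ^ 2 * (α ^ 2 * y k ^ 2 + α ^ 2 * s k ^ 2 + e k ^ 2) := by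
      have : (α * y k + α * s k + e k) ^ 2
          ≤ 8 * (α ^ 2 * y k ^ 2 + α ^ 2 * s k ^ 2 + e k ^ 2) := by
        nlinarith [sq_nonneg (α * y k - α * s k), sq_nonneg (α * y k - e k),
          sq_nonneg (α * s k - e k), sq_nonneg (α * y k), sq_nonneg (α * s k), sq_nonneg (e k)]
      rw [mul_pow]
      nlinarith [mul_le_mul_of_nonneg_left this (sq_nonneg K)]
    have h3 := mul_le_mul_of_nonneg_left h2 (zero_le_one.trans hQ1)
    rw [← hQ] at h1
    linarith
  · have h0 := h.y_step k
    rw [add_assoc] at h0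
    have h1 := (pow_le_pow_left₀ (h.y_nonneg (k + 1)) h0 2).trans
      (sq_add_le_of_contraction hσ0 hσ1 _ _)
    have h2 : (K * e k + K * L * (x k + α * y k + α * s k + e k)) ^ 2
        ≤ 8 * K ^ 2 * e k ^ 2
          + 8 * K ^ 2 * L ^ 2 * (x k ^ 2 + α ^ 2 * y k ^ 2 + α ^ 2 * s k ^ 2 + e k ^ 2) := by
      have a1 : (x k + α * y k + α * s k + e k) ^ 2
          ≤ 4 * (x k ^ 2 + α ^ 2 * y k ^ 2 + α ^ 2 * s k ^ 2 + e k ^ 2) := by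
        nlinarith [sq_nonneg (x k - α * y k), sq_nonneg (x k - α * s k), sq_nonneg (x k - e k),
          sq_nonneg (α * y k - α * s k), sq_nonneg (α * y k - e k), sq_nonneg (α * s k - e k)]
      have a2 := mul_le_mul_of_nonneg_left a1 (sq_nonneg (K * L))
      have a3 := sq_nonneg (K * e k - K * L * (x k + α * y k + α * s k + e k))
      have a4 := sq_nonneg (K * e k)
      nlinarith
    have h3 := mul_le_mul_of_nonneg_left h2 (zero_le_one.trans hQ1)
    rw [← hQ] at h1
    linarith
  · have h1 := pow_le_pow_left₀ (h.s_nonneg k) (h.s_le k) 2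
    have h2 : (g k + K * L * x k) ^ 2 ≤ 2 * g k ^ 2 + 2 * K ^ 2 * (L ^ 2 * x k ^ 2) := by
      nlinarith [sq_nonneg (g k - K * L * x k)]
    have h3 := mul_nonneg (sq_nonneg L) (sq_nonneg (x k))
    have h4 := mul_le_mul_of_nonneg_right hQK h3
    have h5 : 1 ≤ Q * K ^ 2 := by nlinarith
    have h6 := mul_le_mul_of_nonneg_right h5 (sq_nonneg (g k))
    have h7 : 0 ≤ K ^ 2 * (L ^ 2 * x k ^ 2) := mul_nonneg (sq_nonneg K) h3
    have h8 := sq_nonneg (g k)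
    linarith
  · have h1 := h.gap_step k
    have h2 : 0 ≤ α * g k * (L * x k + y k) := by
      have := h.g_nonneg k; have := h.x_nonneg k; have := h.y_nonneg k
      positivity
    have h3 : 0 ≤ L * α ^ 2 * (y k ^ 2 + s k ^ 2) := by positivity
    have h4 := mul_le_mul_of_nonneg_right (hK2.trans hQK) h2
    have h5 := mul_le_mul_of_nonneg_right (hK2.trans hQK) h3
    have h6 := mul_nonneg (zero_le_one.trans hK) h2
    have h7 := mul_nonneg (zero_le_one.trans hK) h3
    linarith
  · have h1 := h.g_sq_le k
    have h2 := mul_nonneg hL.le (h.gap_nonneg k)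
    have h3 := mul_le_mul_of_nonneg_right (hK2.trans hQK) h2
    have h4 := mul_nonneg (zero_le_one.trans hK) h2
    linarith

set_option maxHeartbeats 2000000 in
/-- For small `α L / ϖ` the squared dual gradients and consensus errors are summable. -/
lemma SqBounds.sum_bounded {ρ c ϖ L α : ℝ} {x y s g Δ e : ℕ → ℝ}
    (h : SqBounds ρ c ϖ L α x y s g Δ e) (hρ0 : 0 ≤ ρ) (hρ1 : ρ < 1) (hc : 1 ≤ c) (hϖ0 : 0 < ϖ)
    (hϖ1 : ϖ ≤ 1) (hL : 0 < L) (hα : 0 < α) (hsmall : α * L ≤ ϖ * ((1 - ρ) ^ 2 / (20 * c ^ 3)))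
    (he : Summable fun k => e k ^ 2) :
    ∃ B : ℝ, ∀ k, ∑ t ∈ Finset.range k, g t ^ 2 ≤ B ∧ ∑ t ∈ Finset.range k, x t ^ 2 ≤ B := by
  -- The weight `b` of the tracking error is such that its feedback from `x` uses only `(1 - ρ) / 4`
  -- of the margin, and `τ` is the threshold for which `5 c² τ = b (1 - ρ)`.
  set τ := (1 - ρ) ^ 2 / (20 * c ^ 3) with hτ
  set b := (1 - ρ) / (4 * c) with hb
  have hc0 : 0 < c := by linarith
  have h1ρ : 0 < 1 - ρ := by linarith
  have hτ0 : 0 < τ := by positivity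
  have hb0 : 0 < b := by positivity
  have hbc : b * c = (1 - ρ) / 4 := by rw [hb]; field_simp
  have hb1 : b ≤ 1 := by nlinarith
  have hτb : 5 * c ^ 2 * τ = b * (1 - ρ) := by rw [hτ, hb]; field_simp; ring
  have hτ1 : 5 * c ^ 2 * τ ≤ (1 - ρ) / 4 := by rw [hτb]; nlinarith
  have hc2 : c ≤ c ^ 2 := by nlinarith
  have hc21 : 1 ≤ c ^ 2 := by nlinarith
  have hττ : τ ≤ 1 := by nlinarith
  have hαL0 : 0 < α * L := mul_pos hα hL
  have hαLτ : α * L ≤ τ := hsmall.trans (mul_le_of_le_one_left hτ0.le hϖ1)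
  have hαL2 : (α * L) ^ 2 ≤ τ := by nlinarith
  -- The powers of `L` make the three terms homogeneous, so smallness is needed only of `α L` and `α
  -- L / ϖ`.
  set V : ℕ → ℝ := fun k => Δ k + L * x k ^ 2 + b / L * y k ^ 2 with hV
  set N := c * (L + b / L + b * L) with hN
  have step : ∀ k, V (k + 1) + (α * ϖ / 2 * g k ^ 2 + (1 - ρ) / 2 * L * x k ^ 2)
      ≤ V k + N * e k ^ 2 := by
    intro k
    have hx := mul_le_mul_of_nonneg_left (h.x_step k) hL.le
    have hy := mul_le_mul_of_nonneg_left (h.y_step k) (div_pos hb0 hL).le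
    have hs := h.s_le k
    have hgap := h.gap_step k
    -- The cross term may use a quarter of the descent `α ϖ g²`. This produces `α / ϖ`, which is why
    -- the threshold for `α L` is relative to `ϖ`.
    have young : c * α * g k * (L * x k + y k)
        ≤ α * ϖ / 4 * g k ^ 2 + 2 * c ^ 2 * (α / ϖ) * (L ^ 2 * x k ^ 2 + y k ^ 2) := by
      have e1 : α * ϖ / 4 * g k ^ 2 + 2 * c ^ 2 * (α / ϖ) * (L ^ 2 * x k ^ 2 + y k ^ 2)
          - c * α * g k * (L * x k + y k)
          = α / ϖ * ((ϖ * g k / 2 - c * (L * x k + y k)) ^ 2 + c ^ 2 * (L * x k - y k) ^ 2) := by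
        field_simp
        ring
      have : 0 ≤ α / ϖ * ((ϖ * g k / 2 - c * (L * x k + y k)) ^ 2
          + c ^ 2 * (L * x k - y k) ^ 2) := by positivity
      linarith
    have hϖα : α / ϖ * L ≤ τ := by
      rw [div_mul_eq_mul_div, div_le_iff₀ hϖ0]; linarith
    set G := g k ^ 2 with hG
    set X := x k ^ 2 with hX
    set Y := y k ^ 2 with hY
    have hG0 : 0 ≤ G := sq_nonneg _
    have hX0 : 0 ≤ X := sq_nonneg _
    have hY0 : 0 ≤ Y := sq_nonneg _
    -- This is the total coefficient of `s²`: one share from the gap, one from `L x²`, and `b` from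
    -- the tracking error. Its gradient part uses another quarter of the descent.
    have hs1 := mul_le_mul_of_nonneg_left hs
      (show 0 ≤ (2 + b) * c * L * α ^ 2 by positivity)
    have cg : (2 + b) * c * L * α ^ 2 * (c * G) ≤ α * ϖ / 4 * G := by
      have a1 : (2 + b) * c ^ 2 * (α * L) ≤ ϖ / 4 := by
        have : (2 + b) * c ^ 2 * (α * L) ≤ 3 * c ^ 2 * (ϖ * τ) := by gcongr; linarith
        nlinarith
      have a2 := mul_le_mul_of_nonneg_left a1 (mul_nonneg hα.le hG0)
      linarith
    have cx : (2 + b) * c * L * α ^ 2 * (c * (L ^ 2 * X))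
        + 2 * c ^ 2 * (α / ϖ) * (L ^ 2 * X) + b * c * (L * X)
        ≤ (1 - ρ) / 2 * (L * X) := by
      have a1 : (2 + b) * c ^ 2 * (α * L) ^ 2 + 2 * c ^ 2 * (α / ϖ * L) ≤ (1 - ρ) / 4 := by
        have : (2 + b) * c ^ 2 * (α * L) ^ 2 + 2 * c ^ 2 * (α / ϖ * L)
          ≤ 3 * c ^ 2 * τ + 2 * c ^ 2 * τ := by gcongr; linarith
        linarith
      have a2 := mul_le_mul_of_nonneg_right a1 (mul_nonneg hL.le hX0)
      rw [hbc]
      linarith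
    have cy : 2 * c * L * α ^ 2 * Y + 2 * c ^ 2 * (α / ϖ) * Y + b / L * (c * L ^ 2 * (α ^ 2 * Y))
        ≤ (1 - ρ) * (b / L * Y) := by
      have a1 : (2 + b) * c * (α * L) ^ 2 + 2 * c ^ 2 * (α / ϖ * L) ≤ (1 - ρ) * b := by
        have : (2 + b) * c * (α * L) ^ 2 + 2 * c ^ 2 * (α / ϖ * L)
          ≤ 3 * c ^ 2 * τ + 2 * c ^ 2 * τ := by gcongr; linarith
        linarith
      have a2 := mul_le_mul_of_nonneg_right a1 (div_nonneg hY0 hL.le)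
      have e1 : ((2 + b) * c * (α * L) ^ 2 + 2 * c ^ 2 * (α / ϖ * L)) * (Y / L)
          = 2 * c * L * α ^ 2 * Y + 2 * c ^ 2 * (α / ϖ) * Y
            + b / L * (c * L ^ 2 * (α ^ 2 * Y)) := by
        field_simp
        ring
      have e2 : (1 - ρ) * b * (Y / L) = (1 - ρ) * (b / L * Y) := by ring
      linarith
    have ebL : b / L * (c * L ^ 2 * (X + α ^ 2 * Y + α ^ 2 * s k ^ 2 + e k ^ 2))
        = b * c * (L * X) + b / L * (c * L ^ 2 * (α ^ 2 * Y)) + b * c * L * α ^ 2 * s k ^ 2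
          + b * c * L * e k ^ 2 := by
      field_simp
    simp only [hV]
    rw [mul_add, ebL] at hy
    rw [hN]
    linarith
  have total : ∀ k, V k + ∑ t ∈ Finset.range k, (α * ϖ / 2 * g t ^ 2
      + (1 - ρ) / 2 * L * x t ^ 2) ≤ V 0 + N * ∑ t ∈ Finset.range k, e t ^ 2 := by
    intro k
    induction k with
    | zero => simp
    | succ k ih =>
      rw [Finset.sum_range_succ, Finset.sum_range_succ]
      have := step k
      linarith
  have hN0 : 0 ≤ N := by rw [hN]; positivity
  set T := V 0 + N * ∑' t, e t ^ 2 with hT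
  have hbound : ∀ k, ∑ t ∈ Finset.range k, (α * ϖ / 2 * g t ^ 2
      + (1 - ρ) / 2 * L * x t ^ 2) ≤ T := by
    intro k
    have h1 := total k
    have h2 := mul_le_mul_of_nonneg_left
      (he.sum_le_tsum (Finset.range k) (fun t _ => sq_nonneg (e t))) hN0
    have h3 : 0 ≤ V k := by
      have := h.gap_nonneg k
      simp only [hV]
      positivity
    linarith
  have p1 : 0 < α * ϖ / 2 := by positivity
  have p2 : 0 < (1 - ρ) / 2 * L := by positivity
  refine ⟨max (T / (α * ϖ / 2)) (T / ((1 - ρ) / 2 * L)), fun k => ⟨?_, ?_⟩⟩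
  · refine le_trans ?_ (le_max_left _ _)
    rw [le_div_iff₀ p1, mul_comm, Finset.mul_sum]
    refine (Finset.sum_le_sum fun t _ => ?_).trans (hbound k)
    exact le_add_of_nonneg_right (mul_nonneg p2.le (sq_nonneg _))
  · refine le_trans ?_ (le_max_right _ _)
    rw [le_div_iff₀ p2, mul_comm, Finset.mul_sum]
    refine (Finset.sum_le_sum fun t _ => ?_).trans (hbound k)
    exact le_add_of_nonneg_left (mul_nonneg p1.le (sq_nonneg _))

/-- Weights and smallness thresholds for the Lyapunov function `Δ + a (L + L²) x² + B y²`. -/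
structure LyapunovWeights (ρ c ν a B τ S : ℝ) : Prop where
  a_ge : c ≤ a
  B_pos : 0 < B
  τ_pos : 0 < τ
  S_pos : 0 < S
  a_gap : c ^ 3 + 2 * B * c ^ 2 ≤ a * ((1 - ρ) / 2)
  B_gap : c ^ 3 / 2 + 1 ≤ B * ((1 - ρ) / 2)
  τ_gap : (2 * ν + c ^ 2) * τ ≤ (1 - ρ) / 2
  τ_le : c * ν * (1 + 2 * a) * τ ≤ 1
  τ_le_one : τ ≤ 1
  S_ge : c ^ 6 * (1 + a) ^ 2 / 4 + c ^ 3 * (a + B) ≤ 2 * S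

/-- The requirements are triangular: choose `B`, then `a`, then `τ` and `S`. None depends on the
cost functions or on the step size, so the norms may depend on these weights. -/
lemma exists_lyapunovWeights {ρ c ν : ℝ} (hρ0 : 0 ≤ ρ) (hρ1 : ρ < 1) (hc : 1 ≤ c) (hν : 1 ≤ ν) :
    ∃ a B τ S, LyapunovWeights ρ c ν a B τ S := by
  have h1ρ : 0 < 1 - ρ := by linarith
  have hc0 : 0 < c := by linarith
  have hν0 : 0 < ν := by linarith
  set B := (c ^ 3 + 2) / (1 - ρ) with hB
  set a := 2 * (c ^ 3 + 2 * B * c ^ 2) / (1 - ρ) with ha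
  have hB0 : 0 < B := by positivity
  have ha0 : 0 < a := by positivity
  refine ⟨a, B, min 1 (min ((1 - ρ) / 2 / (2 * ν + c ^ 2)) (1 / (c * ν * (1 + 2 * a)))),
    (c ^ 6 * (1 + a) ^ 2 / 4 + c ^ 3 * (a + B)) / 2, ?_, hB0, by positivity, by positivity, ?_, ?_,
    ?_, ?_, min_le_left _ _, by linarith⟩
  · rw [ha, le_div_iff₀ h1ρ]
    have h1 : c ≤ c ^ 3 := le_self_pow₀ hc (by norm_num)
    have h2 : 0 ≤ B * c ^ 2 := by positivity
    nlinarith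
  · rw [ha]; apply le_of_eq; field_simp
  · rw [hB]; apply le_of_eq; field_simp
  · have h1 : 0 < 2 * ν + c ^ 2 := by positivity
    rw [mul_comm, ← le_div_iff₀ h1]
    exact (min_le_right _ _).trans (min_le_left _ _)
  · have h1 : 0 < c * ν * (1 + 2 * a) := by positivity
    rw [mul_comm, ← le_div_iff₀ h1]
    exact (min_le_right _ _).trans (min_le_right _ _)

set_option maxHeartbeats 2000000 in
-- The factor `lam` must exceed the contraction rate `ρ` of `x` and `y` by a fixed margin, and the
-- gap rate `1 - 2βϖα` by a term of order `α² L G`. The weight `L + L²` of `x²` covers small and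
-- large `L` alike.
lemma SqBounds.lyapunov_step {ρ c ϖ L α ν a B τ S β lam G : ℝ} {x y s g Δ e : ℕ → ℝ}
    (h : SqBounds ρ c ϖ L α x y s g Δ e) (hw : LyapunovWeights ρ c ν a B τ S)
    (hc : 1 ≤ c) (hν : 1 ≤ ν) (hϖ0 : 0 ≤ ϖ) (hL : 0 < L) (hα : 0 < α) (hαL : α * L ≤ τ)
    (hαν : α ≤ ν) (hPL : ∀ k, 2 * β * Δ k ≤ g k ^ 2) (hlam0 : 1 - 2 * ν * (α * L) ≤ lam)
    (hlam : 1 - 2 * β * ϖ * α + 2 * α ^ 2 * L * G ≤ lam) (hG : 1 + S * L ^ 2 ≤ G) (k : ℕ) :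
    Δ (k + 1) + a * (L + L ^ 2) * x (k + 1) ^ 2 + B * y (k + 1) ^ 2
      ≤ lam * (Δ k + a * (L + L ^ 2) * x k ^ 2 + B * y k ^ 2)
        + c * (2 * a + B) * (1 + L ^ 2) * e k ^ 2 := by
  have hc0 : 0 < c := by linarith
  have ha0 : 0 < a := by linarith [hw.a_ge]
  have hB0 := hw.B_pos
  have hαL0 : 0 < α * L := mul_pos hα hL
  have hαL1 : α * L ≤ 1 := hαL.trans hw.τ_le_one
  have hτ0 := hw.τ_pos
  have hc2 : c ≤ c ^ 2 := by nlinarith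
  have hc21 : 1 ≤ c ^ 2 := by nlinarith
  have hc23 : c ^ 2 ≤ c ^ 3 := pow_le_pow_right₀ hc (by norm_num)
  have hc13 : 1 ≤ c ^ 3 := one_le_pow₀ hc
  have hαL2 : (α * L) ^ 2 ≤ τ := by nlinarith
  have hα2L : α ^ 2 * L ≤ ν * τ := by
    have : α * (α * L) ≤ ν * τ := mul_le_mul hαν hαL hαL0.le (by linarith)
    linarith
  have hντ : τ ≤ ν * τ := le_mul_of_one_le_left hτ0.le hν
  have hgaplam : (1 - ρ) / 2 + c ^ 2 * τ ≤ lam - ρ := by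
    have h1 := hw.τ_gap
    have h2 := mul_le_mul_of_nonneg_left hαL (show 0 ≤ 2 * ν by linarith)
    linarith
  have hx := mul_le_mul_of_nonneg_left (h.x_step k) (show 0 ≤ a * (L + L ^ 2) by positivity)
  have hy := mul_le_mul_of_nonneg_left (h.y_step k) hB0.le
  have hs := h.s_le k
  have hgap := h.gap_step k
  have hg := h.g_sq_le k
  have hPLk := mul_le_mul_of_nonneg_left (hPL k) (mul_nonneg hα.le hϖ0)
  -- Unlike in the sublinear case, the whole descent is reserved for the Polyak-Łojasiewicz
  -- inequality. The gradient part of the cross term is bounded by `α² L Δ`, through `g² ≤ c L Δ`.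
  have young : c * α * g k * (L * x k + y k)
      ≤ α ^ 2 * L * Δ k + c ^ 3 / 2 * (L ^ 2 * x k ^ 2 + y k ^ 2) := by
    have h1 : c * α * g k * (L * x k + y k)
        ≤ α ^ 2 * (g k ^ 2 / c) + c ^ 3 / 2 * (L ^ 2 * x k ^ 2 + y k ^ 2) := by
      have e1 : α ^ 2 * (g k ^ 2 / c) + c ^ 3 / 2 * (L ^ 2 * x k ^ 2 + y k ^ 2)
          - c * α * g k * (L * x k + y k)
          = 1 / c * (α * g k - c ^ 2 / 2 * (L * x k + y k)) ^ 2
            + c ^ 3 / 4 * (L * x k - y k) ^ 2 := by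
        field_simp
        ring
      have : 0 ≤ 1 / c * (α * g k - c ^ 2 / 2 * (L * x k + y k)) ^ 2
            + c ^ 3 / 4 * (L * x k - y k) ^ 2 := by positivity
      linarith
    have h2 : g k ^ 2 / c ≤ L * Δ k := by rw [div_le_iff₀ hc0]; linarith
    have h3 := mul_le_mul_of_nonneg_left h2 (sq_nonneg α)
    linarith
  have hΔ0 := h.gap_nonneg k
  set D := Δ k with hD
  set X := x k ^ 2 with hX
  set Y := y k ^ 2 with hY
  have hX0 : 0 ≤ X := sq_nonneg _
  have hY0 : 0 ≤ Y := sq_nonneg _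
  have hs' : s k ^ 2 ≤ c ^ 2 * L * D + c * L ^ 2 * X := by
    have := mul_le_mul_of_nonneg_left hg hc0.le
    linarith
  have hs1 := mul_le_mul_of_nonneg_left hs'
    (show 0 ≤ c * α ^ 2 * (L + a * (L + L ^ 2) + B * L ^ 2) by positivity)
  have cD : (1 - 2 * β * ϖ * α) * D + α ^ 2 * L * D
      + c * α ^ 2 * (L + a * (L + L ^ 2) + B * L ^ 2) * (c ^ 2 * L * D) ≤ lam * D := by
    have a1 : 1 + c ^ 3 * (L + a * (L + L ^ 2) + B * L ^ 2) ≤ 2 * G := by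
      have b1 := hw.S_ge
      -- This square absorbs the term linear in `L` into `1` and a multiple of `L²`.
      have b2 := sq_nonneg (1 - c ^ 3 * (1 + a) * L / 2)
      have b3 := mul_le_mul_of_nonneg_right b1 (sq_nonneg L)
      linarith
    have a2 := mul_le_mul_of_nonneg_left a1 (show 0 ≤ α ^ 2 * L by positivity)
    have a3 : 1 - 2 * β * ϖ * α
        + α ^ 2 * L * (1 + c ^ 3 * (L + a * (L + L ^ 2) + B * L ^ 2)) ≤ lam := by linarith
    have a4 := mul_le_mul_of_nonneg_right a3 hΔ0
    linarith
  have cX : c ^ 3 / 2 * (L ^ 2 * X) + a * (L + L ^ 2) * (ρ * X) + B * (c * L ^ 2 * X)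
      + c * α ^ 2 * (L + a * (L + L ^ 2) + B * L ^ 2) * (c * L ^ 2 * X)
      ≤ lam * (a * (L + L ^ 2) * X) := by
    have a1 : c ^ 3 / 2 * L ^ 2 + B * c * L ^ 2
        + c ^ 2 * (α * L) ^ 2 * (L + B * L ^ 2) ≤ (c ^ 3 + 2 * B * c ^ 2) * (L + L ^ 2) := by
      have b1 : c ^ 2 * (α * L) ^ 2 * (L + B * L ^ 2) ≤ c ^ 2 * 1 * (L + B * L ^ 2) := by
        gcongr; exact hαL2.trans hw.τ_le_one
      have b2 : c ^ 2 * L ≤ c ^ 3 * L := mul_le_mul_of_nonneg_right hc23 hL.le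
      have b3 : B * L ^ 2 * c ≤ B * L ^ 2 * c ^ 2 := mul_le_mul_of_nonneg_left hc2 (by positivity)
      have b4 : 0 ≤ B * c ^ 2 * L := by positivity
      have b5 : 0 ≤ c ^ 3 * L ^ 2 := by positivity
      linarith
    have a2 := mul_le_mul_of_nonneg_right hw.a_gap (show 0 ≤ L + L ^ 2 by positivity)
    have a3 : c ^ 2 * (α * L) ^ 2 ≤ c ^ 2 * τ := by gcongr
    have a4 : (c ^ 2 * (α * L) ^ 2 + (1 - ρ) / 2) * (a * (L + L ^ 2))
        ≤ (lam - ρ) * (a * (L + L ^ 2)) :=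
      mul_le_mul_of_nonneg_right (by linarith) (by positivity)
    have a5 : c ^ 3 / 2 * L ^ 2 + B * c * L ^ 2 + c ^ 2 * (α * L) ^ 2 * (L + B * L ^ 2)
        + c ^ 2 * (α * L) ^ 2 * (a * (L + L ^ 2)) + ρ * (a * (L + L ^ 2))
        ≤ lam * (a * (L + L ^ 2)) := by linarith
    have a6 := mul_le_mul_of_nonneg_right a5 hX0
    linarith
  have cY : c ^ 3 / 2 * Y + c * L * α ^ 2 * Y + a * (L + L ^ 2) * (c * (α ^ 2 * Y))
      + B * (ρ * Y) + B * (c * L ^ 2 * (α ^ 2 * Y)) ≤ lam * (B * Y) := by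
    have a1 : c * (α ^ 2 * L) + a * c * (α ^ 2 * L) + a * c * (α * L) ^ 2 ≤ 1 := by
      have b1 : c * (α ^ 2 * L) + a * c * (α ^ 2 * L) + a * c * (α * L) ^ 2
          ≤ c * (ν * τ) + a * c * (ν * τ) + a * c * (ν * τ) := by
        gcongr; exact hαL2.trans hντ
      have := hw.τ_le
      linarith
    have a2 : B * (c * (α * L) ^ 2) ≤ B * (c ^ 2 * τ) := by gcongr
    have a3 := mul_le_mul_of_nonneg_left hgaplam hB0.le
    have a4 := hw.B_gap
    have a5 : c ^ 3 / 2 + (c * (α ^ 2 * L) + a * c * (α ^ 2 * L) + a * c * (α * L) ^ 2)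
        + B * (c * (α * L) ^ 2) + B * ρ ≤ lam * B := by linarith
    have a6 := mul_le_mul_of_nonneg_right a5 hY0
    linarith
  have cE : a * (L + L ^ 2) * (c * e k ^ 2) + B * (c * e k ^ 2) + B * (c * L ^ 2 * e k ^ 2)
      ≤ c * (2 * a + B) * (1 + L ^ 2) * e k ^ 2 := by
    have a1 : L + L ^ 2 ≤ 2 * (1 + L ^ 2) := by nlinarith [sq_nonneg (L - 1)]
    have a2 := mul_le_mul_of_nonneg_left a1 (show 0 ≤ a * (c * e k ^ 2) by positivity)
    linarith
  linarith

/-- The sequence `M * q ^ (2 * k)` is a supersolution of the recursion exactly because the forcing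
fits into `M * (q ^ 2 - lam)`. -/
lemma geometric_bound {V : ℕ → ℝ} {lam q D M : ℝ} (hlam : 0 ≤ lam) (hq : 0 ≤ q) (h0 : V 0 ≤ M)
    (hD : D ≤ M * (q ^ 2 - lam)) (h : ∀ k, V (k + 1) ≤ lam * V k + D * q ^ (2 * k)) (k : ℕ) :
    V k ≤ M * q ^ (2 * k) := by
  induction k with
  | zero => simpa using h0
  | succ k ih =>
    have h1 := h k
    have h2 := mul_le_mul_of_nonneg_left ih hlam
    have h3 := mul_le_mul_of_nonneg_right hD (show 0 ≤ q ^ (2 * k) by positivity)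
    have e : q ^ (2 * (k + 1)) = q ^ (2 * k) * q ^ 2 := by rw [mul_add, pow_add]
    rw [e]
    linarith

end ETDGT

end

noncomputable section

namespace ETDGT

/-! ## Spectral radii of the comparison matrices -/

/-- The supersolution is `v = adj(1 - P) 1`, for which `(1 - P) v = det(1 - P) 1` is positive. -/
lemma rho_lt_one_of_two {P : Matrix (Fin 2) (Fin 2) ℝ} (hP : ∀ i j, 0 ≤ P i j) (h0 : P 0 0 < 1)
    (h1 : P 1 1 < 1) (hdet : P 0 1 * P 1 0 < (1 - P 0 0) * (1 - P 1 1)) : rho P < 1 := by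
  refine rho_lt_one_of_supersolution hP (v := ![1 - P 1 1 + P 0 1, 1 - P 0 0 + P 1 0]) ?_ ?_
  · intro i
    have := hP 0 1; have := hP 1 0
    fin_cases i <;> simp <;> linarith
  · intro i
    fin_cases i <;> simp [Fin.sum_univ_two] <;> linarith

/-- As in dimension two, `v = adj(1 - P) 1`, and the determinant hypothesis is `det(1 - P) > 0`.
Dropping non-negative terms from it makes the diagonal cofactors positive as well. -/
lemma rho_lt_one_of_three {P : Matrix (Fin 3) (Fin 3) ℝ} (hP : ∀ i j, 0 ≤ P i j)
    (h0 : P 0 0 < 1) (h1 : P 1 1 < 1) (h2 : P 2 2 < 1)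
    (hdet : P 0 1 * P 1 2 * P 2 0 + P 0 2 * P 1 0 * P 2 1 + P 0 2 * (1 - P 1 1) * P 2 0
      + (1 - P 0 0) * P 1 2 * P 2 1 + P 0 1 * P 1 0 * (1 - P 2 2)
      < (1 - P 0 0) * (1 - P 1 1) * (1 - P 2 2)) : rho P < 1 := by
  have p01 := hP 0 1; have p02 := hP 0 2; have p10 := hP 1 0
  have p12 := hP 1 2; have p20 := hP 2 0; have p21 := hP 2 1
  set a := 1 - P 0 0 with ha
  set b := 1 - P 1 1 with hb
  set c := 1 - P 2 2 with hc
  have ha0 : 0 < a := by linarith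
  have hb0 : 0 < b := by linarith
  have hc0 : 0 < c := by linarith
  have q1 : 0 ≤ P 0 1 * P 1 2 * P 2 0 := by positivity
  have q2 : 0 ≤ P 0 2 * P 1 0 * P 2 1 := by positivity
  have q3 : 0 ≤ P 0 2 * b * P 2 0 := by positivity
  have q4 : 0 ≤ a * P 1 2 * P 2 1 := by positivity
  have q5 : 0 ≤ P 0 1 * P 1 0 * c := by positivity
  have m0 : 0 < b * c - P 1 2 * P 2 1 := by
    refine pos_of_mul_pos_right (a := a) ?_ ha0.le
    linarith
  have m1 : 0 < a * c - P 0 2 * P 2 0 := by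
    refine pos_of_mul_pos_right (a := b) ?_ hb0.le
    linarith
  have m2 : 0 < a * b - P 0 1 * P 1 0 := by
    refine pos_of_mul_pos_right (a := c) ?_ hc0.le
    linarith
  have e0 : P 0 0 = 1 - a := by rw [ha]; ring
  have e1 : P 1 1 = 1 - b := by rw [hb]; ring
  have e2 : P 2 2 = 1 - c := by rw [hc]; ring
  refine rho_lt_one_of_supersolution hP (v := ![
    (b * c - P 1 2 * P 2 1) + (P 0 1 * c + P 0 2 * P 2 1) + (P 0 1 * P 1 2 + P 0 2 * b),
    (P 1 0 * c + P 1 2 * P 2 0) + (a * c - P 0 2 * P 2 0) + (a * P 1 2 + P 0 2 * P 1 0),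
    (P 1 0 * P 2 1 + b * P 2 0) + (a * P 2 1 + P 0 1 * P 2 0) + (a * b - P 0 1 * P 1 0)]) ?_ ?_
  · intro i
    fin_cases i <;> simp only [Fin.zero_eta, Fin.mk_one, Fin.reduceFinMk, Matrix.cons_val]
      <;> positivity
  · intro i
    fin_cases i <;>
      simp only [Fin.zero_eta, Fin.mk_one, Fin.reduceFinMk, Matrix.cons_val, Fin.sum_univ_three,
        e0, e1, e2] <;> linarith

/-! ### Spectral radii under the step-size conditions. -/

namespace Data

/-- The constraints which the data of a network and a problem satisfy. -/
structure Valid (c : Data) : Prop where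
  n_pos : 1 ≤ (c.n : ℝ)
  L_pos : 0 < c.L
  σR_nonneg : 0 ≤ c.σR
  σR_lt : c.σR < 1
  σC_nonneg : 0 ≤ c.σC
  σC_lt : c.σC < 1
  δRC_pos : 0 < c.δRC
  δCR_pos : 0 < c.δCR
  δ2R_pos : 0 < c.δ2R
  δ2C_pos : 0 < c.δ2C
  δ_mul : 1 ≤ c.δRC * c.δCR
  ϖ_nonneg : 0 ≤ c.ϖ
  ϖ_le : c.ϖ ≤ 1

variable {c : Data}

/-- With `x = α L`, `N = √n` and `D = δRC δCR ≥ 1`, the hypothesis yields `x D (N + 3) < (1 - σR)(1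
- σC)`, which implies the determinant condition of `rho_lt_one_of_two`. -/
lemma rho_P₁_lt_one (hc : c.Valid) {α : ℝ} (hα : 0 < α)
    (h : α < (1 - c.σR) * (1 - c.σC) / ((√c.n * c.L + √c.n + 3) * c.L * c.δRC * c.δCR)) :
    rho (c.P₁ α) < 1 := by
  have hL := hc.L_pos
  have hn : 1 ≤ √(c.n : ℝ) := Real.one_le_sqrt.2 hc.n_pos
  have hRC := hc.δRC_pos
  have hCR := hc.δCR_pos
  have ha : 0 < 1 - c.σR := sub_pos.2 hc.σR_lt
  have hb : 0 < 1 - c.σC := sub_pos.2 hc.σC_lt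
  have ha1 : 1 - c.σR ≤ 1 := by linarith [hc.σR_nonneg]
  have hb1 : 1 - c.σC ≤ 1 := by linarith [hc.σC_nonneg]
  have hD := hc.δ_mul
  have hσR := hc.σR_nonneg
  have hσC := hc.σC_nonneg
  rw [lt_div_iff₀ (by positivity)] at h
  set N := √(c.n : ℝ) with hN
  set a := 1 - c.σR with haa
  set b := 1 - c.σC with hbb
  set D := c.δRC * c.δCR with hDD
  set x := α * c.L with hx
  have hx0 : 0 < x := mul_pos hα hL
  have h1 : x * D * (N + 3) < a * b := by
    have : 0 ≤ x * D * (N * c.L) := by positivity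
    have e : α * ((N * c.L + N + 3) * c.L * c.δRC * c.δCR)
        = x * D * (N + 3) + x * D * (N * c.L) := by rw [hx, hDD]; ring
    linarith
  have hxN : x * (N + 3) < a * b := by
    have : x * (N + 3) ≤ x * (N + 3) * D := le_mul_of_one_le_right (by positivity) hD
    linarith
  have hab : a * b ≤ a := mul_le_of_le_one_right ha.le hb1
  have hab' : a * b ≤ b := mul_le_of_le_one_left hb.le ha1
  have h2 : x * N < a := by nlinarith
  have h3 : x < b := by nlinarith
  refine rho_lt_one_of_two ?_ ?_ ?_ ?_
  · intro i j
    fin_cases i <;> fin_cases j <;> simp [P₁] <;> positivity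
  · simp [P₁]; linarith
  · simp [P₁]; linarith
  · have e1 : c.P₁ α 0 1 * c.P₁ α 1 0 = x * D * (2 + N * x) := by
      simp [P₁, hx, hDD]; ring
    have e2 : (1 - c.P₁ α 0 0) * (1 - c.P₁ α 1 1) = (a - N * x) * (b - x) := by
      simp [P₁, hx, haa, hbb, ← hN]; ring
    rw [e1, e2]
    have k1 : x * N ≤ 1 := by linarith
    have k2 : x * (D - 1) * (x * N) ≤ x * (D - 1) * 1 :=
      mul_le_mul_of_nonneg_left k1 (mul_nonneg hx0.le (by linarith))
    have k3 : x * a ≤ x := mul_le_of_le_one_right hx0.le ha1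
    have k4 : x * N * b ≤ x * N := mul_le_of_le_one_right (by positivity) hb1
    have k5 : x * 1 * (N + 3) ≤ x * D * (N + 3) := by gcongr
    have k6 : 0 ≤ x * (D - 1) * N := mul_nonneg (mul_nonneg hx0.le (by linarith)) (by linarith)
    linarith

/-- Only one term of the bracket is kept: `c₁² b₃ / (1 - λ)² ≥ b₃ = 3 L δ2C²`, because `c₁ ≥ 1` and
`0 < 1 - λ ≤ 1`. -/
lemma StepSublinear.mul_lt (hc : c.Valid) {α ψ y₀ : ℝ} (hy : 0 ≤ y₀)
    (h : c.StepSublinear α ψ y₀) : α * c.L * (3 * c.δ2C ^ 2) < c.ϖ := by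
  have hlam := rho_P₁_lt_one hc h.pos h.lt_contr
  have hlam0 := rho_nonneg (c.P₁ α)
  have hα := h.pos
  have hψ := h.psi_pos
  have hd := h.lt_descent
  have hL := hc.L_pos
  have hn := hc.n_pos
  have := hc.δRC_pos
  have := hc.δCR_pos
  have := hc.δ2R_pos
  have := hc.δ2C_pos
  have := hc.ϖ_nonneg
  have hσR := hc.σR_nonneg
  have hσC := hc.σC_nonneg
  have ha : 0 < 1 - c.σR := sub_pos.2 hc.σR_lt
  have hl : 0 < 1 - rho (c.P₁ α) := by linarith
  have hl1 : 1 - rho (c.P₁ α) ≤ 1 := by linarith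
  have b1 : 0 ≤ c.b₁ := by unfold b₁; positivity
  have b2 : 0 ≤ c.b₂ := by unfold b₂; positivity
  have b4 : 0 ≤ c.b₄ := by unfold b₄; positivity
  have c0 : 0 ≤ c₀ ψ y₀ := by unfold c₀; positivity
  have c1 : 1 ≤ c.c₁ ψ := by
    unfold c₁
    have : 0 ≤ c.L / ψ := by positivity
    linarith
  have c2 : 0 ≤ c.c₂ ψ := by unfold c₂; positivity
  have c3 : 0 ≤ c₃ y₀ := hy
  have c4 : 0 ≤ c.c₄ ψ := by unfold c₄; positivity
  have c5 : 0 ≤ c.c₅ ψ := by unfold c₅; positivity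
  have b3 : c.b₃ = c.L * (3 * c.δ2C ^ 2) := by unfold b₃; ring
  have b30 : 0 < c.b₃ := by rw [b3]; positivity
  set S := 3 * c.L * c.ϖ ^ 2 / 2
      + (c.c₁ ψ * c.b₁ + c.c₄ ψ * c.b₂ + c₀ ψ y₀ * c.b₁ + c₃ y₀ * c.b₂) / (1 - rho (c.P₁ α))
      + (c.c₁ ψ ^ 2 * c.b₃ + c.c₄ ψ ^ 2 * c.b₄) / (1 - rho (c.P₁ α)) ^ 2
      + (c.c₂ ψ * c.b₁ + c.c₅ ψ * c.b₂) / 2 with hS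
  have hSb : c.b₃ ≤ S := by
    have t1 : 0 ≤ 3 * c.L * c.ϖ ^ 2 / 2 := by positivity
    have t2 : 0 ≤ (c.c₁ ψ * c.b₁ + c.c₄ ψ * c.b₂ + c₀ ψ y₀ * c.b₁ + c₃ y₀ * c.b₂)
        / (1 - rho (c.P₁ α)) := by positivity
    have t4 : 0 ≤ (c.c₂ ψ * c.b₁ + c.c₅ ψ * c.b₂) / 2 := by positivity
    have t3 : c.b₃ ≤ (c.c₁ ψ ^ 2 * c.b₃ + c.c₄ ψ ^ 2 * c.b₄) / (1 - rho (c.P₁ α)) ^ 2 := by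
      rw [le_div_iff₀ (by positivity)]
      have u1 : (1 - rho (c.P₁ α)) ^ 2 ≤ 1 := pow_le_one₀ hl.le hl1
      have u2 : c.b₃ * (1 - rho (c.P₁ α)) ^ 2 ≤ c.b₃ * 1 := mul_le_mul_of_nonneg_left u1 b30.le
      have u3 : 1 * c.b₃ ≤ c.c₁ ψ ^ 2 * c.b₃ :=
        mul_le_mul_of_nonneg_right (one_le_pow₀ c1) b30.le
      have u4 : 0 ≤ c.c₄ ψ ^ 2 * c.b₄ := by positivity
      linarith
    linarith
  have hS0 : 0 < S := b30.trans_le hSb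
  rw [lt_inv_mul_iff₀ hS0] at hd
  have := mul_le_mul_of_nonneg_right hSb hα.le
  rw [b3] at this
  linarith

section Linear

variable {β α : ℝ}

lemma StepLinear.ϖ_pos (hβ : 0 < β) (h : c.StepLinear β α) : 0 < c.ϖ := by
  have h1 : 0 < c.d₁₂ β := one_div_pos.1 (h.pos.trans h.lt_one)
  unfold d₁₂ at h1
  exact pos_of_mul_pos_right h1 (by positivity)

lemma κC_ge (hc : c.Valid) : 1 ≤ c.κC := by
  have := hc.σC_nonneg; have := hc.σC_lt
  have h : 0 < 1 - c.σC ^ 2 := by nlinarith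
  rw [κC, le_div_iff₀ h]
  nlinarith

lemma κR_pos (hc : c.Valid) : 0 < c.κR := by
  have := hc.σR_nonneg; have := hc.σR_lt
  have h : 0 < 1 - c.σR ^ 2 := by nlinarith
  unfold κR
  positivity

/-- The coefficients of the second comparison matrix are non-negative. -/
structure CoeffNonneg (c : Data) : Prop where
  d₁ : 0 ≤ c.d₁
  d₂ : 0 ≤ c.d₂
  d₃ : 0 ≤ c.d₃
  d₄ : 0 ≤ c.d₄
  d₅ : 0 ≤ c.d₅
  d₆ : 0 ≤ c.d₆
  d₇ : 0 ≤ c.d₇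
  d₈ : 0 ≤ c.d₈
  d₉ : 0 ≤ c.d₉
  d₁₀ : 0 ≤ c.d₁₀
  d₁₁ : 0 ≤ c.d₁₁
  d₁₃ : 0 ≤ c.d₁₃

lemma Valid.coeffNonneg (hc : c.Valid) : CoeffNonneg c := by
  have hκ : 0 ≤ c.κC := zero_le_one.trans (κC_ge hc)
  have := hc.σR_nonneg; have := hc.σR_lt
  have h1 : 0 < 1 - c.σR ^ 2 := by nlinarith
  have h3 : 0 ≤ 3 - c.σR ^ 2 := by linarith
  have hL := hc.L_pos
  constructor
  · unfold Data.d₁; positivity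
  · unfold Data.d₂; positivity
  · unfold Data.d₃; positivity
  · unfold Data.d₄; positivity
  · unfold Data.d₅; positivity
  · unfold Data.d₆; positivity
  · unfold Data.d₇; positivity
  · unfold Data.d₈; positivity
  · unfold Data.d₉; positivity
  · unfold Data.d₁₀; positivity
  · unfold Data.d₁₁; positivity
  · unfold Data.d₁₃; positivity

lemma κR_mul_div : (1 - c.σR ^ 2) ^ 2 * (1 - c.σC ^ 2) / (16 * (1 + c.σR ^ 2))
    = c.κR * (1 - c.σC ^ 2) / 16 := by
  rw [κR, mul_comm (16 : ℝ), ← div_div]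
  ring

lemma h₁_eq (β : ℝ) : c.h₁ β = c.κR * (1 - c.σC ^ 2) / 16 * c.d₁₂ β := by
  rw [h₁, κR_mul_div]

lemma h₂_eq : c.h₂ = c.κR * (1 - c.σC ^ 2) / 16 * c.d₁₃
    + c.d₃ * c.d₄ * c.d₁₀ + (1 - c.σC ^ 2) / 2 * c.d₃ * c.d₈ + c.κR * c.d₇ * c.d₁₀ := by
  rw [h₂, κR_mul_div]

/-- The last step-size bound is the positive root of `H α² + h₂ α = h₁`. -/
lemma StepLinear.quadratic (hc : c.Valid) (hβ : 0 < β) (h : c.StepLinear β α) :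
    0 ≤ c.hSum β ∧ c.hSum β * α ^ 2 + c.h₂ * α < c.h₁ β := by
  have hd := hc.coeffNonneg
  obtain ⟨d1, d2, d3, d4, d5, d6, d7, d8, d9, d10, d11, d13⟩ := hd
  have hϖ := h.ϖ_pos hβ
  have hα := h.pos
  have d12 : 0 < c.d₁₂ β := by unfold d₁₂; positivity
  have := hc.σC_nonneg; have := hc.σC_lt
  have hw : 0 < 1 - c.σC ^ 2 := by nlinarith
  have hκ := κR_pos hc
  have H0 : 0 ≤ c.hSum β := by
    unfold hSum h₃ h₄ h₅ h₆
    positivity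
  have h20 : 0 ≤ c.h₂ := by rw [h₂_eq]; positivity
  have h10 : 0 < c.h₁ β := by rw [h₁_eq]; positivity
  refine ⟨H0, ?_⟩
  have h5 := h.lt_five
  rcases H0.eq_or_lt with h0 | h0
  -- If `H = 0`, the quotient in the bound is `0` by convention, which contradicts `0 < α`.
  · rw [← h0] at h5
    simp at h5
    linarith
  · rw [lt_div_iff₀ (by positivity)] at h5
    have h6 : 2 * c.hSum β * α + c.h₂ < √(c.h₂ ^ 2 + 4 * c.h₁ β * c.hSum β) := by linarith
    have h7 := (Real.lt_sqrt (by positivity)).1 h6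
    have h8 : 0 < 4 * c.hSum β * (c.h₁ β - (c.hSum β * α ^ 2 + c.h₂ * α)) := by linarith
    have := pos_of_mul_pos_right h8 (by positivity)
    linarith

lemma StepLinear.diag (hc : c.Valid) (hβ : 0 < β) (h : c.StepLinear β α) :
    c.d₁ * α ^ 2 ≤ c.κR / 4 ∧ c.d₆ * α ^ 2 ≤ (1 - c.σC ^ 2) / 4 ∧ 0 < c.d₁₂ β - c.d₁₃ * α := by
  have hα := h.pos
  have hL := hc.L_pos
  have hn := hc.n_pos
  have hϖ := h.ϖ_pos hβ
  have := hc.σC_nonneg; have := hc.σC_lt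
  have := hc.σR_nonneg; have := hc.σR_lt
  have hw : 0 < 1 - c.σC ^ 2 := by nlinarith
  have hA : 0 < 1 - c.σR ^ 2 := by nlinarith
  have hB : 0 < 1 + c.σR ^ 2 := by positivity
  have hC : 0 < 1 + c.σC ^ 2 := by positivity
  have hn0 : 0 < (c.n : ℝ) := by linarith
  refine ⟨?_, ?_, ?_⟩
  · have h2 := h.lt_two
    rw [lt_div_iff₀ (by positivity)] at h2
    have h3 := pow_le_pow_left₀ (by positivity) h2.le 2
    rw [mul_pow, mul_pow, mul_pow, mul_pow, Real.sq_sqrt hn0.le, Real.sq_sqrt hB.le] at h3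
    rw [κR, d₁, le_div_iff₀ (by norm_num), le_div_iff₀ hB]
    linarith
  · have h2 := h.lt_three
    rw [lt_div_iff₀ (by positivity)] at h2
    have h3 := pow_le_pow_left₀ (by positivity) h2.le 2
    rw [mul_pow, mul_pow, mul_pow, mul_pow, Real.sq_sqrt (by norm_num), Real.sq_sqrt hC.le] at h3
    rw [d₆, κC, le_div_iff₀ (by norm_num)]
    have e : 8 * ((1 + c.σC ^ 2) / (1 - c.σC ^ 2)) * c.L ^ 2 * α ^ 2 * 4
        = (32 * (1 + c.σC ^ 2) * c.L ^ 2 * α ^ 2) / (1 - c.σC ^ 2) := by ring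
    rw [e, div_le_iff₀ hw]
    linarith
  · have h4 := h.lt_four
    rw [lt_div_iff₀ (by positivity)] at h4
    unfold d₁₂ d₁₃
    linarith

lemma P₂_nonneg (hc : c.Valid) (hβ : 0 < β) (h : c.StepLinear β α) (i j : Fin 3) :
    0 ≤ c.P₂ β α i j := by
  obtain ⟨d1, d2, d3, d4, d5, d6, d7, d8, d9, d10, d11, d13⟩ := hc.coeffNonneg
  have hϖ := h.ϖ_pos hβ
  have d12 : 0 < c.d₁₂ β := by unfold d₁₂; positivity
  have h1 := h.lt_one
  rw [lt_div_iff₀ d12] at h1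
  have := hc.σR_nonneg; have := hc.σR_lt
  have hA : 0 ≤ 3 * c.σR ^ 2 - c.σR ^ 4 := by
    have : c.σR ^ 2 ≤ 1 := by nlinarith
    nlinarith [sq_nonneg c.σR]
  have h33 : 0 ≤ 1 - c.d₁₂ β * α + c.d₁₃ * α ^ 2 := by
    have : 0 ≤ c.d₁₃ * α ^ 2 := by positivity
    linarith
  fin_cases i <;> fin_cases j <;> simp [P₂] <;> positivity

/-- In the expansion of `det(1 - P)` the powers `α⁴`, `α⁵`, `α⁶` are replaced by `α³`, using `α <
1`. After division by `α` the determinant condition is implied by the quadratic inequality for `H`,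
`h₂`, `h₁`. -/
lemma rho_P₂_lt_one (hc : c.Valid) (hβ : 0 < β) (h : c.StepLinear β α) (hα1 : α < 1) :
    rho (c.P₂ β α) < 1 := by
  obtain ⟨H0, hq⟩ := h.quadratic hc hβ
  obtain ⟨g1, g2, g3⟩ := h.diag hc hβ
  obtain ⟨d1, d2, d3, d4, d5, d6, d7, d8, d9, d10, d11, d13⟩ := hc.coeffNonneg
  have hϖ := h.ϖ_pos hβ
  have hα := h.pos
  have d12 : 0 < c.d₁₂ β := by unfold d₁₂; positivity
  have hκ := κR_pos hc
  have := hc.σC_nonneg; have := hc.σC_lt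
  have := hc.σR_nonneg; have := hc.σR_lt
  have hw : 0 < 1 - c.σC ^ 2 := by nlinarith
  have e11 : 1 - c.P₂ β α 0 0 = c.κR - c.d₁ * α ^ 2 := by
    simp only [P₂, κR, Matrix.of_apply, Matrix.cons_val]
    field_simp
    ring
  have e22 : 1 - c.P₂ β α 1 1 = (1 - c.σC ^ 2) / 2 - c.d₆ * α ^ 2 := by
    simp only [P₂, Matrix.of_apply, Matrix.cons_val]
    ring
  have e33 : 1 - c.P₂ β α 2 2 = α * (c.d₁₂ β - c.d₁₃ * α) := by
    simp only [P₂, Matrix.of_apply, Matrix.cons_val]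
    ring
  have p33 : 0 < α * (c.d₁₂ β - c.d₁₃ * α) := mul_pos hα g3
  refine rho_lt_one_of_three (P₂_nonneg hc hβ h) (by linarith) (by linarith) (by linarith) ?_
  rw [e11, e22, e33]
  have hα43 : α ^ 4 ≤ α ^ 3 := pow_le_pow_of_le_one hα.le hα1.le (by norm_num)
  have hα63 : α ^ 6 ≤ α ^ 3 := pow_le_pow_of_le_one hα.le hα1.le (by norm_num)
  have hα53 : α ^ 5 ≤ α ^ 3 := pow_le_pow_of_le_one hα.le hα1.le (by norm_num)
  -- By `StepLinear.diag` the first two diagonal gaps are at least half of `κR` and of `(1 - σC²) /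
  -- 2`. Their product exceeds the `1 / 16` built into `h₁` and `h₂`.
  have k0 : c.κR * (1 - c.σC ^ 2) / 16 * (α * (c.d₁₂ β - c.d₁₃ * α))
      ≤ (c.κR - c.d₁ * α ^ 2) * ((1 - c.σC ^ 2) / 2 - c.d₆ * α ^ 2)
        * (α * (c.d₁₂ β - c.d₁₃ * α)) := by
    refine mul_le_mul_of_nonneg_right ?_ p33.le
    have t1 : c.κR / 2 * ((1 - c.σC ^ 2) / 4)
        ≤ (c.κR - c.d₁ * α ^ 2) * ((1 - c.σC ^ 2) / 2 - c.d₆ * α ^ 2) :=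
      mul_le_mul (by linarith) (by linarith) (by positivity) (by linarith)
    have := mul_pos hκ hw
    linarith
  have k1 : c.P₂ β α 0 1 * c.P₂ β α 1 2 * c.P₂ β α 2 0
      ≤ α ^ 3 * (c.d₂ * c.d₇ * c.d₈ + c.d₂ * c.d₇ * c.d₉) := by
    have e : c.P₂ β α 0 1 * c.P₂ β α 1 2 * c.P₂ β α 2 0
        = α ^ 4 * (c.d₂ * c.d₇ * c.d₈) + α ^ 6 * (c.d₂ * c.d₇ * c.d₉) := by
      simp only [P₂, Matrix.of_apply, Matrix.cons_val]; ring
    rw [e, mul_add]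
    gcongr
  have k2 : c.P₂ β α 0 2 * c.P₂ β α 1 0 * c.P₂ β α 2 1
      ≤ α ^ 2 * (c.d₃ * c.d₄ * c.d₁₀) + α ^ 3 * (c.d₃ * c.d₅ * c.d₁₀ + c.d₃ * c.d₄ * c.d₁₁
        + c.d₃ * c.d₅ * c.d₁₁) := by
    have e : c.P₂ β α 0 2 * c.P₂ β α 1 0 * c.P₂ β α 2 1
        = α ^ 2 * (c.d₃ * c.d₄ * c.d₁₀) + (α ^ 4 * (c.d₃ * c.d₅ * c.d₁₀)
        + α ^ 4 * (c.d₃ * c.d₄ * c.d₁₁) + α ^ 6 * (c.d₃ * c.d₅ * c.d₁₁)) := by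
      simp only [P₂, Matrix.of_apply, Matrix.cons_val]; ring
    rw [e, mul_add (α ^ 3), mul_add (α ^ 3)]
    gcongr
  have k3 : c.P₂ β α 0 2 * ((1 - c.σC ^ 2) / 2 - c.d₆ * α ^ 2) * c.P₂ β α 2 0
      ≤ α ^ 2 * ((1 - c.σC ^ 2) / 2 * c.d₃ * c.d₈) + α ^ 3 * ((1 - c.σC ^ 2) / 2 * c.d₃ * c.d₉) := by
    have p1 := P₂_nonneg hc hβ h 0 2
    have p2 := P₂_nonneg hc hβ h 2 0
    calc c.P₂ β α 0 2 * ((1 - c.σC ^ 2) / 2 - c.d₆ * α ^ 2) * c.P₂ β α 2 0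
        ≤ c.P₂ β α 0 2 * ((1 - c.σC ^ 2) / 2) * c.P₂ β α 2 0 := by
          gcongr
          have : 0 ≤ c.d₆ * α ^ 2 := by positivity
          linarith
      _ = α ^ 2 * ((1 - c.σC ^ 2) / 2 * c.d₃ * c.d₈)
          + α ^ 4 * ((1 - c.σC ^ 2) / 2 * c.d₃ * c.d₉) := by
          simp only [P₂, Matrix.of_apply, Matrix.cons_val]; ring
      _ ≤ _ := by gcongr
  have k4 : (c.κR - c.d₁ * α ^ 2) * c.P₂ β α 1 2 * c.P₂ β α 2 1
      ≤ α ^ 2 * (c.κR * c.d₇ * c.d₁₀) + α ^ 3 * (c.κR * c.d₇ * c.d₁₁) := by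
    have p1 := P₂_nonneg hc hβ h 1 2
    have p2 := P₂_nonneg hc hβ h 2 1
    calc (c.κR - c.d₁ * α ^ 2) * c.P₂ β α 1 2 * c.P₂ β α 2 1
        ≤ c.κR * c.P₂ β α 1 2 * c.P₂ β α 2 1 := by
          gcongr
          have : 0 ≤ c.d₁ * α ^ 2 := by positivity
          linarith
      _ = α ^ 2 * (c.κR * c.d₇ * c.d₁₀) + α ^ 4 * (c.κR * c.d₇ * c.d₁₁) := by
          simp only [P₂, Matrix.of_apply, Matrix.cons_val]; ring
      _ ≤ _ := by gcongr
  have k5 : c.P₂ β α 0 1 * c.P₂ β α 1 0 * (α * (c.d₁₂ β - c.d₁₃ * α))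
      ≤ α ^ 3 * (c.d₂ * c.d₄ * c.d₁₂ β + c.d₂ * c.d₅ * c.d₁₂ β) := by
    have p1 := P₂_nonneg hc hβ h 0 1
    have p2 := P₂_nonneg hc hβ h 1 0
    calc c.P₂ β α 0 1 * c.P₂ β α 1 0 * (α * (c.d₁₂ β - c.d₁₃ * α))
        ≤ c.P₂ β α 0 1 * c.P₂ β α 1 0 * (α * c.d₁₂ β) := by
          gcongr
          have : 0 ≤ c.d₁₃ * α := by positivity
          linarith
      _ = α ^ 3 * (c.d₂ * c.d₄ * c.d₁₂ β) + α ^ 5 * (c.d₂ * c.d₅ * c.d₁₂ β) := by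
          simp only [P₂, Matrix.of_apply, Matrix.cons_val]; ring
      _ ≤ _ := by rw [mul_add]; gcongr
  have k6 : 0 ≤ α ^ 3 * (c.d₂ * c.d₅ * c.d₁₃) := by positivity
  have k7 := mul_lt_mul_of_pos_left hq hα
  rw [h₂_eq, h₁_eq, hSum, h₃, h₄, h₅, h₆] at k7
  linarith

end Linear

end Data

end ETDGT

end

noncomputable section

namespace ETDGT

/-! ## Consequences of the step-size conditions for the linear rate -/

namespace Data

variable {c : Data} {μ α : ℝ}

/-- The quadratic inequality gives `h₂ α < h₁`. Both sides carry the factor `T`: `h₁ = T d₁₂`, and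
`h₂` dominates `T (2L + 16 n L³ δ2C²)` through its terms with `d₁₃` and `d₇ d₁₀`. Then `1 / μ ≤ L`
bounds `d₁₂`. -/
lemma StepLinear.mul_le (hc : c.Valid) (hμ : 0 < μ) (hμL : 1 ≤ μ * c.L)
    (h : c.StepLinear (c.n / μ) α) : α * (1 + 8 * c.n * c.L ^ 2 * c.δ2C ^ 2) ≤ c.n * c.ϖ := by
  have hn := hc.n_pos
  have hn0 : 0 < (c.n : ℝ) := by linarith
  have hβ : 0 < c.n / μ := by positivity
  have hϖ := h.ϖ_pos hβ
  have hα := h.pos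
  have hL := hc.L_pos
  obtain ⟨H0, hq⟩ := h.quadratic hc hβ
  obtain ⟨d1, d2, d3, d4, d5, d6, d7, d8, d9, d10, d11, d13⟩ := hc.coeffNonneg
  have hκ := κR_pos hc
  have hκC := κC_ge hc
  have hσ0 := hc.σC_nonneg
  have hσ1 := hc.σC_lt
  have hw : 0 < 1 - c.σC ^ 2 := by nlinarith
  have hw1 : 1 - c.σC ^ 2 ≤ 1 := by nlinarith
  set T := c.κR * (1 - c.σC ^ 2) / 16 with hT
  have hT0 : 0 < T := by positivity
  have k1 : T * (2 * c.L + 16 * c.n * c.L ^ 3 * c.δ2C ^ 2) ≤ c.h₂ := by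
    have t1 : T * (2 * c.L) ≤ T * c.d₁₃ := by
      refine mul_le_mul_of_nonneg_left ?_ hT0.le
      have : 0 ≤ 3 * c.ϖ ^ 2 * c.L ^ 2 := by positivity
      rw [d₁₃]; linarith
    have t2 : T * (16 * c.n * c.L ^ 3 * c.δ2C ^ 2) ≤ c.κR * c.d₇ * c.d₁₀ := by
      have e : c.κR * c.d₇ * c.d₁₀ = c.κR * c.κC * (16 * c.n * c.L ^ 3 * c.δ2C ^ 2) := by
        unfold d₇ d₁₀; ring
      rw [e]
      refine mul_le_mul_of_nonneg_right ?_ (by positivity)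
      have : c.κR * (1 - c.σC ^ 2) ≤ c.κR * c.κC := mul_le_mul_of_nonneg_left (hw1.trans hκC) hκ.le
      have : 0 ≤ c.κR * (1 - c.σC ^ 2) := by positivity
      rw [hT]; linarith
    have t3 : 0 ≤ c.d₃ * c.d₄ * c.d₁₀ := by positivity
    have t4 : 0 ≤ (1 - c.σC ^ 2) / 2 * c.d₃ * c.d₈ := by positivity
    rw [h₂_eq, ← hT]
    linarith
  have k2 : c.h₂ * α < T * c.d₁₂ (c.n / μ) := by
    rw [← h₁_eq]
    have : 0 ≤ c.hSum (c.n / μ) * α ^ 2 := by positivity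
    linarith
  have k3 : T * (α * (2 * c.L + 16 * c.n * c.L ^ 3 * c.δ2C ^ 2)) ≤ T * c.d₁₂ (c.n / μ) := by
    have := mul_le_mul_of_nonneg_right k1 hα.le
    linarith
  have k4 := le_of_mul_le_mul_left k3 hT0
  have k5 : c.d₁₂ (c.n / μ) ≤ 2 * c.n * c.L * c.ϖ := by
    have : 1 / μ ≤ c.L := by rw [div_le_iff₀ hμ]; linarith
    have := mul_le_mul_of_nonneg_left this (show 0 ≤ 2 * c.n * c.ϖ by positivity)
    calc c.d₁₂ (c.n / μ) = 2 * c.n * c.ϖ * (1 / μ) := by unfold d₁₂; ring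
      _ ≤ _ := by linarith
  have k6 : 2 * c.L * (α * (1 + 8 * c.n * c.L ^ 2 * c.δ2C ^ 2)) ≤ 2 * c.L * (c.n * c.ϖ) := by
    linarith
  exact le_of_mul_le_mul_left k6 (by positivity)

lemma StepLinear.le_n (hc : c.Valid) (hμ : 0 < μ) (hμL : 1 ≤ μ * c.L)
    (h : c.StepLinear (c.n / μ) α) : α ≤ c.n := by
  have h1 := h.mul_le hc hμ hμL
  have hα := h.pos
  have h2 : 0 ≤ α * (8 * c.n * c.L ^ 2 * c.δ2C ^ 2) := by positivity
  have h3 : c.n * c.ϖ ≤ c.n := mul_le_of_le_one_right (Nat.cast_nonneg _) hc.ϖ_le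
  linarith

lemma StepLinear.mul_L_le (hc : c.Valid) (hμ : 0 < μ) (hμL : 1 ≤ μ * c.L)
    (h : c.StepLinear (c.n / μ) α) : 2 * (α * c.L) * c.δ2C ≤ c.n := by
  have h1 := h.mul_le hc hμ hμL
  have hα := h.pos
  have hL := hc.L_pos
  have hD := hc.δ2C_pos
  have hn := hc.n_pos
  have h3 : c.n * c.ϖ ≤ c.n := mul_le_of_le_one_right (Nat.cast_nonneg _) hc.ϖ_le
  have h4 : 2 * (c.L * c.δ2C) ≤ 1 + 8 * c.n * c.L ^ 2 * c.δ2C ^ 2 := by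
    have t1 := sq_nonneg (c.L * c.δ2C - 1)
    have t2 : 1 * (c.L * c.δ2C) ^ 2 ≤ c.n * (c.L * c.δ2C) ^ 2 :=
      mul_le_mul_of_nonneg_right hn (sq_nonneg _)
    have t3 := sq_nonneg (c.L * c.δ2C)
    linarith
  have h5 := mul_le_mul_of_nonneg_left h4 hα.le
  linarith

lemma PL_mul_le (hc : c.Valid) (hμ : 0 < μ) (hμL : 1 ≤ μ * c.L) (hα : 0 < α) :
    2 * (c.n / μ) * c.ϖ * α ≤ 2 * c.n * (α * c.L) := by
  have h1 : 1 / μ ≤ c.L := by rw [div_le_iff₀ hμ]; linarith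
  have hϖ := hc.ϖ_le
  have hϖ0 := hc.ϖ_nonneg
  have hL := hc.L_pos
  calc 2 * (c.n / μ) * c.ϖ * α = 2 * c.n * α * ((1 / μ) * c.ϖ) := by ring
    _ ≤ 2 * c.n * α * (c.L * 1) := by gcongr
    _ = _ := by ring

/-- The Perron eigenvector forces the eigenvalue to be close to `1`. -/
lemma StepLinear.eigenvalue_ge (hc : c.Valid) (hμ : 0 < μ) (h : c.StepLinear (c.n / μ) α)
    {ν : Fin 3 → ℝ} (hν : ∀ i, 0 < ν i) {lam : ℝ} (hlam1 : lam < 1)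
    (he : Matrix.mulVec (c.P₂ (c.n / μ) α) ν = lam • ν) :
    1 - 2 * (c.n / μ) * c.ϖ * α + 2 * α ^ 2 * c.L * (1 + 8 * c.n * c.L ^ 2 * c.δ2C ^ 2) ≤ lam := by
  have hn0 : 0 < (c.n : ℝ) := by linarith [hc.n_pos]
  have hβ : 0 < c.n / μ := by positivity
  have hP := P₂_nonneg hc hβ h
  have hL := hc.L_pos
  have hν0 := hν 0; have hν1 := hν 1; have hν2 := hν 2
  have r1 : c.P₂ (c.n / μ) α 1 0 * ν 0 + c.P₂ (c.n / μ) α 1 1 * ν 1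
      + c.P₂ (c.n / μ) α 1 2 * ν 2 = lam * ν 1 := by
    simpa [Matrix.mulVec, dotProduct, Fin.sum_univ_three] using congrFun he 1
  have r2 : c.P₂ (c.n / μ) α 2 0 * ν 0 + c.P₂ (c.n / μ) α 2 1 * ν 1
      + c.P₂ (c.n / μ) α 2 2 * ν 2 = lam * ν 2 := by
    simpa [Matrix.mulVec, dotProduct, Fin.sum_univ_three] using congrFun he 2
  have p10 := mul_nonneg (hP 1 0) hν0.le
  have p11 := mul_nonneg (hP 1 1) hν1.le
  have p20 := mul_nonneg (hP 2 0) hν0.le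
  -- The second row bounds `ν 1` below. Inserted in the third row, it gives `λ ≥ P₂₂ + P₂₁ P₁₂` with
  -- indices from `0`, and this product supplies the term with `δ2C²`.
  have k1 : c.P₂ (c.n / μ) α 1 2 * ν 2 ≤ ν 1 := by
    have : lam * ν 1 ≤ 1 * ν 1 := mul_le_mul_of_nonneg_right hlam1.le hν1.le
    linarith
  have k2 := mul_le_mul_of_nonneg_left k1 (hP 2 1)
  have k3 : (c.P₂ (c.n / μ) α 2 1 * c.P₂ (c.n / μ) α 1 2 + c.P₂ (c.n / μ) α 2 2) * ν 2
      ≤ lam * ν 2 := by linarith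
  refine le_trans ?_ (le_of_mul_le_mul_right k3 hν2)
  have e1 : c.P₂ (c.n / μ) α 2 2
      = 1 - 2 * (c.n / μ) * c.ϖ * α + (2 * c.L + 3 * c.ϖ ^ 2 * c.L ^ 2) * α ^ 2 := by
    simp only [P₂, d₁₂, d₁₃, Matrix.of_apply, Matrix.cons_val]
  have e2 : c.P₂ (c.n / μ) α 2 1 * c.P₂ (c.n / μ) α 1 2
      = (c.d₁₀ + c.d₁₁ * α ^ 2) * (c.d₇ * α ^ 2) := by
    simp only [P₂, Matrix.of_apply, Matrix.cons_val]
  have e3 : 16 * α ^ 2 * c.n * c.L ^ 3 * c.δ2C ^ 2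
      ≤ (c.d₁₀ + c.d₁₁ * α ^ 2) * (c.d₇ * α ^ 2) := by
    have t1 : 0 ≤ c.d₁₁ * α ^ 2 * (c.d₇ * α ^ 2) := by
      have := hc.coeffNonneg.d₁₁; have := hc.coeffNonneg.d₇
      positivity
    have t2 : c.d₁₀ * (c.d₇ * α ^ 2) = c.κC * (16 * α ^ 2 * c.n * c.L ^ 3 * c.δ2C ^ 2) := by
      unfold d₁₀ d₇; ring
    have t3 : 16 * α ^ 2 * c.n * c.L ^ 3 * c.δ2C ^ 2
        ≤ c.κC * (16 * α ^ 2 * c.n * c.L ^ 3 * c.δ2C ^ 2) :=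
      le_mul_of_one_le_left (by positivity) (κC_ge hc)
    linarith
  have e4 : 0 ≤ 3 * c.ϖ ^ 2 * c.L ^ 2 * α ^ 2 := by positivity
  rw [e1, e2]
  linarith

lemma h₈_nonneg {ν : Fin 3 → ℝ} (hν : ∀ i, 0 < ν i) : 0 ≤ h₈ ν := by
  have h1 : 0 < max (ν 0) (max (ν 1) (ν 2)) := lt_max_of_lt_left (hν 0)
  have h2 : 0 < min (ν 0) (min (ν 1) (ν 2)) := lt_min (hν 0) (lt_min (hν 1) (hν 2))
  unfold h₈
  positivity

/-- The Perron eigenvector is spread out when the tracking norm is small. -/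
lemma StepLinear.h₈_ge (hc : c.Valid) (hμ : 0 < μ) (hμL : 1 ≤ μ * c.L)
    (h : c.StepLinear (c.n / μ) α) {ν : Fin 3 → ℝ} (hν : ∀ i, 0 < ν i) {lam : ℝ}
    (hlam1 : lam < 1) (he : Matrix.mulVec (c.P₂ (c.n / μ) α) ν = lam • ν) :
    √3 * (c.δ2C ^ 3 / (2 * c.n ^ 2)) ≤ h₈ ν := by
  have hn0 : 0 < (c.n : ℝ) := by linarith [hc.n_pos]
  have hβ : 0 < c.n / μ := by positivity
  have hP := P₂_nonneg hc hβ h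
  have hL := hc.L_pos
  have hD := hc.δ2C_pos
  have hα := h.pos
  have hν0 := hν 0; have hν1 := hν 1; have hν2 := hν 2
  have r2 : c.P₂ (c.n / μ) α 2 0 * ν 0 + c.P₂ (c.n / μ) α 2 1 * ν 1
      + c.P₂ (c.n / μ) α 2 2 * ν 2 = lam * ν 2 := by
    simpa [Matrix.mulVec, dotProduct, Fin.sum_univ_three] using congrFun he 2
  have p20 := mul_nonneg (hP 2 0) hν0.le
  have e1 : c.P₂ (c.n / μ) α 2 2
      = 1 - 2 * (c.n / μ) * c.ϖ * α + c.d₁₃ * α ^ 2 := by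
    simp only [P₂, d₁₂, Matrix.of_apply, Matrix.cons_val]
  have e2 : c.P₂ (c.n / μ) α 2 1 = 1 / 2 * c.δ2C ^ 2 + c.d₁₁ * α ^ 2 := by
    simp only [P₂, d₁₀, Matrix.of_apply, Matrix.cons_val]
  have t13 : 0 ≤ c.d₁₃ * α ^ 2 * ν 2 := by
    have := hc.coeffNonneg.d₁₃
    positivity
  have t11 : 0 ≤ c.d₁₁ * α ^ 2 * ν 1 := by
    have := hc.coeffNonneg.d₁₁
    positivity
  have tl : lam * ν 2 ≤ 1 * ν 2 := mul_le_mul_of_nonneg_right hlam1.le hν2.le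
  rw [e1, e2] at r2
  -- The third row: the inflow `δ2C² ν₁ / 2` must be balanced by the decay `2βϖα ν₂`, where `α L` is
  -- itself at most `n / (2 δ2C)`. Hence `ν₂ / ν₁` is of order at least `δ2C³`.
  have k1 : 1 / 2 * c.δ2C ^ 2 * ν 1 ≤ 2 * (c.n / μ) * c.ϖ * α * ν 2 := by linarith
  have k2 := mul_le_mul_of_nonneg_right (PL_mul_le hc hμ hμL hα) hν2.le
  have k3 : 1 / 2 * c.δ2C ^ 2 * ν 1 * c.δ2C ≤ c.n ^ 2 * ν 2 := by
    have t1 := mul_le_mul_of_nonneg_right (k1.trans k2) hD.le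
    have t2 := mul_le_mul_of_nonneg_left (h.mul_L_le hc hμ hμL)
      (show 0 ≤ c.n * ν 2 by positivity)
    linarith
  have k4 : c.δ2C ^ 3 / (2 * c.n ^ 2) ≤ ν 2 / ν 1 := by
    rw [div_le_div_iff₀ (by positivity) hν1]
    linarith
  have k5 : ν 2 / ν 1 ≤ max (ν 0) (max (ν 1) (ν 2)) / min (ν 0) (min (ν 1) (ν 2)) := by
    refine div_le_div₀ (hν0.le.trans (le_max_left _ _)) ?_ (lt_min hν0 (lt_min hν1 hν2)) ?_
    · exact (le_max_right _ _).trans (le_max_right _ _)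
    · exact (min_le_right _ _).trans (min_le_left _ _)
  exact mul_le_mul_of_nonneg_left (k4.trans k5) (Real.sqrt_nonneg 3)

lemma h₇_ge (hc : c.Valid) : 1 + c.δCR ^ 2 * c.L ^ 2 ≤ c.h₇ := by
  have hκ := κC_ge hc
  have hn := hc.n_pos
  have hR := hc.σR_nonneg
  have hR1 := hc.σR_lt
  have hC := hc.σC_nonneg
  unfold h₇
  have t1 : 0 ≤ (3 + c.σR ^ 2) / (1 + c.σR ^ 2) * (1 + c.σR) ^ 2 := by positivity
  have t2 : 1 ≤ (1 + c.σC) ^ 2 := one_le_pow₀ (by linarith)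
  have t3 : 1 ≤ (1 + c.σR) ^ 2 := one_le_pow₀ (by linarith)
  have t4 : 0 ≤ c.δCR ^ 2 * c.L ^ 2 := by positivity
  have t5 : 1 * (c.δCR ^ 2 * c.L ^ 2) ≤ (1 + c.σR) ^ 2 * (c.δCR ^ 2 * c.L ^ 2) :=
    mul_le_mul_of_nonneg_right t3 t4
  have t6 : 1 + c.δCR ^ 2 * c.L ^ 2
      ≤ (1 + c.σC) ^ 2 + 4 * (1 + c.σR) ^ 2 * c.δCR ^ 2 * c.L ^ 2 := by linarith
  have t7 : 1 * ((1 + c.σC) ^ 2 + 4 * (1 + c.σR) ^ 2 * c.δCR ^ 2 * c.L ^ 2)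
      ≤ 2 * c.κC * ((1 + c.σC) ^ 2 + 4 * (1 + c.σR) ^ 2 * c.δCR ^ 2 * c.L ^ 2) :=
    mul_le_mul_of_nonneg_right (by linarith) (by linarith)
  have t8 : 1 + c.δCR ^ 2 * c.L ^ 2 ≤ (3 + c.σR ^ 2) / (1 + c.σR ^ 2) * (1 + c.σR) ^ 2
      + 2 * c.κC * ((1 + c.σC) ^ 2 + 4 * (1 + c.σR) ^ 2 * c.δCR ^ 2 * c.L ^ 2) := by linarith
  exact t8.trans (le_mul_of_one_le_right (by linarith) hn)

end Data

/-! ## Residuals along a run -/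

section Residual

variable {n m : ℕ} {R C : Matrix (Fin n) (Fin n) ℝ} {pR pC : Fin n → ℝ}
  {F : Fin n → EuclideanSpace ℝ (Fin m) → ℝ} {d : Fin n → EuclideanSpace ℝ (Fin m)} {L α : ℝ}
  {ew es : ℕ → Fin n → ℝ} {wt w s wh sh : ℕ → Fin n → EuclideanSpace ℝ (Fin m)}

lemma sum_norm_sub_mean_sq_le (hn : 0 < n) (v : Fin n → EuclideanSpace ℝ (Fin m))
    (z : EuclideanSpace ℝ (Fin m)) :
    ∑ i, ‖v i - (n : ℝ)⁻¹ • ∑ j, v j‖ ^ 2 ≤ ∑ i, ‖v i - z‖ ^ 2 := by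
  set a := (n : ℝ)⁻¹ • ∑ j, v j with ha
  have hn' : (n : ℝ) ≠ 0 := by exact_mod_cast hn.ne'
  have e : ∀ i, ‖v i - z‖ ^ 2 = ‖v i - a‖ ^ 2 + 2 * ⟪v i - a, a - z⟫_ℝ + ‖a - z‖ ^ 2 := fun i => by
    rw [← norm_add_sq_real, sub_add_sub_cancel]
  have h0 : ∑ i, (v i - a) = 0 := by
    rw [Finset.sum_sub_distrib, Finset.sum_const, Finset.card_univ, Fintype.card_fin,
      ← Nat.cast_smul_eq_nsmul ℝ, ha, smul_smul, mul_inv_cancel₀ hn', one_smul, sub_self]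
  simp_rw [e, Finset.sum_add_distrib, ← Finset.mul_sum, ← sum_inner, h0, inner_zero_left]
  have : 0 ≤ ∑ _i : Fin n, ‖a - z‖ ^ 2 := Finset.sum_nonneg fun _ _ => sq_nonneg _
  linarith

/-- Since `∇F_i(w_i)` is the dual estimate, the gradient disagreement is at most the consensus
error. The supply-demand violation is the total tracker, that is `∇f(x̄)` up to consensus error. -/
lemma IsRun.kktResidual_le (h : IsRun R C F d α ew es wt w s wh sh) (hn : 0 < n)
    (hc : ∀ j, ∑ i, C i j = 1) (hL : 0 < L) (hF : ∀ i, Differentiable ℝ (F i))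
    (hk : ∀ i, StrongConvexOn Set.univ (1 / L) (F i)) (k : ℕ) :
    kktResidual F d w k ≤ 2 * ‖gradient (dual F d) (xbar pR wt k)‖ ^ 2
      + 2 * (n : ℝ) ^ 2 * (1 + L ^ 2) * ∑ i, ‖xErr pR wt k i‖ ^ 2 := by
  have hn1 : (1 : ℝ) ≤ n := by exact_mod_cast hn
  set g := gradient (dual F d) (xbar pR wt k) with hg
  have h1 : ∑ i, ‖gradient (F i) (w k i) - gradAvg F w k‖ ^ 2 ≤ ∑ i, ‖xErr pR wt k i‖ ^ 2 := by
    unfold gradAvg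
    simp_rw [h.gradient_eq hF]
    refine (sum_norm_sub_mean_sq_le hn (wt k) (-xbar pR wt k)).trans (le_of_eq ?_)
    refine Finset.sum_congr rfl fun i _ => ?_
    rw [xErr, ← norm_neg]
    congr 2
    abel
  have h2 : ‖∑ i, w k i - ∑ i, d i‖ ^ 2
      ≤ 2 * ‖g‖ ^ 2 + 2 * n * L ^ 2 * ∑ i, ‖xErr pR wt k i‖ ^ 2 := by
    have e1 : ‖∑ i, w k i - ∑ i, d i‖ = ‖∑ i, s k i‖ := by
      rw [h.sum_s hc, Finset.sum_sub_distrib, norm_sub_rev]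
    have e2 : ‖∑ i, s k i‖ ≤ ‖g‖ + L * (√n * frob (xErr pR wt k)) := by
      have h3 := norm_add_le (∑ i, s k i - g) g
      rw [sub_add_cancel] at h3
      have := h.norm_sum_s_sub_gradient_le (pR := pR) hc hL hF hk k
      linarith
    have e3 : (‖g‖ + L * (√n * frob (xErr pR wt k))) ^ 2
        ≤ 2 * ‖g‖ ^ 2 + 2 * (L * (√n * frob (xErr pR wt k))) ^ 2 := by
      nlinarith [sq_nonneg (‖g‖ - L * (√n * frob (xErr pR wt k)))]
    rw [e1]
    refine (pow_le_pow_left₀ (norm_nonneg _) e2 2).trans (e3.trans (le_of_eq ?_))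
    rw [← frob_sq, mul_pow, mul_pow, Real.sq_sqrt (Nat.cast_nonneg n)]
    ring
  have h3 : 1 + 2 * (n : ℝ) * L ^ 2 ≤ 2 * (n : ℝ) ^ 2 * (1 + L ^ 2) := by
    have t1 : (n : ℝ) ≤ (n : ℝ) ^ 2 := by nlinarith
    have t2 : (n : ℝ) * L ^ 2 ≤ (n : ℝ) ^ 2 * L ^ 2 := by gcongr
    nlinarith
  have h4 := mul_le_mul_of_nonneg_right h3
    (show 0 ≤ ∑ i, ‖xErr pR wt k i‖ ^ 2 from Finset.sum_nonneg fun _ _ => sq_nonneg _)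
  unfold kktResidual
  linarith

lemma IsRun.sum_sub_optimal_sq_le (h : IsRun R C F d α ew es wt w s wh sh) (hn : 0 < n)
    (hL : 0 < L) (hF : ∀ i, Differentiable ℝ (F i))
    (hk : ∀ i, StrongConvexOn Set.univ (1 / L) (F i)) {W : Fin n → EuclideanSpace ℝ (Fin m)}
    (hW : IsOptimal F d W) (k : ℕ) :
    ∑ i, ‖w k i - W i‖ ^ 2
      ≤ 4 * L * dualGap F d (xbar pR wt k) + 2 * L ^ 2 * frob (xErr pR wt k) ^ 2 := by
  set x := xbar pR wt k with hx
  have h1 := sum_primal_sub_optimal_sq_le hn hL hF hk hW x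
  have h2 : ∀ i, ‖w k i - W i‖ ^ 2
      ≤ 2 * (L ^ 2 * ‖xErr pR wt k i‖ ^ 2) + 2 * ‖primal F x i - W i‖ ^ 2 := fun i => by
    have t1 := norm_sub_primal_le hL hF hk x i (w k i)
    rw [h.gradient_eq hF] at t1
    have t2 := norm_sub_le_norm_sub_add_norm_sub (w k i) (primal F x i) (W i)
    have t3 := pow_le_pow_left₀ (norm_nonneg _) t2 2
    have t4 := pow_le_pow_left₀ (norm_nonneg _) t1 2
    rw [mul_pow] at t4
    have e : ‖xErr pR wt k i‖ = ‖-wt k i - x‖ := rfl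
    rw [e]
    nlinarith [sq_nonneg (‖w k i - primal F x i‖ - ‖primal F x i - W i‖)]
  calc ∑ i, ‖w k i - W i‖ ^ 2
      ≤ ∑ i, (2 * (L ^ 2 * ‖xErr pR wt k i‖ ^ 2) + 2 * ‖primal F x i - W i‖ ^ 2) :=
        Finset.sum_le_sum fun i _ => h2 i
    _ = 2 * (L ^ 2 * frob (xErr pR wt k) ^ 2) + 2 * ∑ i, ‖primal F x i - W i‖ ^ 2 := by
        rw [Finset.sum_add_distrib, ← Finset.mul_sum, ← Finset.mul_sum, ← Finset.mul_sum, frob_sq]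
    _ ≤ _ := by linarith

/-- All dual estimates start at zero, so the initial Lyapunov value contains no consensus term,
whose weight depends on `L`. -/
lemma IsRun.xErr_zero (h : IsRun R C F d α ew es wt w s wh sh) : xErr pR wt 0 = 0 := by
  ext1 i
  simp [xErr, xbar, h.wt_init]

end Residual

lemma vecNorm_pos {n : ℕ} {T : Matrix (Fin n) (Fin n) ℝ} (hT : IsUnit T.det) {x : Fin n → ℝ}
    (hx : x ≠ 0) : 0 < vecNorm T x := by
  refine (l2_nonneg _).lt_of_ne fun h => hx ?_
  have h1 := l2_eq_zero.1 h.symm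
  by_contra h0
  exact hT.ne_zero (Matrix.exists_mulVec_eq_zero_iff.1 ⟨x, h0, h1⟩)

lemma l2_le_matOp_inv_mul {n : ℕ} {T : Matrix (Fin n) (Fin n) ℝ} (hT : IsUnit T.det)
    (x : Fin n → ℝ) : l2 x ≤ matOp T⁻¹ * vecNorm T x := by
  have := l2_mulVec_le T⁻¹ (T.mulVec x)
  rwa [Matrix.mulVec_mulVec, Matrix.nonsing_inv_mul T hT, Matrix.one_mulVec] at this

lemma vecNorm_smul {n : ℕ} (T : Matrix (Fin n) (Fin n) ℝ) {t : ℝ} (ht : 0 < t) (x : Fin n → ℝ) :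
    vecNorm (t • T) x = t * vecNorm T x := by
  rw [vecNorm, Matrix.smul_mulVec, l2_smul, abs_of_pos ht, vecNorm]

end ETDGT

end

noncomputable section

namespace ETDGT

/-! ## The scaled contraction norms -/

section Network

variable {n : ℕ} {R C : Matrix (Fin n) (Fin n) ℝ} {pR pC : Fin n → ℝ} {ε : ℝ}
  {TR TC : Matrix (Fin n) (Fin n) ℝ}

lemma ones_ne_zero (hn : 0 < n) : (fun _ => 1 : Fin n → ℝ) ≠ 0 := fun h =>
  one_ne_zero (congrFun h ⟨0, hn⟩)

/-- Signs of the equivalence constants and `δRC δCR ≥ 1` follow by testing the inequalities on one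
nonzero vector. -/
lemma EquivConsts.valid {a b p q L : ℝ} (he : EquivConsts TR TC a b p q)
    (hT : ContractionNorms R C pR pC ε TR TC) (hp : PerronPair R C pR pC) (hn : 0 < n)
    (hL : 0 < L) :
    Data.Valid { n := n, L := L, σR := opNorm TR (devR R pR), σC := opNorm TC (devC C pC),
                 δRC := a, δCR := b, δ2R := p, δ2C := q, ϖ := ∑ i, pC i * pR i } := by
  have h1 := ones_ne_zero hn
  set x : Fin n → ℝ := fun _ => 1
  have hR := vecNorm_pos hT.TR_inv h1
  have hC := vecNorm_pos hT.TC_inv h1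
  have h2 : 0 < l2 x := hR.trans_le (hT.R_le x)
  have hb := pos_of_mul_pos_left (hC.trans_le (he.CR x)) hR.le
  have ha := pos_of_mul_pos_left (hR.trans_le (he.RC x)) hC.le
  have hR1 : ∀ i, pR i ≤ 1 := fun i => hp.R_sum ▸
    Finset.single_le_sum (fun j _ => hp.R_nonneg j) (Finset.mem_univ i)
  refine ⟨Nat.one_le_cast.2 hn, hL, norm_nonneg _, hT.R_contr, norm_nonneg _, hT.C_contr, ha, hb,
    pos_of_mul_pos_left (h2.trans_le (he.twoR x)) hR.le,
    pos_of_mul_pos_left (h2.trans_le (he.twoC x)) hC.le, ?_,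
    show 0 ≤ ∑ i, pC i * pR i from
      Finset.sum_nonneg fun i _ => mul_nonneg (hp.C_nonneg i) (hp.R_nonneg i), ?_⟩
  · refine le_of_mul_le_mul_right (a := vecNorm TR x) ?_ hR
    have := mul_le_mul_of_nonneg_left (he.CR x) ha.le
    have := he.RC x
    change 1 * vecNorm TR x ≤ a * b * vecNorm TR x
    linarith
  · calc ∑ i, pC i * pR i ≤ ∑ i, pC i :=
          Finset.sum_le_sum fun i _ => mul_le_of_le_one_right (hp.C_nonneg i) (hR1 i)
      _ = 1 := hp.C_sum

/-- On a nonzero vector `‖·‖_TC ≤ ‖·‖₂ ≤ q t ‖·‖_TC`. Thus every admissible `δ2C` is at least `1 /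
t`. -/
lemma EquivConsts.one_le_mul_scale {a b p q t : ℝ} (ht : 0 < t)
    (he : EquivConsts (t • TR) (t • TC) a b p q) (hT : ContractionNorms R C pR pC ε TR TC)
    (hn : 0 < n) : 1 ≤ q * t := by
  have h1 := ones_ne_zero hn
  set x : Fin n → ℝ := fun _ => 1
  have hC := vecNorm_pos hT.TC_inv h1
  have h2 := he.twoC x
  rw [vecNorm_smul TC ht] at h2
  refine le_of_mul_le_mul_right (a := vecNorm TC x) ?_ hC
  linarith [hT.C_le x]

/-- The common factor `t` cancels, so `δCR` has a lower bound independent of the scale. -/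
lemma EquivConsts.one_le_mul_of_matOp_inv_le {a b p q t M : ℝ} (ht : 0 < t)
    (he : EquivConsts (t • TR) (t • TC) a b p q) (hT : ContractionNorms R C pR pC ε TR TC)
    (hn : 0 < n) (hM : matOp TC⁻¹ ≤ M) : 1 ≤ b * M := by
  have h1 := ones_ne_zero hn
  set x : Fin n → ℝ := fun _ => 1
  have hR := vecNorm_pos hT.TR_inv h1
  have hC := vecNorm_pos hT.TC_inv h1
  have h2 := he.CR x
  rw [vecNorm_smul TC ht, vecNorm_smul TR ht] at h2
  have h3 : vecNorm TC x ≤ b * vecNorm TR x := le_of_mul_le_mul_left (by linarith) ht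
  have hM0 : 0 ≤ M := (matOp_nonneg _).trans hM
  refine le_of_mul_le_mul_right (a := vecNorm TR x) ?_ hR
  have h4 := l2_le_matOp_inv_mul hT.TC_inv x
  have h5 := mul_le_mul_of_nonneg_right hM hC.le
  have h6 := mul_le_mul_of_nonneg_left h3 hM0
  linarith [hT.R_le x]

lemma one_le_netBound (R C : Matrix (Fin n) (Fin n) ℝ) (pR pC : Fin n → ℝ)
    (TR TC : Matrix (Fin n) (Fin n) ℝ) : 1 ≤ netBound R C pR pC TR TC := by
  unfold netBound
  linarith [Real.sqrt_nonneg (n : ℝ), matOp_nonneg (projR pR), matOp_nonneg (projC pC),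
    matOp_nonneg (R - 1), matOp_nonneg (C - 1), matOp_nonneg TR⁻¹, matOp_nonneg TC⁻¹]

lemma matOp_inv_le_netBound (R C : Matrix (Fin n) (Fin n) ℝ) (pR pC : Fin n → ℝ)
    (TR TC : Matrix (Fin n) (Fin n) ℝ) :
    matOp TR⁻¹ ≤ netBound R C pR pC TR TC ∧ matOp TC⁻¹ ≤ netBound R C pR pC TR TC := by
  unfold netBound
  constructor <;>
  linarith [Real.sqrt_nonneg (n : ℝ), matOp_nonneg (projR pR), matOp_nonneg (projC pC),
    matOp_nonneg (R - 1), matOp_nonneg (C - 1), matOp_nonneg TR⁻¹, matOp_nonneg TC⁻¹]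

/-- The rate at which the squared errors contract. -/
def netRate (R C : Matrix (Fin n) (Fin n) ℝ) (pR pC : Fin n → ℝ)
    (TR TC : Matrix (Fin n) (Fin n) ℝ) : ℝ :=
  (1 + max (opNorm TR (devR R pR)) (opNorm TC (devC C pC)) ^ 2) / 2

/-- A bound for the coupling coefficients of the squared errors. -/
def netGain (R C : Matrix (Fin n) (Fin n) ℝ) (pR pC : Fin n → ℝ)
    (TR TC : Matrix (Fin n) (Fin n) ℝ) : ℝ :=
  8 * (1 + 2 / (1 - max (opNorm TR (devR R pR)) (opNorm TC (devC C pC)) ^ 2))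
    * (netBound R C pR pC TR TC ^ 4) ^ 2

lemma ContractionNorms.rate_mem (hT : ContractionNorms R C pR pC ε TR TC) :
    0 ≤ netRate R C pR pC TR TC ∧ netRate R C pR pC TR TC < 1 := by
  have h0 : 0 ≤ max (opNorm TR (devR R pR)) (opNorm TC (devC C pC)) :=
    le_max_of_le_left (norm_nonneg _)
  have h1 : max (opNorm TR (devR R pR)) (opNorm TC (devC C pC)) < 1 :=
    max_lt hT.R_contr hT.C_contr
  unfold netRate
  constructor
  · positivity
  · nlinarith

lemma ContractionNorms.sq_netBound_le (hT : ContractionNorms R C pR pC ε TR TC) :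
    netBound R C pR pC TR TC ^ 2 ≤ netGain R C pR pC TR TC := by
  have h0 : 0 ≤ max (opNorm TR (devR R pR)) (opNorm TC (devC C pC)) :=
    le_max_of_le_left (norm_nonneg _)
  have h1 : max (opNorm TR (devR R pR)) (opNorm TC (devC C pC)) < 1 :=
    max_lt hT.R_contr hT.C_contr
  have hM := one_le_netBound R C pR pC TR TC
  set σ := max (opNorm TR (devR R pR)) (opNorm TC (devC C pC)) with hσ
  have h2 : 0 < 1 - σ ^ 2 := by nlinarith
  have h3 : 0 ≤ 2 / (1 - σ ^ 2) := by positivity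
  unfold netGain
  rw [← hσ, ← pow_mul]
  refine (pow_le_pow_right₀ hM (show 2 ≤ 4 * 2 by norm_num)).trans ?_
  exact le_mul_of_one_le_left (by positivity) (by linarith)

lemma ContractionNorms.one_le_netGain (hT : ContractionNorms R C pR pC ε TR TC) :
    1 ≤ netGain R C pR pC TR TC :=
  (one_le_pow₀ (one_le_netBound R C pR pC TR TC)).trans hT.sq_netBound_le

lemma IsRun.sqBounds {m : ℕ} {F : Fin n → EuclideanSpace ℝ (Fin m) → ℝ}
    {d : Fin n → EuclideanSpace ℝ (Fin m)} {L α : ℝ} {ew es : ℕ → Fin n → ℝ}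
    {wt w s wh sh : ℕ → Fin n → EuclideanSpace ℝ (Fin m)}
    (h : IsRun R C F d α ew es wt w s wh sh) (hnet : Network R C) (hp : PerronPair R C pR pC)
    (hT : ContractionNorms R C pR pC ε TR TC) (hn : 0 < n) (hL : 0 < L)
    (hF : ∀ i, Differentiable ℝ (F i)) (hk : ∀ i, StrongConvexOn Set.univ (1 / L) (F i))
    (hα : 0 < α) (he1 : Antitone (eMax ew es)) (he2 : Summable (eMax ew es)) :
    SqBounds (netRate R C pR pC TR TC) (netGain R C pR pC TR TC) (∑ i, pC i * pR i) L α
      (fun k => matNorm TR (xErr pR wt k)) (fun k => matNorm TC (yErr pC s k))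
      (fun k => ‖∑ i, s k i‖) (fun k => ‖gradient (dual F d) (xbar pR wt k)‖)
      (fun k => dualGap F d (xbar pR wt k)) (eMax ew es) :=
  (h.stepBounds hnet hp hT hn hL hF hk hα he1 he2).sqBounds
    (le_max_of_le_left (norm_nonneg _)) (max_lt hT.R_contr hT.C_contr)
    (one_le_pow₀ (one_le_netBound R C pR pC TR TC)) hL hα

lemma frob_sq_le_netBound {m : ℕ} (hT : ContractionNorms R C pR pC ε TR TC)
    (X : Fin n → EuclideanSpace ℝ (Fin m)) :
    frob X ^ 2 ≤ netBound R C pR pC TR TC ^ 2 * matNorm TR X ^ 2 := by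
  rw [← mul_pow]
  refine pow_le_pow_left₀ (frob_nonneg X) ((frob_le_matNorm hT.TR_inv X).trans ?_) 2
  exact mul_le_mul_of_nonneg_right (matOp_inv_le_netBound R C pR pC TR TC).1 (matNorm_nonneg _ _)

end Network

/-- The factor `t` is so small that contraction norms scaled by it make the step-size conditions
and the constants of the convergence estimates dominate those of the Lyapunov function. -/
structure SmallScale (n M ρ c a B τ S t : ℝ) : Prop where
  pos : 0 < t
  le_one : t ≤ 1
  le_sum : t ≤ (1 - ρ) ^ 2 / (20 * c ^ 3)
  le_τ : n * t ≤ 2 * τ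
  le_S : S * t ≤ 1
  le_init : (1 + B) * (2 * n ^ 2) * t ≤ 1
  le_noise : c * (2 * a + B) * M ^ 2 * (2 * n ^ 2) * t ≤ 1

/-- Take `t` to be the reciprocal of the sum of all the quantities which it has to beat. -/
lemma exists_smallScale {n M ρ c a B τ S ν : ℝ} (hn : 0 < n) (hρ : ρ < 1) (hc : 1 ≤ c)
    (hw : LyapunovWeights ρ c ν a B τ S) : ∃ t, SmallScale n M ρ c a B τ S t := by
  have hc0 : 0 < c := by linarith
  have ha := hw.a_ge
  have ha0 : 0 < a := by linarith
  have hB := hw.B_pos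
  have hS := hw.S_pos
  have hτ := hw.τ_pos
  have h1ρ : 0 < 1 - ρ := by linarith
  obtain ⟨t, ht⟩ : ∃ t, t = 1 / (1 + 20 * c ^ 3 / (1 - ρ) ^ 2 + n / (2 * τ) + S
      + (1 + B) * (2 * n ^ 2) + c * (2 * a + B) * M ^ 2 * (2 * n ^ 2)) := ⟨_, rfl⟩
  have p1 : 0 ≤ 20 * c ^ 3 / (1 - ρ) ^ 2 := by positivity
  have p2 : 0 ≤ n / (2 * τ) := by positivity
  have p3 : 0 ≤ (1 + B) * (2 * n ^ 2) := by positivity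
  have p4 : 0 ≤ c * (2 * a + B) * M ^ 2 * (2 * n ^ 2) := by positivity
  have ht0 : 0 < t := by rw [ht]; positivity
  have key : ∀ X, X ≤ 1 + 20 * c ^ 3 / (1 - ρ) ^ 2 + n / (2 * τ) + S
      + (1 + B) * (2 * n ^ 2) + c * (2 * a + B) * M ^ 2 * (2 * n ^ 2) → X * t ≤ 1 := fun X hX => by
    rw [ht, mul_one_div, div_le_one (by positivity)]
    exact hX
  refine ⟨t, ht0, ?_, ?_, ?_, key _ (by linarith), key _ (by linarith), key _ (by linarith)⟩
  · simpa using key 1 (by linarith)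
  · have := key (20 * c ^ 3 / (1 - ρ) ^ 2) (by linarith)
    rw [le_div_iff₀ (by positivity)]
    rw [div_mul_eq_mul_div, div_le_one (by positivity)] at this
    linarith
  · have := key (n / (2 * τ)) (by linarith)
    rwa [div_mul_eq_mul_div, div_le_one (by positivity)] at this

/-! ## Convergence rates -/

lemma IsRun.sublinear_bound {n m : ℕ} {R C : Matrix (Fin n) (Fin n) ℝ} {pR pC : Fin n → ℝ}
    {ε L α : ℝ} {TR TC : Matrix (Fin n) (Fin n) ℝ} {F : Fin n → EuclideanSpace ℝ (Fin m) → ℝ}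
    {d : Fin n → EuclideanSpace ℝ (Fin m)} {ew es : ℕ → Fin n → ℝ}
    {wt w s wh sh : ℕ → Fin n → EuclideanSpace ℝ (Fin m)}
    (h : IsRun R C F d α ew es wt w s wh sh) (hnet : Network R C) (hp : PerronPair R C pR pC)
    (hT : ContractionNorms R C pR pC ε TR TC) (hn : 0 < n) (hL : 0 < L)
    (hF : ∀ i, Differentiable ℝ (F i)) (hk : ∀ i, StrongConvexOn Set.univ (1 / L) (F i))
    (hα : 0 < α) (he1 : Antitone (eMax ew es)) (he2 : Summable (eMax ew es))
    (hϖ0 : 0 < ∑ i, pC i * pR i) (hϖ1 : ∑ i, pC i * pR i ≤ 1)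
    (hsmall : α * L ≤ (∑ i, pC i * pR i)
      * ((1 - netRate R C pR pC TR TC) ^ 2 / (20 * netGain R C pR pC TR TC ^ 3))) :
    ∃ K : ℝ, ∀ k : ℕ, 1 ≤ k →
      (1 / (k : ℝ)) * ∑ t ∈ Finset.range k, kktResidual F d w t
        ≤ (2 / (k : ℝ)) * ∑ t ∈ Finset.range k, ‖gradient (dual F d) (xbar pR wt t)‖ ^ 2
          + (2 * (n : ℝ) ^ 2 * (1 + L ^ 2) / (k : ℝ)) * ∑ t ∈ Finset.range k,
              ∑ i, ‖xErr pR wt t i‖ ^ 2 ∧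
      (2 / (k : ℝ)) * ∑ t ∈ Finset.range k, ‖gradient (dual F d) (xbar pR wt t)‖ ^ 2
          + (2 * (n : ℝ) ^ 2 * (1 + L ^ 2) / (k : ℝ)) * ∑ t ∈ Finset.range k,
              ∑ i, ‖xErr pR wt t i‖ ^ 2
        ≤ K / (k : ℝ) := by
  have e0 := eMax_nonneg he1 he2
  -- Monotone and summable thresholds are square-summable: `e_k² ≤ e_0 e_k`.
  have he : Summable fun k => eMax ew es k ^ 2 := by
    refine Summable.of_nonneg_of_le (fun k => sq_nonneg _) (fun k => ?_)
      (he2.mul_left (eMax ew es 0))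
    rw [sq]
    exact mul_le_mul_of_nonneg_right (he1 (Nat.zero_le k)) (e0 k)
  obtain ⟨hρ0, hρ1⟩ := hT.rate_mem
  obtain ⟨B, hB⟩ := (h.sqBounds hnet hp hT hn hL hF hk hα he1 he2).sum_bounded hρ0 hρ1
    hT.one_le_netGain hϖ0 hϖ1 hL hα hsmall he
  have hM := frob_sq_le_netBound (m := m) hT
  set M := netBound R C pR pC TR TC
  refine ⟨2 * B + 2 * (n : ℝ) ^ 2 * (1 + L ^ 2) * (M ^ 2 * B), fun k hk1 => ?_⟩
  have hk0 : 0 < (k : ℝ) := by exact_mod_cast hk1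
  obtain ⟨hg, hx⟩ := hB k
  have e : (2 / (k : ℝ)) * ∑ t ∈ Finset.range k, ‖gradient (dual F d) (xbar pR wt t)‖ ^ 2
      + (2 * (n : ℝ) ^ 2 * (1 + L ^ 2) / (k : ℝ)) * ∑ t ∈ Finset.range k,
          ∑ i, ‖xErr pR wt t i‖ ^ 2
      = (2 * ∑ t ∈ Finset.range k, ‖gradient (dual F d) (xbar pR wt t)‖ ^ 2
        + 2 * (n : ℝ) ^ 2 * (1 + L ^ 2) * ∑ t ∈ Finset.range k,
          ∑ i, ‖xErr pR wt t i‖ ^ 2) / k := by ring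
  rw [e]
  constructor
  · rw [one_div_mul_eq_div]
    refine div_le_div_of_nonneg_right ?_ hk0.le
    rw [Finset.mul_sum, Finset.mul_sum, ← Finset.sum_add_distrib]
    exact Finset.sum_le_sum fun t _ => h.kktResidual_le hn hnet.C_col hL hF hk t
  · refine div_le_div_of_nonneg_right ?_ hk0.le
    have h1 : ∑ t ∈ Finset.range k, ∑ i, ‖xErr pR wt t i‖ ^ 2 ≤ M ^ 2 * B := by
      refine le_trans ?_ (mul_le_mul_of_nonneg_left hx (sq_nonneg M))
      rw [Finset.mul_sum]
      refine Finset.sum_le_sum fun t _ => ?_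
      rw [← frob_sq]
      exact hM _
    have h2 := mul_le_mul_of_nonneg_left h1
      (show 0 ≤ 2 * (n : ℝ) ^ 2 * (1 + L ^ 2) by positivity)
    linarith

lemma abs_le_l2 {q : ℕ} (x : Fin q → ℝ) (i : Fin q) : |x i| ≤ l2 x :=
  PiLp.norm_apply_le (WithLp.toLp 2 x : EuclideanSpace ℝ (Fin q)) i

/-- The Lyapunov function lives in the unscaled norms `TR`, `TC`, while the equivalence constants
and the initial condition on `E` belong to the norms scaled by `t`. Through `δ2C t ≥ 1` the explicit
constants absorb the Lyapunov weights. -/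
lemma IsRun.linear_bound {c : Data} {m : ℕ} {R C : Matrix (Fin c.n) (Fin c.n) ℝ}
    {pR pC : Fin c.n → ℝ} {ε α μ a B τ S t : ℝ} {TR TC : Matrix (Fin c.n) (Fin c.n) ℝ}
    {F : Fin c.n → EuclideanSpace ℝ (Fin m) → ℝ} {d : Fin c.n → EuclideanSpace ℝ (Fin m)}
    {ew es : ℕ → Fin c.n → ℝ} {wt w s wh sh : ℕ → Fin c.n → EuclideanSpace ℝ (Fin m)}
    (h : IsRun R C F d α ew es wt w s wh sh) (hnet : Network R C) (hp : PerronPair R C pR pC)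
    (hT : ContractionNorms R C pR pC ε TR TC) (hc : c.Valid) (hϖ : c.ϖ = ∑ i, pC i * pR i)
    (hF : ∀ i, Differentiable ℝ (F i)) (hk : ∀ i, StrongConvexOn Set.univ (1 / c.L) (F i))
    (he1 : Antitone (eMax ew es)) (he2 : Summable (eMax ew es))
    (hw : LyapunovWeights (netRate R C pR pC TR TC) (netGain R C pR pC TR TC) c.n a B τ S)
    (ht : SmallScale c.n (netBound R C pR pC TR TC) (netRate R C pR pC TR TC)
      (netGain R C pR pC TR TC) a B τ S t)
    (hDt : 1 ≤ c.δ2C * t) (hδM : 1 ≤ c.δCR * netBound R C pR pC TR TC)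
    (hμ : 0 < μ) (hμL : 1 ≤ μ * c.L)
    (hlip : ∀ i v v', ‖gradient (F i) v - gradient (F i) v'‖ ≤ μ * ‖v - v'‖)
    (hstep : c.StepLinear (c.n / μ) α) {ν : Fin 3 → ℝ} (hν : ∀ i, 0 < ν i) {lam : ℝ}
    (hlam0 : 0 ≤ lam) (heig : Matrix.mulVec (c.P₂ (c.n / μ) α) ν = lam • ν) {E q : ℝ}
    (hq : √lam < q) (hq1 : q < 1) (heE : ∀ k, eMax ew es k ≤ E * q ^ k)
    (hE : l2 ![matNorm (t • TR) (xErr pR wt 0) ^ 2, matNorm (t • TC) (yErr pC s 0) ^ 2,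
      dualGap F d (xbar pR wt 0)] * (q ^ 2 - lam) / c.h₇ ≤ E ^ 2)
    {W : Fin c.n → EuclideanSpace ℝ (Fin m)} (hW : IsOptimal F d W) (k : ℕ) :
    ∑ i, ‖w k i - W i‖ ^ 2
      ≤ 2 * √2 * c.L * (c.h₇ * Data.h₈ ν * E ^ 2 * q ^ (2 * k) / (q ^ 2 - lam)) := by
  have hn1 := hc.n_pos
  have hn0 : 0 < (c.n : ℝ) := by linarith
  have hn : 0 < c.n := by exact_mod_cast hn0
  have hL := hc.L_pos
  have hα := hstep.pos
  have hD := hc.δ2C_pos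
  have hq0 : 0 < q := (Real.sqrt_nonneg _).trans_lt hq
  have hgap : 0 < q ^ 2 - lam := by
    have := (Real.sqrt_lt' hq0).1 hq
    linarith
  have hlam1 : lam < 1 := by
    have : q ^ 2 < 1 := by nlinarith
    linarith
  obtain ⟨hρ0, hρ1⟩ := hT.rate_mem
  have hg1 := hT.one_le_netGain
  have hMg := hT.sq_netBound_le
  have hM1 := one_le_netBound R C pR pC TR TC
  have hfrob := frob_sq_le_netBound (m := m) hT (xErr pR wt k)
  have hsq := h.sqBounds hnet hp hT hn hL hF hk hα he1 he2
  rw [← hϖ] at hsq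
  set M := netBound R C pR pC TR TC
  set ρ := netRate R C pR pC TR TC
  set g := netGain R C pR pC TR TC
  have ht0 := ht.pos
  have ha := hw.a_ge
  have ha0 : 0 < a := by linarith
  have hB := hw.B_pos
  have hS := hw.S_pos
  have hD1 : 1 ≤ c.δ2C := by
    have := mul_le_of_le_one_right hD.le ht.le_one
    linarith
  -- the Lyapunov recursion
  have hαL : α * c.L ≤ τ := by
    have h1 := mul_le_mul_of_nonneg_left (hstep.mul_L_le hc hμ hμL) ht0.le
    have h2 := mul_le_mul_of_nonneg_left hDt (show 0 ≤ 2 * (α * c.L) by positivity)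
    linarith [ht.le_τ]
  have hSD : S ≤ 8 * c.n * c.δ2C ^ 2 := by
    have h1 : S ≤ c.δ2C := le_of_mul_le_mul_right (ht.le_S.trans hDt) ht0
    have h2 : c.δ2C ≤ c.δ2C ^ 2 := le_self_pow₀ hD1 (by norm_num)
    have h3 : 1 * c.δ2C ^ 2 ≤ 8 * c.n * c.δ2C ^ 2 := by gcongr; linarith
    linarith
  have hG : 1 + S * c.L ^ 2 ≤ 1 + 8 * c.n * c.L ^ 2 * c.δ2C ^ 2 := by
    have := mul_le_mul_of_nonneg_right hSD (sq_nonneg c.L)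
    linarith
  have hev := hstep.eigenvalue_ge hc hμ hν hlam1 heig
  have hev0 : 1 - 2 * c.n * (α * c.L) ≤ lam := by
    have h1 := Data.PL_mul_le hc hμ hμL hα
    have h2 : 0 ≤ 2 * α ^ 2 * c.L * (1 + 8 * c.n * c.L ^ 2 * c.δ2C ^ 2) := by positivity
    linarith
  have hstepV := hsq.lyapunov_step hw hg1 hn1 hc.ϖ_nonneg hL hα hαL (hstep.le_n hc hμ hμL)
    (fun k => dualGap_le_gradient_sq hn hL hF hk hμ hlip _) hev0 hev hG
  set N := g * (2 * a + B) with hN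
  have hN0 : 0 ≤ N := by positivity
  -- comparison of the constants
  set Q := c.δ2C ^ 3 / (2 * (c.n : ℝ) ^ 2) with hQ
  have hQ0 : 0 < Q := by positivity
  have hQ8 : Q ≤ √2 / 2 * Data.h₈ ν := by
    have h1 := mul_le_mul_of_nonneg_left (hstep.h₈_ge hc hμ hμL hν hlam1 heig)
      (show 0 ≤ √2 / 2 by positivity)
    refine le_trans ?_ h1
    have h2 : 2 ≤ √2 * √3 := by
      rw [← Real.sqrt_mul (by norm_num), Real.le_sqrt (by norm_num) (by norm_num)]
      norm_num
    have h3 := mul_le_mul_of_nonneg_right h2 hQ0.le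
    linarith
  have hDt3 : 1 ≤ c.δ2C ^ 3 * t ^ 3 := by
    rw [← mul_pow]
    exact one_le_pow₀ hDt
  -- The division by `t²` converts the initial tracking error from the scaled to the unscaled norm.
  -- The cubic growth of `Q` in `δ2C ≥ 1 / t` beats it with one power of `t` to spare.
  have hinit : 1 + B / t ^ 2 ≤ Q := by
    have e : 1 + B / t ^ 2 = (t ^ 2 + B) / t ^ 2 := by field_simp
    rw [e, hQ, div_le_div_iff₀ (by positivity) (by positivity)]
    have h1 : t ^ 2 ≤ 1 := pow_le_one₀ ht0.le ht.le_one
    have h2 : (t ^ 2 + B) * (2 * (c.n : ℝ) ^ 2) * t ≤ 1 :=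
      le_trans (by gcongr) ht.le_init
    refine le_of_mul_le_mul_right (a := t) ?_ ht0
    linarith
  have h7 := Data.h₇_ge hc
  have hnoise : N * (1 + c.L ^ 2) ≤ Q * c.h₇ := by
    have h1 : N * M ^ 2 ≤ Q := by
      rw [hQ, le_div_iff₀ (by positivity)]
      have h2 : N * M ^ 2 * (2 * (c.n : ℝ) ^ 2) ≤ c.δ2C :=
        le_of_mul_le_mul_right (ht.le_noise.trans hDt) ht0
      exact h2.trans (le_self_pow₀ hD1 (by norm_num))
    -- The bound `h₇ ≥ 1 + δCR² L²` suffices because `δCR M ≥ 1`. This makes the noise comparison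
    -- uniform in `L`.
    have h2 : 1 + c.L ^ 2 ≤ M ^ 2 * c.h₇ := by
      have t1 : 1 ≤ (c.δCR * M) ^ 2 := one_le_pow₀ hδM
      have t2 : 1 ≤ M ^ 2 := one_le_pow₀ hM1
      have t3 := mul_le_mul_of_nonneg_right t1 (sq_nonneg c.L)
      have t4 := mul_le_mul_of_nonneg_left h7 (sq_nonneg M)
      linarith
    calc N * (1 + c.L ^ 2) ≤ N * (M ^ 2 * c.h₇) := mul_le_mul_of_nonneg_left h2 hN0
      _ = N * M ^ 2 * c.h₇ := by ring
      _ ≤ Q * c.h₇ := mul_le_mul_of_nonneg_right h1 (by linarith [sq_nonneg (c.δCR * c.L)])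
  have h70 : 0 < c.h₇ := by linarith [sq_nonneg (c.δCR * c.L)]
  set Z := c.h₇ * E ^ 2 / (q ^ 2 - lam) with hZ
  have hZ0 : 0 ≤ Z := by positivity
  -- the initial value
  set V : ℕ → ℝ := fun k => dualGap F d (xbar pR wt k)
    + a * (c.L + c.L ^ 2) * matNorm TR (xErr pR wt k) ^ 2 + B * matNorm TC (yErr pC s k) ^ 2
    with hV
  have hV0 : V 0 ≤ √2 / 2 * Data.h₈ ν * Z := by
    have hz1 := abs_le_l2 ![matNorm (t • TR) (xErr pR wt 0) ^ 2,
      matNorm (t • TC) (yErr pC s 0) ^ 2, dualGap F d (xbar pR wt 0)] 1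
    have hz2 := abs_le_l2 ![matNorm (t • TR) (xErr pR wt 0) ^ 2,
      matNorm (t • TC) (yErr pC s 0) ^ 2, dualGap F d (xbar pR wt 0)] 2
    set z := l2 ![matNorm (t • TR) (xErr pR wt 0) ^ 2,
      matNorm (t • TC) (yErr pC s 0) ^ 2, dualGap F d (xbar pR wt 0)]
    simp only [Matrix.cons_val] at hz1 hz2
    have hz1' := (le_abs_self _).trans hz1
    have hz2' := (le_abs_self _).trans hz2
    rw [matNorm_smul ht0.le, mul_pow] at hz1'
    have hzZ : z ≤ Z := by
      rw [hZ, le_div_iff₀ hgap]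
      rw [div_le_iff₀ h70] at hE
      linarith
    have hx0 : matNorm TR (xErr pR wt 0) = 0 := by
      rw [h.xErr_zero]
      simp [matNorm]
    have hy : matNorm TC (yErr pC s 0) ^ 2 ≤ z / t ^ 2 := by
      rw [le_div_iff₀ (by positivity)]
      linarith
    have h1 := mul_le_mul_of_nonneg_left hy hB.le
    have h2 : V 0 ≤ (1 + B / t ^ 2) * z := by
      have e : (1 + B / t ^ 2) * z = z + B * (z / t ^ 2) := by ring
      rw [e, hV]
      simp only [hx0]
      linarith
    have hz0 : 0 ≤ z := l2_nonneg _
    calc V 0 ≤ (1 + B / t ^ 2) * z := h2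
      _ ≤ Q * z := mul_le_mul_of_nonneg_right hinit hz0
      _ ≤ Q * Z := mul_le_mul_of_nonneg_left hzZ hQ0.le
      _ ≤ _ := mul_le_mul_of_nonneg_right hQ8 hZ0
  have hVk : V k ≤ √2 / 2 * Data.h₈ ν * Z * q ^ (2 * k) := by
    refine geometric_bound (D := N * (1 + c.L ^ 2) * E ^ 2) hlam0 hq0.le hV0 ?_ ?_ k
    · have e : √2 / 2 * Data.h₈ ν * Z * (q ^ 2 - lam) = √2 / 2 * Data.h₈ ν * (c.h₇ * E ^ 2) := by
        rw [hZ]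
        field_simp
      rw [e]
      have h1 := mul_le_mul_of_nonneg_right hnoise (sq_nonneg E)
      have h2 := mul_le_mul_of_nonneg_right hQ8 (show 0 ≤ c.h₇ * E ^ 2 by positivity)
      linarith
    · intro j
      refine (hstepV j).trans ?_
      have h1 : eMax ew es j ^ 2 ≤ E ^ 2 * q ^ (2 * j) := by
        have := pow_le_pow_left₀ (eMax_nonneg he1 he2 j) (heE j) 2
        rwa [mul_pow, ← pow_mul, mul_comm j 2] at this
      have h2 := mul_le_mul_of_nonneg_left h1 (show 0 ≤ N * (1 + c.L ^ 2) by positivity)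
      simp only [hV]
      linarith
  -- from the Lyapunov function to the primal error
  have hfin : ∑ i, ‖w k i - W i‖ ^ 2 ≤ 4 * c.L * V k := by
    have h1 := h.sum_sub_optimal_sq_le (pR := pR) hn hL hF hk hW k
    have h2 := mul_le_mul_of_nonneg_left hfrob (show 0 ≤ 2 * c.L ^ 2 by positivity)
    have h3 : 2 * c.L ^ 2 * M ^ 2 ≤ 4 * c.L * (a * (c.L + c.L ^ 2)) := by
      have t1 : c.L ^ 2 * M ^ 2 ≤ c.L ^ 2 * a :=
        mul_le_mul_of_nonneg_left (hMg.trans ha) (sq_nonneg _)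
      have t2 : 0 ≤ a * c.L ^ 3 := by positivity
      have t3 : 0 ≤ a * c.L ^ 2 := by positivity
      linarith
    have h4 := mul_le_mul_of_nonneg_right h3 (sq_nonneg (matNorm TR (xErr pR wt k)))
    have h5 : 0 ≤ 4 * c.L * (B * matNorm TC (yErr pC s k) ^ 2) := by positivity
    simp only [hV]
    linarith
  calc ∑ i, ‖w k i - W i‖ ^ 2 ≤ 4 * c.L * V k := hfin
    _ ≤ 4 * c.L * (√2 / 2 * Data.h₈ ν * Z * q ^ (2 * k)) :=
      mul_le_mul_of_nonneg_left hVk (by positivity)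
    _ = _ := by rw [hZ]; ring

end ETDGT

end

/-! ### Choice of the scaled norms and both rates. -/

theorem theorem4 (n : ℕ) (R C : Matrix (Fin n) (Fin n) ℝ) (hnet : ETDGT.Network R C)
    (pR pC : Fin n → ℝ) (hperron : ETDGT.PerronPair R C pR pC) (ε : ℝ) (hε : 0 < ε) :
    -- contraction norms for the two weight matrices
    ∃ TR TC : Matrix (Fin n) (Fin n) ℝ, ETDGT.ContractionNorms R C pR pC ε TR TC ∧
      ∀ (δRC δCR δ2R δ2C : ℝ), ETDGT.EquivConsts TR TC δRC δCR δ2R δ2C →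
      ∀ (m : ℕ) (F : Fin n → EuclideanSpace ℝ (Fin m) → ℝ)
        (d : Fin n → EuclideanSpace ℝ (Fin m)) (L : ℝ),
      0 < L → (∀ i, Differentiable ℝ (F i)) → (∀ i, StrongConvexOn Set.univ (1 / L) (F i)) →
      ∀ (α : ℝ) (ew es : ℕ → Fin n → ℝ) (wt w s wh sh : ℕ → Fin n → EuclideanSpace ℝ (Fin m)),
      Antitone (ETDGT.eMax ew es) → Summable (ETDGT.eMax ew es) →
      ETDGT.IsRun R C F d α ew es wt w s wh sh →
      ∀ c : ETDGT.Data,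
      c = { n := n, L := L, σR := ETDGT.opNorm TR (ETDGT.devR R pR),
            σC := ETDGT.opNorm TC (ETDGT.devC C pC), δRC := δRC, δCR := δCR,
            δ2R := δ2R, δ2C := δ2C, ϖ := ∑ i, pC i * pR i } →
      -- sublinear rate
      (∀ ψ : ℝ, c.StepSublinear α ψ (ETDGT.matNorm TC (ETDGT.yErr pC s 0)) →
        ∃ K : ℝ, ∀ k : ℕ, 1 ≤ k →
          (1 / (k : ℝ)) * ∑ t ∈ Finset.range k, ETDGT.kktResidual F d w t
            ≤ (2 / (k : ℝ)) * ∑ t ∈ Finset.range k,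
                  ‖gradient (ETDGT.dual F d) (ETDGT.xbar pR wt t)‖ ^ 2
              + (2 * (n : ℝ) ^ 2 * (1 + L ^ 2) / (k : ℝ)) * ∑ t ∈ Finset.range k,
                  ∑ i, ‖ETDGT.xErr pR wt t i‖ ^ 2 ∧
          (2 / (k : ℝ)) * ∑ t ∈ Finset.range k,
                  ‖gradient (ETDGT.dual F d) (ETDGT.xbar pR wt t)‖ ^ 2
              + (2 * (n : ℝ) ^ 2 * (1 + L ^ 2) / (k : ℝ)) * ∑ t ∈ Finset.range k,
                  ∑ i, ‖ETDGT.xErr pR wt t i‖ ^ 2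
            ≤ K / (k : ℝ)) ∧
      -- linear rate, with the Polyak-Łojasiewicz constant n / μ
      (∀ μ : ℝ, 0 < μ →
        (∀ i v v', ‖gradient (F i) v - gradient (F i) v'‖ ≤ μ * ‖v - v'‖) →
        c.StepLinear (n / μ) α →
        (α < 1 → ETDGT.rho (c.P₂ (n / μ) α) < 1) ∧
        ∀ (ν : Fin 3 → ℝ), (∀ i, 0 < ν i) →
          Matrix.mulVec (c.P₂ (n / μ) α) ν = ETDGT.rho (c.P₂ (n / μ) α) • ν →
        ∀ (E q : ℝ), √(ETDGT.rho (c.P₂ (n / μ) α)) < q → q < 1 →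
          (∀ k, ETDGT.eMax ew es k ≤ E * q ^ k) →
          ETDGT.l2 ![ETDGT.matNorm TR (ETDGT.xErr pR wt 0) ^ 2,
                ETDGT.matNorm TC (ETDGT.yErr pC s 0) ^ 2,
                ETDGT.dual F d (ETDGT.xbar pR wt 0) - ⨅ x, ETDGT.dual F d x]
              * (q ^ 2 - ETDGT.rho (c.P₂ (n / μ) α)) / c.h₇ ≤ E ^ 2 →
        ∀ (W : Fin n → EuclideanSpace ℝ (Fin m)), ETDGT.IsOptimal F d W →
        ∀ k : ℕ, ∑ i, ‖w k i - W i‖ ^ 2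
          ≤ 2 * √2 * L * (c.h₇ * ETDGT.Data.h₈ ν * E ^ 2 * q ^ (2 * k)
              / (q ^ 2 - ETDGT.rho (c.P₂ (n / μ) α)))) := by
  obtain ⟨r, -⟩ := hnet.common_root
  have hn : 0 < n := r.pos
  have hn1 : (1 : ℝ) ≤ n := by exact_mod_cast hn
  obtain ⟨TR, TC, hT⟩ := ETDGT.exists_contractionNorms hnet hperron hε
  obtain ⟨hρ0, hρ1⟩ := hT.rate_mem
  obtain ⟨a, B, τ, S, hw⟩ := ETDGT.exists_lyapunovWeights hρ0 hρ1 hT.one_le_netGain hn1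
  obtain ⟨t, ht⟩ := ETDGT.exists_smallScale (n := n) (M := ETDGT.netBound R C pR pC TR TC)
    (by linarith) hρ1 hT.one_le_netGain hw
  have hTt := hT.smul ht.pos ht.le_one
  -- The scale is fixed here, before the costs, the thresholds and the step size are given.
  refine ⟨t • TR, t • TC, hTt, ?_⟩
  intro δRC δCR δ2R δ2C hδ m F d L hL hF hk α ew es wt w s wh sh he1 he2 hrun c hcdef
  have hc : c.Valid := hcdef ▸ hδ.valid hTt hperron hn hL
  have hDt := hδ.one_le_mul_scale ht.pos hT hn
  have hδM := hδ.one_le_mul_of_matOp_inv_le ht.pos hT hn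
    (ETDGT.matOp_inv_le_netBound R C pR pC TR TC).2
  subst hcdef
  refine ⟨fun ψ hstep => ?_, fun μ hμ hlip hstep => ?_⟩
  · have h1 := hstep.mul_lt hc (ETDGT.matNorm_nonneg _ _)
    dsimp only at h1
    have hα := hstep.pos
    have hD2 : 1 ≤ δ2C ^ 2 * t ^ 2 := by
      rw [← mul_pow]
      exact one_le_pow₀ hDt
    -- From `3 α L δ2C² < ϖ` and `δ2C t ≥ 1`, so `α L / ϖ` falls below the Lyapunov threshold.
    have h2 : α * L * 3 ≤ (∑ i, pC i * pR i) * t ^ 2 := by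
      have t1 := mul_le_mul_of_nonneg_left hD2 (show 0 ≤ α * L * 3 by positivity)
      have t2 := mul_le_mul_of_nonneg_right h1.le (sq_nonneg t)
      linarith
    have hϖ : 0 < ∑ i, pC i * pR i := by
      refine lt_of_le_of_lt ?_ h1
      positivity
    refine hrun.sublinear_bound hnet hperron hT hn hL hF hk hα he1 he2 hϖ hc.ϖ_le ?_
    have h3 : t ^ 2 ≤ t := pow_le_of_le_one ht.pos.le ht.le_one (by norm_num)
    have h4 := mul_le_mul_of_nonneg_left (h3.trans ht.le_sum) hϖ.le
    have h5 : 0 < α * L := mul_pos hα hL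
    linarith
  · have hβ : 0 < n / μ := by positivity
    refine ⟨ETDGT.Data.rho_P₂_lt_one hc hβ hstep, ?_⟩
    intro ν hν heig E q hq hq1 heE hE W hW k
    -- In dimension zero `1 ≤ μ L` may fail, but the error vanishes and only non-negativity of the
    -- bound is needed.
    rcases subsingleton_or_nontrivial (EuclideanSpace ℝ (Fin m)) with hm | hm
    · have hq2 := (Real.sqrt_lt' ((Real.sqrt_nonneg _).trans_lt hq)).1 hq
      have h7 := ETDGT.Data.h₇_ge hc
      have h8 := ETDGT.Data.h₈_nonneg hν
      have h0 : ∑ i, ‖w k i - W i‖ ^ 2 = 0 :=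
        Finset.sum_eq_zero fun i _ => by simp [Subsingleton.elim (w k i) (W i)]
      rw [h0]
      have h70 := (add_nonneg zero_le_one (mul_nonneg (sq_nonneg _) (sq_nonneg _))).trans h7
      refine mul_nonneg (by positivity) (div_nonneg ?_ (by linarith))
      rw [pow_mul]
      exact mul_nonneg (mul_nonneg (mul_nonneg h70 h8) (sq_nonneg _)) (pow_nonneg (sq_nonneg _) _)
    · have hμL := ETDGT.one_le_mul_of_gradient_lipschitz (hF r) hL (hk r) (hlip r)
      exact hrun.linear_bound hnet hperron hT hc rfl hF hk he1 he2 hw ht hDt hδM hμ hμL hlip hstep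
        hν (ETDGT.rho_nonneg _) heig hq hq1 heE hE hW k
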